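/- Let $k\ge 4$, let $\Gamma=\langle\gamma\rangle$ be a cyclic group of order $k$, and let $2\le j\le k-2$. \emph{Gain graphs.} A (finite) $\Gamma$-gain graph $(G,\psi)$ is a finite directed multigraph $G$ with a map $\psi:E(G)\to\Gamma$ and a partition $V(G)=V_0(G)\,\dot\cup\,\overline{V(G)}$ into fixed and free vertices with $|V_0(G)|\le 1$, such that: parallel edges $e\neq f$ with the same direction have $\psi(e)\ne\psi(f)$ and parallel edges $e\neq f$ with opposite directions have $\psi(e)\neq\psi(f)^{-1}$ (two loops at a vertex are subject to both conditions); the fixed vertex is incident to no loop and to no parallel edges; loops have gain $\neq\mathrm{id}$. The gain of a walk is the product of the $\psi(e)^{\pm1}$ over its steps, with exponent $+1$ if $e$ is traversed along its direction and $-1$ otherwise. For a connected edge set $X$ let $V(X)$ be the set of its end vertices, $V_0(X)$ the set of fixed vertices in $V(X)$, and $\langle X\rangle\le\Gamma$ the group generated by the gains of the closed walks in $X$ that contain no fixed vertex. $X$ is balanced if $\langle X\rangle$ is trivial. $X$ is near-balanced if $V_0(X)=\emptyset$, $X$ is unbalanced, and there are $v\in V(X)$ and $\delta\in\Gamma$ such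 that every closed walk in $X$ starting at $v$ and not having $v$ as an internal vertex has gain $\mathrm{id}$, $\delta$ or $\delta^{-1}$; it is proper near-balanced if moreover $\langle X\rangle\not\simeq\mathbb Z_2,\mathbb Z_3$. For $i\in\{-1,0,1\}$ let $S_i(k,j)$ be the set of integers $n\ge2$ with $n\mid k$, $j\equiv i\pmod n$, and $n\ne2$ if $j$ is odd. \emph{Gain tightness.} For a connected edge set $X$ put $$\alpha_k^j(X)=\begin{cases}0&\text{if }X\text{ is balanced},\\ 1&\text{if }j\text{ is odd and }\langle X\rangle\simeq\mathbb Z_2,\\ 2-|V_0(X)|&\text{if }\langle X\rangle\simeq\mathbb Z_n\text{ for some }n\in S_{-1}(k,j)\cup S_1(k,j),\\ 2-2|V_0(X)|&\text{if }\langle X\rangle\simeq\mathbb Z_n\text{ for some }n\in S_0(k,j)\text{, or if }X\text{ is proper near-balanced},\\ 3-2|V_0(X)|&\text{otherwise},\end{cases}$$ and for an edge set $F$ put $f_k^j(F)=\sum_X\big(2|V(X)|-3+\alpha_k^j(X)\big)$, where $X$ runs over the connected components of $F$. Then $(G,\psi)$ is $\mathbb Z_k^j$-gain tight if $|F|\le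 f_k^j(F)$ for all non-empty $F\subseteq E(G)$ and $|E(G)|=f_k^j(E(G))$. \emph{1-reductions.} Let $v$ be a free vertex of degree $3$ without a loop. A 1-reduction at $v$ chooses two of the three edges at $v$, say (after redirecting them, with inverted gains, if necessary) $e_1=(v,v_1)$ and $e_2=(v,v_2)$, where $v_1=v_2$ is allowed, deletes $v$ with its three edges, and adds a new edge $(v_1,v_2)$ of gain $\psi(e_1)^{-1}\psi(e_2)$, provided that the result is again a $\Gamma$-gain graph. It is admissible if the result is $\mathbb Z_k^j$-gain tight. \textbf{Theorem.} Let $(G,\psi)$ be a $\mathbb Z_k^j$-gain tight $\Gamma$-gain graph with a free vertex $v$ of degree $3$ without a loop. If there is no admissible 1-reduction at $v$, then $k$ is even, $j$ is odd, $v$ has exactly two neighbours, exactly one of which, say $v_1$, is free, and the $2$-cycle $v,v_1,v$ formed by the two edges between $v$ and $v_1$ has gain $\gamma^{k/2}$. -/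

import Mathlib

/-- A finite `Γ`-gain graph with vertex set `V` and edge set `E`: a directed multigraph with a
gain on every edge and a set `fixed` of at most one vertex. The vertices outside `fixed` are the
free vertices. -/
structure GainGraph (V E Γ : Type*) [Group Γ] where
  /-- the tail of an edge -/
  src : E → V
  /-- the head of an edge -/
  tgt : E → V
  /-- the gain function -/
  gain : E → Γ
  /-- the set of fixed vertices -/
  fixed : Set V
  fixed_subsingleton : fixed.Subsingleton
  /-- parallel edges with the same direction have different gains -/
  gain_ne_of_parallel : ∀ e f, e ≠ f → src e = src f → tgt e = tgt f → gain e ≠ gain f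
  /-- parallel edges with opposite directions do not have inverse gains -/
  gain_ne_of_antiparallel : ∀ e f, e ≠ f → src e = tgt f → tgt e = src f → gain e ≠ (gain f)⁻¹
  /-- a fixed vertex has no loop -/
  fixed_no_loop : ∀ e, src e ∈ fixed → src e ≠ tgt e
  /-- a fixed vertex is not incident to parallel edges -/
  fixed_no_parallel : ∀ e f, (src e ∈ fixed ∨ tgt e ∈ fixed) →
    s(src e, tgt e) = s(src f, tgt f) → e = f
  /-- the gain of a loop is not the identity -/
  loop_gain_ne_one : ∀ e, src e = tgt e → gain e ≠ 1

namespace GainGraph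

section Walks

variable {V E Γ : Type*} [Group Γ] (G : GainGraph V E Γ)

/-- The vertex at which a step starts: the step `(e, true)` traverses `e` along its direction,
the step `(e, false)` against it. -/
def tail : E × Bool → V
  | (e, true) => G.src e
  | (e, false) => G.tgt e

/-- The vertex at which a step ends. -/
def head : E × Bool → V
  | (e, true) => G.tgt e
  | (e, false) => G.src e

/-- The contribution `ψ(e)` or `ψ(e)⁻¹` of a step to the gain of a walk. -/
def stepGain : E × Bool → Γ
  | (e, true) => G.gain e
  | (e, false) => (G.gain e)⁻¹

/-- `G.IsWalk u l w`: the list of steps `l` is a walk from `u` to `w`. -/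
def IsWalk : V → List (E × Bool) → V → Prop
  | u, [], w => u = w
  | u, s :: l, w => G.tail s = u ∧ IsWalk (G.head s) l w

/-- The gain of a walk. -/
def walkGain (l : List (E × Bool)) : Γ := (l.map G.stepGain).prod

/-- The group `⟨F⟩` generated by the gains of the closed walks in the edge set `F` that contain
no fixed vertex. -/
def gainGroup (F : Finset E) : Subgroup Γ :=
  Subgroup.closure {g | ∃ u l, G.IsWalk u l u ∧ (∀ s ∈ l, s.1 ∈ F) ∧
    u ∉ G.fixed ∧ (∀ s ∈ l, G.head s ∉ G.fixed) ∧ G.walkGain l = g}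

/-- The edge set `F` satisfies `⟨F⟩ ≃ ℤ_n`. -/
def HasGroup (F : Finset E) (n : ℕ) : Prop :=
  Nonempty (G.gainGroup F ≃* Multiplicative (ZMod n))

/-- The edge set `F` is balanced. -/
def Balanced (F : Finset E) : Prop := G.gainGroup F = ⊥

/-- `u` and `w` are joined by a walk whose edges lie in `F`. -/
def Reachable (F : Finset E) (u w : V) : Prop :=
  ∃ l, G.IsWalk u l w ∧ ∀ s ∈ l, s.1 ∈ F

open Classical in
/-- The vertices of the subgraph induced by the edge set `F`. -/
noncomputable def verts (F : Finset E) : Finset V := F.image G.src ∪ F.image G.tgt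

open Classical in
/-- The fixed vertices of the subgraph induced by the edge set `F`. -/
noncomputable def fixedVerts (F : Finset E) : Finset V := (G.verts F).filter (· ∈ G.fixed)

open Classical in
/-- The connected components of the edge set `F`, as edge sets. -/
noncomputable def components (F : Finset E) : Finset (Finset E) :=
  F.image fun e => F.filter fun f => G.Reachable F (G.src e) (G.src f)

/-- The edge set `F` (with no fixed vertex) is near-balanced: it is unbalanced and there are a base
vertex `v` and a gain `δ` such that every closed walk in `F` that starts at `v` and does not have
`v` as an internal vertex has gain `1`, `δ` or `δ⁻¹`. -/
def NearBalanced (F : Finset E) : Prop :=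
  G.fixedVerts F = ∅ ∧ ¬ G.Balanced F ∧
    ∃ v ∈ G.verts F, ∃ δ : Γ, ∀ l, G.IsWalk v l v → (∀ s ∈ l, s.1 ∈ F) →
      (∀ s ∈ l.dropLast, G.head s ≠ v) →
      G.walkGain l = 1 ∨ G.walkGain l = δ ∨ G.walkGain l = δ⁻¹

/-- The edge set `F` is proper near-balanced. -/
def ProperNearBalanced (F : Finset E) : Prop :=
  G.NearBalanced F ∧ ¬ G.HasGroup F 2 ∧ ¬ G.HasGroup F 3

end Walks

/-- The set `S_i(k, j)`. -/
def SSet (i : ℤ) (k j : ℕ) : Set ℕ :=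
  {n | 2 ≤ n ∧ n ∣ k ∧ (Odd j → n ≠ 2) ∧ (j : ℤ) ≡ i [ZMOD n]}

section Count

variable {V E Γ : Type*} [Group Γ] (G : GainGraph V E Γ)

/-- The edge set `F` is `S_0(k, j)`. -/
def IsSZero (k j : ℕ) (F : Finset E) : Prop :=
  ∃ n ∈ SSet 0 k j, G.HasGroup F n

/-- The edge set `F` is `S_{±1}(k, j)`. -/
def IsSOne (k j : ℕ) (F : Finset E) : Prop :=
  ∃ n ∈ SSet (-1) k j ∪ SSet 1 k j, G.HasGroup F n

open Classical in
/-- The number `α_k^j(X)` of a connected edge set `X`. -/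
noncomputable def alpha (k j : ℕ) (X : Finset E) : ℤ :=
  if G.Balanced X then 0
  else if Odd j ∧ G.HasGroup X 2 then 1
  else if G.IsSOne k j X then 2 - (G.fixedVerts X).card
  else if G.IsSZero k j X ∨ G.ProperNearBalanced X then 2 - 2 * (G.fixedVerts X).card
  else 3 - 2 * (G.fixedVerts X).card

/-- The function `f_k^j` on edge sets. -/
noncomputable def count (k j : ℕ) (F : Finset E) : ℤ :=
  ∑ X ∈ G.components F, (2 * ((G.verts X).card : ℤ) - 3 + G.alpha k j X)

/-- `ℤ_k^j`-gain sparsity. A subgraph enters the condition only through its edge set. -/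
def GainSparse (k j : ℕ) : Prop :=
  ∀ F : Finset E, F.Nonempty → (F.card : ℤ) ≤ G.count k j F

/-- `ℤ_k^j`-gain tightness. -/
def GainTight [Fintype E] (k j : ℕ) : Prop :=
  G.GainSparse k j ∧ (Fintype.card E : ℤ) = G.count k j Finset.univ

end Count

section Reduction

variable {V E Γ : Type*} [Group Γ] (G : GainGraph V E Γ)

open Classical in
/-- The degree of a vertex; a loop adds 2. -/
noncomputable def degree [Fintype E] (v : V) : ℕ :=
  (Finset.univ.filter fun e => G.src e = v).card + (Finset.univ.filter fun e => G.tgt e = v).card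

/-- The set of neighbours of a vertex. -/
def neighbors (v : V) : Set V := {w | ∃ s, G.tail s = v ∧ G.head s = w}

/-- The edges that are not incident to `v`. -/
abbrev EdgesAway (v : V) : Type _ := {e : E // G.src e ≠ v ∧ G.tgt e ≠ v}

/-- `G.IsOneReduction v G'`: the gain graph `G'` arises from `G` by a 1-reduction at the free
vertex `v`, which has degree 3 and no loop. It chooses two different edges at `v`, traversed from
`v` by the steps `s` to `v₁` and `t` to `v₂`, deletes `v` and its edges, and adds one new edge
(the edge `none` of `G'`) from `v₁` to `v₂` with gain `ψ(s)⁻¹ ψ(t)`. That `G'` is a gain graph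
is part of its type. -/
def IsOneReduction [Fintype E] (v : V)
    (G' : GainGraph {w : V // w ≠ v} (Option (G.EdgesAway v)) Γ) : Prop :=
  v ∉ G.fixed ∧ G.degree v = 3 ∧ (∀ e, ¬ (G.src e = v ∧ G.tgt e = v)) ∧
  (∀ w, w ∈ G'.fixed ↔ (w : V) ∈ G.fixed) ∧
  (∀ e : G.EdgesAway v, (G'.src (some e) : V) = G.src e ∧ (G'.tgt (some e) : V) = G.tgt e ∧
    G'.gain (some e) = G.gain e) ∧
  ∃ s t : E × Bool, s.1 ≠ t.1 ∧ G.tail s = v ∧ G.tail t = v ∧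
    (G'.src none : V) = G.head s ∧ (G'.tgt none : V) = G.head t ∧
    G'.gain none = (G.stepGain s)⁻¹ * G.stepGain t

open Classical in
/-- There is an admissible 1-reduction at `v`: one whose result is again `ℤ_k^j`-gain tight. -/
def HasAdmissibleOneReduction [Fintype E] (k j : ℕ) (v : V) : Prop :=
  ∃ G' : GainGraph {w : V // w ≠ v} (Option (G.EdgesAway v)) Γ,
    G.IsOneReduction v G' ∧ G'.GainTight k j

end Reduction

end GainGraph

/-! For connected `X` the bound `2|V(X)| - 3 + α(X)` equals `2 · #(free vertices of X) - dim X`.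
Here `dim` counts which of the multiples `j - 1`, `j`, `j + 1` turn the gains into differences of a
potential (`j - 1` and `j + 1` only if `X` avoids the fixed vertex). If there are none, `dim` is
still 1 when `X` avoids the fixed vertex and becomes balanced after splitting one vertex, which is
the near-balanced case. Since `dim` does not grow with the edge set, the count may be imposed on all
edge sets without mention of components. This gives `Indep`, equivalent to gain sparsity
(`indep_of_gainSparse`, `gainSparse_of_indep`).

The count is submodular enough (`card_inter_add_le`) to give circuit elimination and hence
augmentation: independent sets form a matroid. The proof glues potentials along the common vertices;
where gluing fails, the intersection splits into parts that are counted separately and has edges to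
spare.

The three possible 1-reductions at `v` add the edges of a triangle on the neighbours of `v`. If
adding one of them to the edges away from `v` is independent, the result is a gain graph
(`toGainGraph`) and is tight (`gainTight_reduction`), because two edges and one free vertex are lost
and the sum of the dimensions does not drop. So without an admissible reduction every triangle edge
is spanned by the edges away from `v`. As these are independent together with the three star edges,
every independent set `K` of triangle edges is independent together with the star
(`union_of_spanned`). Inside the wheel formed by star and triangle this reads `|K| + 3 + dim wheel ≤
2 · #(free vertices of the wheel)` (`card_add_dim_wheel_le`).

A suitable `K` violates this for three distinct neighbours, for a single neighbour, and for two free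
neighbours. With one free and one fixed neighbour it survives only if `j` is odd and the 2-cycle has
gain of order 2. Then the triangle loop is dependent and the wheel has dimension 0. The unique
involution of a cyclic group is `γ ^ (k / 2)`. -/

/-- A labelled directed multigraph with a set of fixed vertices, without any restriction on
parallel edges and loops. -/
structure GainDatum (V U Γ : Type*) where
  /-- the tail of an edge -/
  src : U → V
  /-- the head of an edge -/
  tgt : U → V
  /-- the gain function -/
  gain : U → Γ
  /-- the set of fixed vertices -/
  fixed : Set V

namespace GainDatum

open Classical

/-! ### The component-free count and its independent sets -/

section Basic

variable {V U Γ : Type*} (P : GainDatum V U Γ)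

/-- The free end vertices of the edge set `F`. -/
noncomputable def freeVerts (F : Finset U) : Finset V :=
  (F.image P.src ∪ F.image P.tgt).filter (· ∉ P.fixed)

/-- Some edge of `F` has a fixed end vertex. -/
def Pinned (F : Finset U) : Prop := ∃ e ∈ F, P.src e ∈ P.fixed ∨ P.tgt e ∈ P.fixed

section Ends

variable {P} {F X Y : Finset U}

theorem mem_freeVerts {x : V} :
    x ∈ P.freeVerts F ↔ (∃ e ∈ F, P.src e = x ∨ P.tgt e = x) ∧ x ∉ P.fixed := by
  simp only [freeVerts, Finset.mem_filter, Finset.mem_union, Finset.mem_image]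
  constructor
  · rintro ⟨⟨e, he, h⟩ | ⟨e, he, h⟩, hx⟩
    exacts [⟨⟨e, he, Or.inl h⟩, hx⟩, ⟨⟨e, he, Or.inr h⟩, hx⟩]
  · rintro ⟨⟨e, he, h | h⟩, hx⟩
    exacts [⟨Or.inl ⟨e, he, h⟩, hx⟩, ⟨Or.inr ⟨e, he, h⟩, hx⟩]

theorem src_mem_freeVerts {e : U} (he : e ∈ F) (h : P.src e ∉ P.fixed) :
    P.src e ∈ P.freeVerts F := mem_freeVerts.2 ⟨⟨e, he, Or.inl rfl⟩, h⟩

theorem tgt_mem_freeVerts {e : U} (he : e ∈ F) (h : P.tgt e ∉ P.fixed) :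
    P.tgt e ∈ P.freeVerts F := mem_freeVerts.2 ⟨⟨e, he, Or.inr rfl⟩, h⟩

theorem freeVerts_mono (h : X ⊆ Y) : P.freeVerts X ⊆ P.freeVerts Y := by
  intro x hx
  obtain ⟨⟨e, he, h'⟩, hx⟩ := mem_freeVerts.1 hx
  exact mem_freeVerts.2 ⟨⟨e, h he, h'⟩, hx⟩

theorem freeVerts_union : P.freeVerts (X ∪ Y) = P.freeVerts X ∪ P.freeVerts Y := by
  ext x
  simp only [mem_freeVerts, Finset.mem_union]
  constructor
  · rintro ⟨⟨e, he | he, h⟩, hx⟩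
    exacts [Or.inl ⟨⟨e, he, h⟩, hx⟩, Or.inr ⟨⟨e, he, h⟩, hx⟩]
  · rintro (⟨⟨e, he, h⟩, hx⟩ | ⟨⟨e, he, h⟩, hx⟩)
    exacts [⟨⟨e, Or.inl he, h⟩, hx⟩, ⟨⟨e, Or.inr he, h⟩, hx⟩]

theorem freeVerts_subset_iff {A : Finset V} : P.freeVerts F ⊆ A ↔
    ∀ e ∈ F, (P.src e ∉ P.fixed → P.src e ∈ A) ∧ (P.tgt e ∉ P.fixed → P.tgt e ∈ A) := by
  constructor
  · exact fun h e he => ⟨fun h' => h (src_mem_freeVerts he h'),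
      fun h' => h (tgt_mem_freeVerts he h')⟩
  · intro h x hx
    obtain ⟨⟨e, he, rfl | rfl⟩, hx⟩ := mem_freeVerts.1 hx
    exacts [(h e he).1 hx, (h e he).2 hx]

theorem Pinned.mono (h : X ⊆ Y) (hX : P.Pinned X) : P.Pinned Y := by
  obtain ⟨e, he, h'⟩ := hX
  exact ⟨e, h he, h'⟩

theorem src_free (h : ¬ P.Pinned F) {e : U} (he : e ∈ F) : P.src e ∉ P.fixed :=
  fun h' => h ⟨e, he, Or.inl h'⟩

theorem tgt_free (h : ¬ P.Pinned F) {e : U} (he : e ∈ F) : P.tgt e ∉ P.fixed :=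
  fun h' => h ⟨e, he, Or.inr h'⟩

theorem not_pinned_union (hX : ¬ P.Pinned X) (hY : ¬ P.Pinned Y) : ¬ P.Pinned (X ∪ Y) := by
  rintro ⟨e, he, h⟩
  rcases Finset.mem_union.1 he with he | he
  exacts [hX ⟨e, he, h⟩, hY ⟨e, he, h⟩]

end Ends

variable [AddCommGroup Γ]

/-- The `m`-fold multiples of the gains on `F` come from a potential on the free vertices. -/
def MulBalanced (m : ℕ) (F : Finset U) : Prop :=
  ∃ p : V → Γ, ∀ e ∈ F, P.src e ∉ P.fixed → P.tgt e ∉ P.fixed →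
    m • P.gain e = p (P.tgt e) - p (P.src e)

/-- The potentials `p` and `q` explain the gain of the edge `e`, with a choice between the two at
each end of `e`. -/
def Explains (p q : V → Γ) (e : U) : Prop :=
  ∃ x y, (x = p (P.src e) ∨ x = q (P.src e)) ∧ (y = p (P.tgt e) ∨ y = q (P.tgt e)) ∧
    P.gain e = y - x

/-- The edge set `F` becomes balanced after splitting one vertex into two. -/
def SplitBalanced (F : Finset U) : Prop :=
  ∃ (p q : V → Γ) (b : V), (∀ x, x ≠ b → p x = q x) ∧ ∀ e ∈ F, P.Explains p q e

/-- The indicator of a proposition. -/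
noncomputable def ind (a : Prop) : ℕ := if a then 1 else 0

theorem ind_of {a : Prop} (h : a) : ind a = 1 := if_pos h

theorem ind_of_not {a : Prop} (h : ¬ a) : ind a = 0 := if_neg h

theorem ind_le_one (a : Prop) : ind a ≤ 1 := by
  unfold ind; split_ifs <;> omega

theorem ind_le_ind {a b : Prop} (h : a → b) : ind a ≤ ind b := by
  unfold ind; split_ifs <;> first | omega | tauto

/-- The number of the three characters that are balanced on `F`; two of them require that no edge
is pinned. -/
noncomputable def groupDim (j : ℕ) (F : Finset U) : ℕ :=
  ind (P.MulBalanced j F) + ind (¬ P.Pinned F ∧ P.MulBalanced (j - 1) F) +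
    ind (¬ P.Pinned F ∧ P.MulBalanced (j + 1) F)

/-- The defect of `2 |V|` in the sparsity count. -/
noncomputable def dim (j : ℕ) (F : Finset U) : ℕ :=
  max (P.groupDim j F) (ind (¬ P.Pinned F ∧ P.SplitBalanced F))

/-- The sparsity condition, which makes no reference to connected components. -/
def Indep (j : ℕ) (I : Finset U) : Prop :=
  ∀ F ⊆ I, F.Nonempty → F.card + P.dim j F ≤ 2 * (P.freeVerts F).card

variable {P} {j m : ℕ} {F X Y I : Finset U}

theorem MulBalanced.mono (h : X ⊆ Y) (hY : P.MulBalanced m Y) : P.MulBalanced m X := by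
  obtain ⟨p, hp⟩ := hY
  exact ⟨p, fun e he => hp e (h he)⟩

theorem SplitBalanced.mono (h : X ⊆ Y) (hY : P.SplitBalanced Y) : P.SplitBalanced X := by
  obtain ⟨p, q, b, hb, hp⟩ := hY
  exact ⟨p, q, b, hb, fun e he => hp e (h he)⟩

theorem MulBalanced.smul (h : P.MulBalanced 1 F) (m : ℕ) : P.MulBalanced m F := by
  obtain ⟨p, hp⟩ := h
  refine ⟨fun x => m • p x, fun e he h1 h2 => ?_⟩
  rw [← smul_sub, ← hp e he h1 h2, one_smul]

theorem groupDim_anti (h : X ⊆ Y) : P.groupDim j Y ≤ P.groupDim j X := by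
  have h0 : ∀ m, P.MulBalanced m Y → P.MulBalanced m X := fun m => MulBalanced.mono h
  have h1 : ¬ P.Pinned Y → ¬ P.Pinned X := fun h' h'' => h' (h''.mono h)
  exact Nat.add_le_add (Nat.add_le_add (ind_le_ind (h0 _))
    (ind_le_ind fun h => ⟨h1 h.1, h0 _ h.2⟩)) (ind_le_ind fun h => ⟨h1 h.1, h0 _ h.2⟩)

theorem dim_anti (h : X ⊆ Y) : P.dim j Y ≤ P.dim j X :=
  max_le_max (groupDim_anti h)
    (ind_le_ind fun h' => ⟨fun h'' => h'.1 (h''.mono h), h'.2.mono h⟩)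

theorem groupDim_le_three : P.groupDim j F ≤ 3 :=
  Nat.add_le_add (Nat.add_le_add (ind_le_one _) (ind_le_one _)) (ind_le_one _)

theorem dim_le_three : P.dim j F ≤ 3 :=
  max_le groupDim_le_three ((ind_le_one _).trans (by norm_num))

/-- A potential for `j + 1` minus a potential for `j` is a potential for the gains themselves. -/
theorem dim_eq_three_iff : P.dim j F = 3 ↔ ¬ P.Pinned F ∧ P.MulBalanced 1 F := by
  constructor
  · intro h
    have h3 : P.groupDim j F = 3 := by
      have := ind_le_one (¬ P.Pinned F ∧ P.SplitBalanced F)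
      unfold dim at h
      omega
    unfold groupDim at h3
    have i0 := ind_le_one (P.MulBalanced j F)
    have i1 := ind_le_one (¬ P.Pinned F ∧ P.MulBalanced (j - 1) F)
    have i2 := ind_le_one (¬ P.Pinned F ∧ P.MulBalanced (j + 1) F)
    have h0 : P.MulBalanced j F := by
      by_contra h'
      have := ind_of_not h'
      omega
    have h1 : ¬ P.Pinned F ∧ P.MulBalanced (j + 1) F := by
      by_contra h'
      have := ind_of_not h'
      omega
    refine ⟨h1.1, ?_⟩
    obtain ⟨p, hp⟩ := h0
    obtain ⟨q, hq⟩ := h1.2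
    refine ⟨fun x => q x - p x, fun e he ha hb => ?_⟩
    have e1 := hp e he ha hb
    have e2 := hq e he ha hb
    rw [add_smul, e1] at e2
    grind
  · rintro ⟨h1, h2⟩
    have := h2.smul
    refine le_antisymm dim_le_three (le_max_of_le_left ?_)
    simp [groupDim, h1, this, ind]

theorem dim_eq_three (h1 : ¬ P.Pinned F) (h2 : P.MulBalanced 1 F) : P.dim j F = 3 :=
  dim_eq_three_iff.2 ⟨h1, h2⟩

theorem one_le_dim_of_split (h1 : ¬ P.Pinned F) (h2 : P.SplitBalanced F) : 1 ≤ P.dim j F := by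
  refine le_max_of_le_right ?_
  simp [h1, h2, ind]

theorem one_le_dim_of_mulBalanced (h : P.MulBalanced j F) : 1 ≤ P.dim j F := by
  refine le_max_of_le_left ?_
  rw [groupDim, ind_of h]
  omega

theorem groupDim_le_dim : P.groupDim j F ≤ P.dim j F := le_max_left _ _

theorem Indep.subset (hI : P.Indep j Y) (h : X ⊆ Y) : P.Indep j X :=
  fun F hF => hI F (hF.trans h)

theorem Indep.card_add_le (hI : P.Indep j I) (hF : F ⊆ I) {A : Finset V} {d : ℕ}
    (hA : P.freeVerts F ⊆ A) (hd : F.Nonempty → d ≤ P.dim j F) (hdA : d ≤ 2 * A.card) :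
    F.card + d ≤ 2 * A.card := by
  rcases F.eq_empty_or_nonempty with rfl | hne
  · simpa using hdA
  · have := hI F hF hne
    have := hd hne
    have := Finset.card_le_card hA
    omega

/-- Two disjoint parts of an independent set are counted separately. -/
theorem Indep.card_add_le_of_split (hI : P.Indep j I) {p : U → Prop} {A B : Finset V} {d d' : ℕ}
    (hA : P.freeVerts (I.filter p) ⊆ A) (hB : P.freeVerts (I.filter (¬ p ·)) ⊆ B)
    (hd : (I.filter p).Nonempty → d ≤ P.dim j (I.filter p))
    (hd' : (I.filter (¬ p ·)).Nonempty → d' ≤ P.dim j (I.filter (¬ p ·)))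
    (hdA : d ≤ 2 * A.card) (hdB : d' ≤ 2 * B.card) :
    I.card + d + d' ≤ 2 * A.card + 2 * B.card := by
  have h1 := hI.card_add_le (Finset.filter_subset _ _) hA hd hdA
  have h2 := hI.card_add_le (Finset.filter_subset _ _) hB hd' hdB
  have := Finset.card_filter_add_card_filter_not (s := I) p
  omega

end Basic

end GainDatum

namespace GainDatum

open Classical

/-! ### Disconnected vertex sets -/

section Separation

variable {V U Γ : Type*} {P : GainDatum V U Γ} {I X Y : Finset U} {W A : Finset V}

variable (P) in
/-- No edge of `I` leads from the part `A` of `W` to the rest of `W`. -/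
def Separates (I : Finset U) (W A : Finset V) : Prop :=
  A ⊆ W ∧ A.Nonempty ∧ (W \ A).Nonempty ∧
    ∀ e ∈ I, P.src e ∉ P.fixed → P.tgt e ∉ P.fixed → (P.src e ∈ A ↔ P.tgt e ∈ A)

/-- Otherwise the level set of `s` through `x` is a separation. -/
theorem const_of_not_separates {α : Type*} (h : ¬ ∃ A, P.Separates I W A)
    (hI : P.freeVerts I ⊆ W) (s : V → α)
    (hs : ∀ e ∈ I, P.src e ∉ P.fixed → P.tgt e ∉ P.fixed → P.src e ∈ W → P.tgt e ∈ W →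
      s (P.src e) = s (P.tgt e))
    {x y : V} (hx : x ∈ W) (hy : y ∈ W) : s x = s y := by
  by_contra hne
  refine h ⟨W.filter (s · = s x), Finset.filter_subset _ _, ⟨x, by simp [hx]⟩, ⟨y, ?_⟩, ?_⟩
  · simp [hy, Ne.symm hne]
  · intro e he h1 h2
    have h3 := hI (src_mem_freeVerts he h1)
    have h4 := hI (tgt_mem_freeVerts he h2)
    simp [h3, h4, hs e he h1 h2 h3 h4]

theorem Separates.freeVerts_filter {p : U → Prop} (hp : ∀ e, p e ↔ P.src e ∈ A ∨ P.tgt e ∈ A)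
    (hf : ∀ x ∈ W, x ∉ P.fixed) (h : P.Separates I W A) :
    P.freeVerts (I.filter p) ⊆ A := by
  refine freeVerts_subset_iff.2 fun e he => ?_
  obtain ⟨he, h'⟩ := Finset.mem_filter.1 he
  have := h.2.2.2 e he
  have := hp e
  have h1 : P.src e ∈ A → P.src e ∉ P.fixed := fun h' => hf _ (h.1 h')
  have h2 : P.tgt e ∈ A → P.tgt e ∉ P.fixed := fun h' => hf _ (h.1 h')
  tauto

theorem freeVerts_filter_not {p : U → Prop} (hp : ∀ e, P.src e ∈ A ∨ P.tgt e ∈ A → p e)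
    (hW : P.freeVerts I ⊆ W) : P.freeVerts (I.filter fun e => ¬ p e) ⊆ W \ A := by
  refine freeVerts_subset_iff.2 fun e he => ?_
  obtain ⟨he, h'⟩ := Finset.mem_filter.1 he
  have hw := (freeVerts_subset_iff.1 hW) e he
  have := hp e
  simp only [Finset.mem_sdiff]
  tauto

theorem freeVerts_inter_subset : P.freeVerts (X ∩ Y) ⊆ P.freeVerts X ∩ P.freeVerts Y :=
  Finset.subset_inter (freeVerts_mono Finset.inter_subset_left)
    (freeVerts_mono Finset.inter_subset_right)

theorem not_fixed_of_mem_freeVerts {x : V} (h : x ∈ P.freeVerts X) : x ∉ P.fixed :=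
  (mem_freeVerts.1 h).2

end Separation

/-! ### Gluing potentials along an intersection -/

section Submodular

variable {V U Γ : Type*} [AddCommGroup Γ] {P : GainDatum V U Γ} {j m : ℕ} {F X Y I : Finset U}
  {W A : Finset V} {p q p' q' : V → Γ} {b b' : V}

/-- If both parts carry edges, each of the two counts contributes its own `dim`, which is at least
`dim I`. If one part carries none, its vertices are unused and contribute at least 2. -/
theorem card_add_le_of_separates (hI : P.Indep j I) (hne : I.Nonempty) (hW : P.freeVerts I ⊆ W)
    (hf : ∀ x ∈ W, x ∉ P.fixed) (h : P.Separates I W A) :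
    I.card + P.dim j I + min 2 (P.dim j I) ≤ 2 * W.card := by
  obtain ⟨p, hp⟩ : ∃ p : U → Prop, ∀ e, p e ↔ P.src e ∈ A ∨ P.tgt e ∈ A := ⟨_, fun _ => Iff.rfl⟩
  have hA := h.freeVerts_filter hp hf
  have hB := freeVerts_filter_not (fun e => (hp e).2) hW
  obtain ⟨hAW, hA0, hA0', -⟩ := h
  have hcard := Finset.card_sdiff_add_card_eq_card hAW
  have hA1 := hA0.card_pos
  have hA2 := hA0'.card_pos
  have hsum := Finset.card_filter_add_card_filter_not (s := I) p
  have hd1 := dim_anti (P := P) (j := j) (Finset.filter_subset p I)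
  have hd2 := dim_anti (P := P) (j := j) (Finset.filter_subset (fun e => ¬ p e) I)
  have hc1 := Finset.card_le_card hA
  have hc2 := Finset.card_le_card hB
  rcases (I.filter p).eq_empty_or_nonempty with h1 | h1
  · have : I.filter (fun e => ¬ p e) = I :=
      Finset.filter_true_of_mem fun e he => by simpa using (Finset.filter_eq_empty_iff.1 h1) he
    rw [this] at hc2
    have := hI I subset_rfl hne
    omega
  · have k1 := hI _ (Finset.filter_subset p I) h1
    rcases (I.filter (fun e => ¬ p e)).eq_empty_or_nonempty with h2 | h2
    · rw [h2] at hsum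
      simp only [Finset.card_empty] at hsum
      omega
    · have k2 := hI _ (Finset.filter_subset (fun e => ¬ p e) I) h2
      omega

/-- If both parts of a separation carry edges, or one part without edges has at least two
vertices, then the bound improves. -/
theorem card_add_six_le_of_separates (hI : P.Indep j I)
    (hW : P.freeVerts I ⊆ W) (hf : ∀ x ∈ W, x ∉ P.fixed) (h : P.Separates I W A)
    (h3 : P.dim j I = 3) (hno : ∀ w ∈ W, ¬ (P.freeVerts I ⊆ W.erase w)) :
    I.card + 6 ≤ 2 * W.card := by
  obtain ⟨p, hp⟩ : ∃ p : U → Prop, ∀ e, p e ↔ P.src e ∈ A ∨ P.tgt e ∈ A := ⟨_, fun _ => Iff.rfl⟩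
  have hA := h.freeVerts_filter hp hf
  have hB := freeVerts_filter_not (fun e => (hp e).2) hW
  obtain ⟨hAW, hA0, hA0', -⟩ := h
  have hcard := Finset.card_sdiff_add_card_eq_card hAW
  have hsum := Finset.card_filter_add_card_filter_not (s := I) p
  have hd1 := dim_anti (P := P) (j := j) (Finset.filter_subset p I)
  have hd2 := dim_anti (P := P) (j := j) (Finset.filter_subset (fun e => ¬ p e) I)
  have hc1 := Finset.card_le_card hA
  have hc2 := Finset.card_le_card hB
  rcases (I.filter p).eq_empty_or_nonempty with h1 | h1
  · have : I.filter (fun e => ¬ p e) = I :=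
      Finset.filter_true_of_mem fun e he => by simpa using (Finset.filter_eq_empty_iff.1 h1) he
    rw [this] at hB
    obtain ⟨w, hw⟩ := hA0
    refine absurd (hB.trans fun x hx => ?_) (hno w (hAW hw))
    obtain ⟨hx, hx'⟩ := Finset.mem_sdiff.1 hx
    exact Finset.mem_erase.2 ⟨fun h => hx' (h ▸ hw), hx⟩
  · have k1 := hI _ (Finset.filter_subset p I) h1
    rcases (I.filter (fun e => ¬ p e)).eq_empty_or_nonempty with h2 | h2
    · have : I.filter p = I :=
        Finset.filter_true_of_mem fun e he => by
          simpa using (Finset.filter_eq_empty_iff.1 h2) he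
      rw [this] at hA
      obtain ⟨w, hw⟩ := hA0'
      obtain ⟨hw, hw'⟩ := Finset.mem_sdiff.1 hw
      exact absurd (hA.trans fun x hx => Finset.mem_erase.2
        ⟨fun h : x = w => hw' (h ▸ hx), hAW hx⟩) (hno w hw)
    · have k2 := hI _ (Finset.filter_subset (fun e => ¬ p e) I) h2
      omega

/-- Potentials on two edge sets whose intersection is connected fit together. -/
theorem exists_shift (h : ¬ ∃ A, P.Separates I W A) (hW : P.freeVerts I ⊆ W)
    (hs : ∀ e ∈ I, P.src e ∉ P.fixed → P.tgt e ∉ P.fixed → P.src e ∈ W → P.tgt e ∈ W →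
      p (P.tgt e) - p (P.src e) = p' (P.tgt e) - p' (P.src e)) :
    ∃ s, ∀ x ∈ W, p' x = s + p x := by
  rcases W.eq_empty_or_nonempty with h0 | ⟨x0, hx0⟩
  · exact ⟨0, by simp [h0]⟩
  · refine ⟨p' x0 - p x0, fun x hx => ?_⟩
    have := const_of_not_separates h hW (fun x => p' x - p x) ?_ hx hx0
    · grind
    · intro e he h1 h2 h3 h4
      have := hs e he h1 h2 h3 h4
      grind

/-- After a constant shift the two potentials agree on all common vertices. -/
theorem MulBalanced.union (h : ¬ ∃ A, P.Separates (X ∩ Y) (P.freeVerts X ∩ P.freeVerts Y) A)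
    (hX : P.MulBalanced m X) (hY : P.MulBalanced m Y) : P.MulBalanced m (X ∪ Y) := by
  obtain ⟨p, hp⟩ := hX
  obtain ⟨r, hr⟩ := hY
  obtain ⟨s, hs⟩ := exists_shift (p := p) (p' := r) h freeVerts_inter_subset
    fun e he h1 h2 _ _ => by
      rw [← hp e (Finset.mem_inter.1 he).1 h1 h2, ← hr e (Finset.mem_inter.1 he).2 h1 h2]
  refine ⟨(P.freeVerts X).piecewise p (fun x => r x - s), fun e he h1 h2 => ?_⟩
  have key : ∀ x ∈ P.freeVerts Y, (P.freeVerts X).piecewise p (fun x => r x - s) x = r x - s := by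
    intro x hx
    by_cases hx' : x ∈ P.freeVerts X
    · rw [Finset.piecewise_eq_of_mem _ _ _ hx', hs x (Finset.mem_inter.2 ⟨hx', hx⟩)]
      simp
    · rw [Finset.piecewise_eq_of_notMem _ _ _ hx']
  rcases Finset.mem_union.1 he with he | he
  · rw [Finset.piecewise_eq_of_mem _ _ _ (src_mem_freeVerts he h1),
      Finset.piecewise_eq_of_mem _ _ _ (tgt_mem_freeVerts he h2), hp e he h1 h2]
  · rw [key _ (src_mem_freeVerts he h1), key _ (tgt_mem_freeVerts he h2), hr e he h1 h2]
    simp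

/-- Each of the three indicators is supermodular by itself: its condition passes from either set to
the intersection, and from both sets to the union by gluing. -/
theorem groupDim_supermodular
    (h : ¬ ∃ A, P.Separates (X ∩ Y) (P.freeVerts X ∩ P.freeVerts Y) A) :
    P.groupDim j X + P.groupDim j Y ≤ P.groupDim j (X ∩ Y) + P.groupDim j (X ∪ Y) := by
  have h1 : ∀ m, P.MulBalanced m X → P.MulBalanced m (X ∩ Y) :=
    fun m => MulBalanced.mono Finset.inter_subset_left
  have h2 : ∀ m, P.MulBalanced m Y → P.MulBalanced m (X ∩ Y) :=
    fun m => MulBalanced.mono Finset.inter_subset_right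
  have h3 : ∀ m, P.MulBalanced m X → P.MulBalanced m Y → P.MulBalanced m (X ∪ Y) :=
    fun m => MulBalanced.union h
  have h4 : P.Pinned (X ∩ Y) → P.Pinned X := Pinned.mono Finset.inter_subset_left
  have h5 : P.Pinned (X ∩ Y) → P.Pinned Y := Pinned.mono Finset.inter_subset_right
  have h6 : ¬ P.Pinned X → ¬ P.Pinned Y → ¬ P.Pinned (X ∪ Y) := not_pinned_union
  have key : ∀ a b c d : Prop, (a → c) → (b → c) → (a → b → d) →
      ind a + ind b ≤ ind c + ind d := by
    intro a b c d _ _ _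
    unfold ind
    split_ifs <;> first | omega | tauto
  have k0 := key _ _ _ _ (h1 j) (h2 j) (h3 j)
  have k1 := key (¬ P.Pinned X ∧ P.MulBalanced (j - 1) X) (¬ P.Pinned Y ∧ P.MulBalanced (j - 1) Y)
    (¬ P.Pinned (X ∩ Y) ∧ P.MulBalanced (j - 1) (X ∩ Y))
    (¬ P.Pinned (X ∪ Y) ∧ P.MulBalanced (j - 1) (X ∪ Y))
    (fun h => ⟨mt h4 h.1, h1 _ h.2⟩) (fun h => ⟨mt h5 h.1, h2 _ h.2⟩)
    (fun h h' => ⟨h6 h.1 h'.1, h3 _ h.2 h'.2⟩)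
  have k2 := key (¬ P.Pinned X ∧ P.MulBalanced (j + 1) X) (¬ P.Pinned Y ∧ P.MulBalanced (j + 1) Y)
    (¬ P.Pinned (X ∩ Y) ∧ P.MulBalanced (j + 1) (X ∩ Y))
    (¬ P.Pinned (X ∪ Y) ∧ P.MulBalanced (j + 1) (X ∪ Y))
    (fun h => ⟨mt h4 h.1, h1 _ h.2⟩) (fun h => ⟨mt h5 h.1, h2 _ h.2⟩)
    (fun h h' => ⟨h6 h.1 h'.1, h3 _ h.2 h'.2⟩)
  unfold groupDim
  omega

/-- Gluing two split potentials with the same split vertex. -/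
theorem SplitBalanced.union (hX : ¬ P.Pinned X) (hY : ¬ P.Pinned Y)
    (hb : ∀ x, x ≠ b → p x = q x) (hb' : ∀ x, x ≠ b → p' x = q' x)
    (hpX : ∀ e ∈ X, P.Explains p q e) (hpY : ∀ e ∈ Y, P.Explains p' q' e) (s : Γ)
    (hs : ∀ x ∈ P.freeVerts X ∩ P.freeVerts Y, x ≠ b → p' x = s + p x)
    (hsb : b ∈ P.freeVerts X ∩ P.freeVerts Y → (p' b = s + p b ∨ p' b = s + q b) ∧
      (q' b = s + p b ∨ q' b = s + q b)) :
    P.SplitBalanced (X ∪ Y) := by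
  refine ⟨(P.freeVerts X).piecewise p (fun x => p' x - s),
    (P.freeVerts X).piecewise q (fun x => q' x - s), b, fun x hx => ?_, fun e he => ?_⟩
  · simp only [Finset.piecewise, hb x hx, hb' x hx]
  · set p1 := (P.freeVerts X).piecewise p (fun x => p' x - s) with hp1
    set q1 := (P.freeVerts X).piecewise q (fun x => q' x - s) with hq1
    have key : ∀ x ∈ P.freeVerts Y, (p' x - s = p1 x ∨ p' x - s = q1 x) ∧
        (q' x - s = p1 x ∨ q' x - s = q1 x) := by
      intro x hx
      by_cases hx' : x ∈ P.freeVerts X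
      · simp only [hp1, hq1, Finset.piecewise_eq_of_mem _ _ _ hx']
        by_cases hxb : x = b
        · subst hxb
          have := hsb (Finset.mem_inter.2 ⟨hx', hx⟩)
          grind
        · have e1 := hs x (Finset.mem_inter.2 ⟨hx', hx⟩) hxb
          have e2 := hb' x hxb
          grind
      · simp [hp1, hq1, Finset.piecewise_eq_of_notMem _ _ _ hx']
    rcases Finset.mem_union.1 he with he | he
    · have h1 := src_mem_freeVerts he (src_free hX he)
      have h2 := tgt_mem_freeVerts he (tgt_free hX he)
      obtain ⟨x, y, hx, hy, hg⟩ := hpX e he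
      exact ⟨x, y, by simpa [hp1, hq1, h1] using hx, by simpa [hp1, hq1, h2] using hy, hg⟩
    · have h1 := key _ (src_mem_freeVerts he (src_free hY he))
      have h2 := key _ (tgt_mem_freeVerts he (tgt_free hY he))
      obtain ⟨x, y, hx, hy, hg⟩ := hpY e he
      refine ⟨x - s, y - s, ?_, ?_, by rw [hg]; simp⟩
      · rcases hx with rfl | rfl
        exacts [h1.1, h1.2]
      · rcases hy with rfl | rfl
        exacts [h2.1, h2.2]

end Submodular

end GainDatum

namespace GainDatum

open Classical

section Submodular

variable {V U Γ : Type*} [AddCommGroup Γ] {P : GainDatum V U Γ} {j m : ℕ} {F X Y I : Finset U}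
  {W A : Finset V} {p q p' q' r : V → Γ} {b b' : V}

theorem explains_self {e : U} (h : P.gain e = r (P.tgt e) - r (P.src e)) : P.Explains r r e :=
  ⟨_, _, Or.inl rfl, Or.inl rfl, h⟩

theorem MulBalanced.exists_potential (hF : ¬ P.Pinned F) (h : P.MulBalanced 1 F) :
    ∃ r : V → Γ, ∀ e ∈ F, P.gain e = r (P.tgt e) - r (P.src e) := by
  obtain ⟨r, hr⟩ := h
  exact ⟨r, fun e he => by simpa using hr e he (src_free hF he) (tgt_free hF he)⟩

theorem mulBalanced_one_of (h : ∀ e ∈ F, P.gain e = r (P.tgt e) - r (P.src e)) :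
    P.MulBalanced 1 F := ⟨r, fun e he _ _ => by simpa using h e he⟩

theorem Explains.eq_of_ne (hb : ∀ x, x ≠ b → p x = q x) {e : U} (he : P.Explains p q e)
    (h1 : P.src e ≠ b) (h2 : P.tgt e ≠ b) : P.gain e = p (P.tgt e) - p (P.src e) := by
  obtain ⟨x, y, hx, hy, hg⟩ := he
  have := hb _ h1
  have := hb _ h2
  grind

/-- Two balanced edge sets. -/
theorem splitBalanced_union_of_balanced (hX : ¬ P.Pinned X) (hY : ¬ P.Pinned Y)
    (hXb : P.MulBalanced 1 X) (hYb : P.MulBalanced 1 Y) (hI : P.Indep j (X ∩ Y))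
    (hne : (X ∩ Y).Nonempty)
    (h : P.Separates (X ∩ Y) (P.freeVerts X ∩ P.freeVerts Y) A) :
    P.SplitBalanced (X ∪ Y) ∨
      (X ∩ Y).card + 6 ≤ 2 * (P.freeVerts X ∩ P.freeVerts Y).card := by
  have hf : ∀ x ∈ P.freeVerts X ∩ P.freeVerts Y, x ∉ P.fixed :=
    fun x hx => not_fixed_of_mem_freeVerts (Finset.mem_inter.1 hx).1
  have h3 : P.dim j (X ∩ Y) = 3 := dim_eq_three (fun h => hX (h.mono Finset.inter_subset_left))
    (hXb.mono Finset.inter_subset_left)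
  -- A common vertex `w` that is isolated in `X ∩ Y` is the only way to miss the stronger bound. If
  -- the rest still separates, the bound without `w` leaves room for the two units of `w`.
  by_cases hw : ∃ w ∈ P.freeVerts X ∩ P.freeVerts Y,
      P.freeVerts (X ∩ Y) ⊆ (P.freeVerts X ∩ P.freeVerts Y).erase w
  · obtain ⟨w, hw, hwI⟩ := hw
    by_cases hs : ∃ B, P.Separates (X ∩ Y) ((P.freeVerts X ∩ P.freeVerts Y).erase w) B
    · obtain ⟨B, hB⟩ := hs
      have := card_add_le_of_separates hI hne hwI
        (fun x hx => hf x (Finset.mem_of_mem_erase hx)) hB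
      have h1 := Finset.card_erase_add_one hw
      right
      omega
    · left
      obtain ⟨p, hp⟩ := hXb.exists_potential hX
      obtain ⟨r, hr⟩ := hYb.exists_potential hY
      obtain ⟨s, hs⟩ := exists_shift (p := p) (p' := r) hs hwI fun e he _ _ _ _ => by
        rw [← hp e (Finset.mem_inter.1 he).1, ← hr e (Finset.mem_inter.1 he).2]
      -- The shifted potentials agree on all common vertices except possibly `w`, which is split
      -- into the two values they give it.
      refine SplitBalanced.union (b := w) (p := p) (q := Function.update p w (r w - s))
        (p' := r) (q' := r) hX hY (fun x hx => by simp [hx]) (fun x _ => rfl) (fun e he => ?_)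
        (fun e he => explains_self (hr e he)) s (fun x hx hxw => hs x ?_) (fun _ => ?_)
      · exact ⟨_, _, Or.inl rfl, Or.inl rfl, hp e he⟩
      · exact Finset.mem_erase.2 ⟨hxw, hx⟩
      · simp
  · right
    push Not at hw
    exact card_add_six_le_of_separates hI freeVerts_inter_subset hf h h3 hw

/-- A split balanced and a balanced edge set. -/
theorem splitBalanced_union_of_split_balanced (hX : ¬ P.Pinned X) (hY : ¬ P.Pinned Y)
    (hXs : P.SplitBalanced X) (hYb : P.MulBalanced 1 Y) (hI : P.Indep j (X ∩ Y))
    (h : ¬ ∃ A, P.Separates (X ∩ Y) (P.freeVerts X ∩ P.freeVerts Y) A) :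
    P.SplitBalanced (X ∪ Y) ∨
      (X ∩ Y).card + 4 ≤ 2 * (P.freeVerts X ∩ P.freeVerts Y).card := by
  obtain ⟨p, q, b, hb, hp⟩ := hXs
  obtain ⟨r, hr⟩ := hYb.exists_potential hY
  have hIX : ∀ e ∈ X ∩ Y, e ∈ X := fun e he => (Finset.mem_inter.1 he).1
  have hIY : ∀ e ∈ X ∩ Y, e ∈ Y := fun e he => (Finset.mem_inter.1 he).2
  have hIp : ¬ P.Pinned (X ∩ Y) := fun h => hX (h.mono Finset.inter_subset_left)
  have hends : ∀ e ∈ X ∩ Y, P.src e ∈ P.freeVerts X ∩ P.freeVerts Y ∧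
      P.tgt e ∈ P.freeVerts X ∩ P.freeVerts Y := fun e he =>
    ⟨freeVerts_inter_subset (src_mem_freeVerts he (src_free hIp he)),
      freeVerts_inter_subset (tgt_mem_freeVerts he (tgt_free hIp he))⟩
  set W := P.freeVerts X ∩ P.freeVerts Y with hW
  have glue : ∀ s : Γ, (∀ x ∈ W, x ≠ b → r x = s + p x) →
      (b ∈ W → r b = s + p b ∨ r b = s + q b) → P.SplitBalanced (X ∪ Y) := by
    intro s h1 h2
    exact SplitBalanced.union (b := b) hX hY hb (fun x _ => rfl) hp
      (fun e he => explains_self (hr e he)) s h1 (fun h => ⟨h2 h, h2 h⟩)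
  by_cases hbW : b ∈ W
  · by_cases hc : ∃ x0 ∈ W, ∃ x1 ∈ W, x0 ≠ b ∧ x1 ≠ b ∧ r x0 - p x0 ≠ r x1 - p x1
    · right
      obtain ⟨x0, h0, x1, h1, h0b, h1b, hne⟩ := hc
      -- Off `b` the shift `r - p` is constant along edges, so an edge that meets the level set `A`
      -- stays in `A ∪ {b}`, and the others stay in `W \ A`. Both parts are balanced and only `b` is
      -- counted twice: `|X ∩ Y| + 6 ≤ 2|W| + 2`.
      set A := W.filter (fun x => x ≠ b ∧ r x - p x = r x0 - p x0) with hA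
      have hbA : b ∉ A := by simp [hA]
      have hAW : A ⊆ W := Finset.filter_subset _ _
      obtain ⟨π, hπ⟩ : ∃ π : U → Prop, ∀ e, π e ↔ P.src e ∈ A ∨ P.tgt e ∈ A :=
        ⟨_, fun _ => Iff.rfl⟩
      have hdim : ∀ F ⊆ X ∩ Y, 3 ≤ P.dim j F := fun F hF =>
        (dim_eq_three (fun h => hIp (h.mono hF))
          (hYb.mono (hF.trans Finset.inter_subset_right))).ge
      have hcA : x0 ∈ A := by simp [hA, h0, h0b]
      have hc1 : (insert b A).card = A.card + 1 := Finset.card_insert_of_notMem hbA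
      have hc2 := Finset.card_sdiff_add_card_eq_card hAW
      have hc3 : 2 ≤ (W \ A).card := by
        refine Finset.one_lt_card.2 ⟨b, ?_, x1, ?_, Ne.symm h1b⟩
        · simp [hbW, hbA]
        · simp [h1, hA, Ne.symm hne]
      have hc4 := Finset.card_pos.2 ⟨x0, hcA⟩
      have := hI.card_add_le_of_split (p := π) (A := insert b A) (B := W \ A) (d := 3) (d' := 3)
        (freeVerts_subset_iff.2 fun e he => ?_)
        (freeVerts_filter_not (fun e => (hπ e).2) freeVerts_inter_subset)
        (fun _ => hdim _ (Finset.filter_subset _ _)) (fun _ => hdim _ (Finset.filter_subset _ _))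
        (by omega) (by omega)
      · omega
      · obtain ⟨he, h'⟩ := Finset.mem_filter.1 he
        rw [hπ] at h'
        obtain ⟨k1, k2⟩ := hends e he
        have k3 := hr e (hIY e he)
        have k4 := (hp e (hIX e he)).eq_of_ne hb
        simp only [hA, Finset.mem_insert, Finset.mem_filter] at h' ⊢
        grind
    · push Not at hc
      by_cases hx0 : ∃ x0 ∈ W, x0 ≠ b
      · obtain ⟨x0, h0, h0b⟩ := hx0
        by_cases hsb : r b = r x0 - p x0 + p b ∨ r b = r x0 - p x0 + q b
        · left
          refine glue (r x0 - p x0) (fun x hx hxb => ?_) (fun _ => hsb)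
          have := hc x hx x0 h0 hxb h0b
          grind
        -- If neither copy of `b` fits the common shift, no edge of `X ∩ Y` joins `b` to another
        -- vertex, so `{b}` separates.
        · refine absurd ⟨{b}, by simpa using hbW, by simp, ⟨x0, by simp [h0, h0b]⟩, ?_⟩ h
          intro e he _ _
          obtain ⟨k1, k2⟩ := hends e he
          have k3 := hr e (hIY e he)
          obtain ⟨x, y, hx, hy, hg⟩ := hp e (hIX e he)
          simp only [Finset.mem_singleton]
          have k4 := hc _ k1 x0 h0
          have k5 := hc _ k2 x0 h0
          have k6 := hb (P.src e)
          have k7 := hb (P.tgt e)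
          push Not at hsb
          constructor <;> intro hh <;> by_contra hh' <;> grind
      · left
        push Not at hx0
        exact glue (r b - p b) (fun x hx hxb => absurd (hx0 x hx) hxb) (fun _ => by simp)
  · left
    obtain ⟨s, hs⟩ := exists_shift (p := p) (p' := r) h freeVerts_inter_subset
      fun e he _ _ h1 h2 => by
        rw [← hr e (hIY e he), ← (hp e (hIX e he)).eq_of_ne hb]
        · rintro rfl; exact hbW h1
        · rintro rfl; exact hbW h2
    exact glue s (fun x hx _ => hs x hx) (fun h => absurd h hbW)

end Submodular

end GainDatum

namespace GainDatum

open Classical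

/-! ### Gluing two split potentials -/

section Submodular

variable {V U Γ : Type*} [AddCommGroup Γ] {P : GainDatum V U Γ} {j m : ℕ} {F X Y I : Finset U}
  {W A : Finset V} {p q p' q' r : V → Γ} {b b' : V}

/-- Two split balanced edge sets with different split vertices. -/
theorem card_add_two_le_of_ne (hI : P.Indep j I) (hIp : ¬ P.Pinned I)
    (hW : P.freeVerts I ⊆ W) (hb : ∀ x, x ≠ b → p x = q x) (hb' : ∀ x, x ≠ b' → p' x = q' x)
    (hp : ∀ e ∈ I, P.Explains p q e) (hp' : ∀ e ∈ I, P.Explains p' q' e)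
    (hbW : b ∈ W) (hbW' : b' ∈ W) (hbb : b ≠ b') : I.card + 2 ≤ 2 * W.card := by
  -- On the common edges, `b` has the single value `p' b` in the second potential. Thus an edge that
  -- needs the copy `q b` leads to `b'` or to a vertex of `A`, and an edge between `A` and `b` does
  -- use `q b`. Edges that meet `A` or are not explained by `p` lie in `A ∪ {b, b'}` and have
  -- potential `q`; the others lie in `W \ A` and have potential `p`. Counting gives `|I| + 6 ≤ 2|W|
  -- + 4`.
  set A := W.filter (fun x => x ≠ b ∧ x ≠ b' ∧ p' x - p x = p' b - q b) with hA
  obtain ⟨π, hπ⟩ : ∃ π : U → Prop, ∀ e, π e ↔ ((P.src e ∈ A ∨ P.tgt e ∈ A) ∨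
    P.gain e ≠ p (P.tgt e) - p (P.src e)) := ⟨_, fun _ => Iff.rfl⟩
  have hAW : A ⊆ W := Finset.filter_subset _ _
  have hbA : b ∉ A := by simp [hA]
  have hbA' : b' ∉ A := by simp [hA]
  have hends : ∀ e ∈ I, P.src e ∈ W ∧ P.tgt e ∈ W := fun e he =>
    ⟨hW (src_mem_freeVerts he (src_free hIp he)), hW (tgt_mem_freeVerts he (tgt_free hIp he))⟩
  have hc1 : (insert b (insert b' A)).card = A.card + 2 := by
    rw [Finset.card_insert_of_notMem (by simp [hbb, hbA]), Finset.card_insert_of_notMem hbA']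
  have hc2 := Finset.card_sdiff_add_card_eq_card hAW
  have hc3 : 2 ≤ (W \ A).card :=
    Finset.one_lt_card.2 ⟨b, by simp [hbW, hbA], b', by simp [hbW', hbA'], hbb⟩
  have hpin : ∀ F ⊆ I, ¬ P.Pinned F := fun F hF h => hIp (h.mono hF)
  have := hI.card_add_le_of_split (p := π) (A := insert b (insert b' A)) (B := W \ A) (d := 3)
    (d' := 3) (freeVerts_subset_iff.2 fun e he => ?_)
    (freeVerts_filter_not (fun e h => (hπ e).2 (Or.inl h)) hW)
    (fun _ => (dim_eq_three (hpin _ (Finset.filter_subset _ _))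
      (mulBalanced_one_of (r := q) fun e he => ?_)).ge)
    (fun _ => (dim_eq_three (hpin _ (Finset.filter_subset _ _))
      (mulBalanced_one_of (r := p) fun e he => ?_)).ge)
    (by omega) (by omega)
  · omega
  · obtain ⟨he, h'⟩ := Finset.mem_filter.1 he
    rw [hπ] at h'
    obtain ⟨k1, k2⟩ := hends e he
    obtain ⟨x, y, hx, hy, hg⟩ := hp e he
    obtain ⟨x', y', hx', hy', hg'⟩ := hp' e he
    have := hb (P.src e)
    have := hb (P.tgt e)
    have := hb' (P.src e)
    have := hb' (P.tgt e)
    simp only [hA, Finset.mem_insert, Finset.mem_filter] at h' ⊢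
    by_cases c1 : P.src e = b <;> by_cases c2 : P.tgt e = b <;> by_cases c3 : P.src e = b' <;>
      by_cases c4 : P.tgt e = b' <;> grind
  · obtain ⟨he, h'⟩ := Finset.mem_filter.1 he
    rw [hπ] at h'
    obtain ⟨k1, k2⟩ := hends e he
    obtain ⟨x, y, hx, hy, hg⟩ := hp e he
    obtain ⟨x', y', hx', hy', hg'⟩ := hp' e he
    have := hb (P.src e)
    have := hb (P.tgt e)
    have := hb' (P.src e)
    have := hb' (P.tgt e)
    simp only [hA, Finset.mem_filter] at h'
    by_cases c1 : P.src e = b <;> by_cases c2 : P.tgt e = b <;> by_cases c3 : P.src e = b' <;>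
      by_cases c4 : P.tgt e = b' <;> grind
  · obtain ⟨he, h'⟩ := Finset.mem_filter.1 he
    rw [hπ] at h'
    push Not at h'
    exact h'.2

/-- Two split balanced edge sets with unbalanced intersection. -/
theorem splitBalanced_union_of_split (hX : ¬ P.Pinned X) (hY : ¬ P.Pinned Y)
    (hb : ∀ x, x ≠ b → p x = q x) (hp : ∀ e ∈ X, P.Explains p q e) (h2 : 2 • q b ≠ 2 • p b)
    (hYs : P.SplitBalanced Y) (hI : P.Indep j (X ∩ Y)) (hIu : ¬ P.MulBalanced 1 (X ∩ Y)) :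
    P.SplitBalanced (X ∪ Y) ∨
      (X ∩ Y).card + 2 ≤ 2 * (P.freeVerts X ∩ P.freeVerts Y).card := by
  obtain ⟨p', q', b', hb', hp'⟩ := hYs
  have hIX : ∀ e ∈ X ∩ Y, e ∈ X := fun e he => (Finset.mem_inter.1 he).1
  have hIY : ∀ e ∈ X ∩ Y, e ∈ Y := fun e he => (Finset.mem_inter.1 he).2
  have hIp : ¬ P.Pinned (X ∩ Y) := fun h => hX (h.mono Finset.inter_subset_left)
  have hends : ∀ e ∈ X ∩ Y, P.src e ∈ P.freeVerts X ∩ P.freeVerts Y ∧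
      P.tgt e ∈ P.freeVerts X ∩ P.freeVerts Y := fun e he =>
    ⟨freeVerts_inter_subset (src_mem_freeVerts he (src_free hIp he)),
      freeVerts_inter_subset (tgt_mem_freeVerts he (tgt_free hIp he))⟩
  set W := P.freeVerts X ∩ P.freeVerts Y with hW
  have hbW : b ∈ W := by
    by_contra hbW
    refine hIu (mulBalanced_one_of (r := p) fun e he => (hp e (hIX e he)).eq_of_ne hb ?_ ?_)
    · rintro rfl; exact hbW (hends e he).1
    · rintro rfl; exact hbW (hends e he).2
  have hbW' : b' ∈ W := by
    by_contra hbW'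
    refine hIu (mulBalanced_one_of (r := p') fun e he => (hp' e (hIY e he)).eq_of_ne hb' ?_ ?_)
    · rintro rfl; exact hbW' (hends e he).1
    · rintro rfl; exact hbW' (hends e he).2
  by_cases hbb : b = b'
  swap
  · exact Or.inr (card_add_two_le_of_ne hI hIp freeVerts_inter_subset hb hb'
      (fun e he => hp e (hIX e he)) (fun e he => hp' e (hIY e he)) hbW hbW' hbb)
  subst hbb
  -- For one level set of the shift `p' - p` off `b`, the edges meeting it may be balanced. They
  -- then contribute 3 and the remaining split balanced edges contribute 1, with only `b` counted
  -- twice: `|X ∩ Y| + 4 ≤ 2|W| + 2`.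
  by_cases hgood : ∃ x0 ∈ W, x0 ≠ b ∧ P.MulBalanced 1 ((X ∩ Y).filter fun e =>
      (P.src e ≠ b ∧ p' (P.src e) - p (P.src e) = p' x0 - p x0) ∨
      (P.tgt e ≠ b ∧ p' (P.tgt e) - p (P.tgt e) = p' x0 - p x0))
  · right
    obtain ⟨x0, h0, h0b, hbal⟩ := hgood
    set A := W.filter (fun x => x ≠ b ∧ p' x - p x = p' x0 - p x0) with hA
    obtain ⟨π, hπ⟩ : ∃ π : U → Prop, ∀ e, π e ↔
      ((P.src e ≠ b ∧ p' (P.src e) - p (P.src e) = p' x0 - p x0) ∨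
      (P.tgt e ≠ b ∧ p' (P.tgt e) - p (P.tgt e) = p' x0 - p x0)) := ⟨_, fun _ => Iff.rfl⟩
    simp only [← hπ] at hbal
    have hAW : A ⊆ W := Finset.filter_subset _ _
    have hbA : b ∉ A := by simp [hA]
    have hc1 : (insert b A).card = A.card + 1 := Finset.card_insert_of_notMem hbA
    have hc2 := Finset.card_sdiff_add_card_eq_card hAW
    have hc3 : 1 ≤ (W \ A).card := Finset.card_pos.2 ⟨b, by simp [hbW, hbA]⟩
    have hc4 : 1 ≤ A.card := Finset.card_pos.2 ⟨x0, by simp [hA, h0, h0b]⟩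
    have hpin : ∀ F ⊆ X ∩ Y, ¬ P.Pinned F := fun F hF h => hIp (h.mono hF)
    have := hI.card_add_le_of_split (p := π) (A := insert b A) (B := W \ A) (d := 3)
      (d' := 1) (freeVerts_subset_iff.2 fun e he => ?_)
      (freeVerts_filter_not (fun e h => (hπ e).2 ?_) freeVerts_inter_subset)
      (fun _ => (dim_eq_three (hpin _ (Finset.filter_subset _ _)) hbal).ge)
      (fun _ => one_le_dim_of_split (hpin _ (Finset.filter_subset _ _))
        ⟨p, q, b, hb, fun e he => hp e (hIX e (Finset.filter_subset _ _ he))⟩)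
      (by omega) (by omega)
    · omega
    · obtain ⟨he, h'⟩ := Finset.mem_filter.1 he
      rw [hπ] at h'
      obtain ⟨k1, k2⟩ := hends e he
      have k3 := (hp e (hIX e he)).eq_of_ne hb
      have k4 := (hp' e (hIY e he)).eq_of_ne hb'
      simp only [hA, Finset.mem_insert, Finset.mem_filter]
      grind
    · simp only [hA, Finset.mem_filter] at h
      tauto
  · left
    push Not at hgood
    -- If the edges at the level set of `x0` are unbalanced, both copies of `b` are used by them, so
    -- the shift at `x0` carries the pair `p b, q b` onto the pair `p' b, q' b`.
    have hstep : ∀ x0 ∈ W, x0 ≠ b →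
        (p' x0 - p x0 + p b = p' b ∧ p' x0 - p x0 + q b = q' b) ∨
        (p' x0 - p x0 + p b = q' b ∧ p' x0 - p x0 + q b = p' b) := by
      intro x0 h0 h0b
      have hno := hgood x0 h0 h0b
      have n1 := mt (mulBalanced_one_of (r := p)) hno
      have n2 := mt (mulBalanced_one_of (r := q)) hno
      push Not at n1 n2
      obtain ⟨e1, he1, g1⟩ := n1
      obtain ⟨e2, he2, g2⟩ := n2
      obtain ⟨he1, c1⟩ := Finset.mem_filter.1 he1
      obtain ⟨he2, c2⟩ := Finset.mem_filter.1 he2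
      have s1 : p' x0 - p x0 + q b = p' b ∨ p' x0 - p x0 + q b = q' b := by
        obtain ⟨x, y, hx, hy, hg⟩ := hp e1 (hIX e1 he1)
        obtain ⟨x', y', hx', hy', hg'⟩ := hp' e1 (hIY e1 he1)
        have := hb (P.src e1)
        have := hb (P.tgt e1)
        have := hb' (P.src e1)
        have := hb' (P.tgt e1)
        by_cases c3 : P.src e1 = b <;> by_cases c4 : P.tgt e1 = b <;> grind
      have s2 : p' x0 - p x0 + p b = p' b ∨ p' x0 - p x0 + p b = q' b := by
        obtain ⟨x, y, hx, hy, hg⟩ := hp e2 (hIX e2 he2)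
        obtain ⟨x', y', hx', hy', hg'⟩ := hp' e2 (hIY e2 he2)
        have := hb (P.src e2)
        have := hb (P.tgt e2)
        have := hb' (P.src e2)
        have := hb' (P.tgt e2)
        by_cases c3 : P.src e2 = b <;> by_cases c4 : P.tgt e2 = b <;> grind
      have : q b ≠ p b := fun h => h2 (by rw [h])
      grind
    by_cases hx0 : ∃ x0 ∈ W, x0 ≠ b
    · obtain ⟨x0, h0, h0b⟩ := hx0
      refine SplitBalanced.union (b := b) hX hY hb hb' hp hp' (p' x0 - p x0) (fun x hx hxb => ?_)
        (fun _ => ?_)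
      -- Two different shifts would swap the two copies relative to each other, which forces `2 • q
      -- b = 2 • p b`.
      · have k1 := hstep x0 h0 h0b
        have k2 := hstep x hx hxb
        grind
      · have k1 := hstep x0 h0 h0b
        grind
    · push Not at hx0
      have n1 := mt (mulBalanced_one_of (r := p)) hIu
      push Not at n1
      obtain ⟨e, he, hge⟩ := n1
      obtain ⟨x, y, hx, hy, hg⟩ := hp e (hIX e he)
      obtain ⟨x', y', hx', hy', hg'⟩ := hp' e (hIY e he)
      rw [hx0 _ (hends e he).1, hx0 _ (hends e he).2] at *
      -- Here `b` is the only common vertex, so the unbalanced edge is a loop at `b`; its gain is,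
      -- up to sign, the difference of the two copies in both potentials.
      have : ∃ s, (p' b = s + p b ∨ p' b = s + q b) ∧ (q' b = s + p b ∨ q' b = s + q b) := by
        by_cases hh : q b - p b = q' b - p' b
        · exact ⟨p' b - p b, by grind⟩
        · exact ⟨p' b - q b, by grind⟩
      obtain ⟨s, hs⟩ := this
      exact SplitBalanced.union (b := b) hX hY hb hb' hp hp' s
        (fun x hx hxb => absurd (hx0 x hx) hxb) (fun _ => hs)

/-- A split balanced edge set on which a multiple of the gains is balanced. -/
theorem mulBalanced_of_split (hF : ¬ P.Pinned F) (hb : ∀ x, x ≠ b → p x = q x)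
    (hp : ∀ e ∈ F, P.Explains p q e) (hm : P.MulBalanced m F) (h1 : ¬ P.MulBalanced 1 F) :
    m • p b = m • q b := by
  by_contra hne
  obtain ⟨r, hr⟩ := hm
  obtain ⟨f, hf⟩ : ∃ f : Γ → Γ, ∀ x, m • x = f x := ⟨_, fun _ => rfl⟩
  simp only [hf] at hne
  -- The quantity `r x - f (p x)` is constant along edges off `b`, and at an edge to `b` it tells
  -- which copy of `b` is used, as `f (p b) ≠ f (q b)`. Vertices attached through `q b` are shifted
  -- by `p b - q b`, which makes `p` a potential for all of `F`.
  refine h1 (mulBalanced_one_of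
    (r := fun x => if x = b ∨ r x - f (p x) = r b - f (p b) then p x else p x + p b - q b)
    fun e he => ?_)
  have k := hr e he (src_free hF he) (tgt_free hF he)
  obtain ⟨x, y, hx, hy, hg⟩ := hp e he
  rw [hg, smul_sub, hf, hf] at k
  have k1 := hb (P.src e)
  have k2 := hb (P.tgt e)
  clear hr h1 hp hb hF
  by_cases c1 : P.src e = b <;> by_cases c2 : P.tgt e = b <;> grind

theorem mulBalanced_of_smul_eq (hb : ∀ x, x ≠ b → p x = q x)
    (hp : ∀ e ∈ F, P.Explains p q e) (h : m • p b = m • q b) : P.MulBalanced m F := by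
  refine ⟨fun x => m • p x, fun e he _ _ => ?_⟩
  have key : ∀ x, m • q x = m • p x := fun x => by
    by_cases hx : x = b
    · rw [hx, h]
    · rw [hb x hx]
  obtain ⟨x, y, hx | hx, hy | hy, hg⟩ := hp e he <;> simp [hg, hx, hy, smul_sub, key]

/-- One of `j` and `j - 1` is even, and that multiple would be balanced if the two copies differed
by an element killed by 2. -/
theorem two_smul_ne_of_groupDim_eq_zero (hj : 1 ≤ j) (hF : ¬ P.Pinned F)
    (hb : ∀ x, x ≠ b → p x = q x) (hp : ∀ e ∈ F, P.Explains p q e) (h0 : P.groupDim j F = 0) :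
    2 • q b ≠ 2 • p b := by
  intro h
  unfold groupDim at h0
  rcases Nat.even_or_odd' j with ⟨c, hc | hc⟩
  · have : P.MulBalanced j F := mulBalanced_of_smul_eq hb hp (by
      rw [hc, mul_comm, mul_smul, mul_smul, h])
    rw [ind_of this] at h0
    omega
  · have : P.MulBalanced (j - 1) F := mulBalanced_of_smul_eq hb hp (by
      rw [show j - 1 = c * 2 by omega, mul_smul, mul_smul, h])
    rw [ind_of (a := ¬ P.Pinned F ∧ P.MulBalanced (j - 1) F) ⟨hF, this⟩] at h0
    omega

end Submodular

end GainDatum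

namespace GainDatum

open Classical

/-! ### The submodular inequality -/

section Submodular

variable {V U Γ : Type*} [AddCommGroup Γ] {P : GainDatum V U Γ} {j m : ℕ} {F X Y I : Finset U}

theorem dim_cases : P.dim j F = P.groupDim j F ∨
    (P.groupDim j F = 0 ∧ P.dim j F = 1 ∧ ¬ P.Pinned F ∧ P.SplitBalanced F) := by
  by_cases h : ¬ P.Pinned F ∧ P.SplitBalanced F
  · unfold dim
    rw [ind_of h]
    by_cases h0 : P.groupDim j F = 0
    · right
      simp [h0, h.1, h.2]
    · left
      omega
  · left
    rw [dim, ind_of_not h]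
    simp

theorem groupDim_pos_of (hF : ¬ P.Pinned F) {m : ℕ} (hm : m = j ∨ m = j - 1 ∨ m = j + 1)
    (h : P.MulBalanced m F) : 0 < P.groupDim j F := by
  unfold groupDim
  rcases hm with rfl | rfl | rfl
  · rw [ind_of h]; omega
  · rw [ind_of (a := ¬ P.Pinned F ∧ P.MulBalanced (j - 1) F) ⟨hF, h⟩]; omega
  · rw [ind_of (a := ¬ P.Pinned F ∧ P.MulBalanced (j + 1) F) ⟨hF, h⟩]; omega

theorem exists_mulBalanced_of_groupDim_pos (h : 0 < P.groupDim j F) :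
    ∃ m, (m = j ∨ m = j - 1 ∨ m = j + 1) ∧ P.MulBalanced m F := by
  by_contra hno
  push Not at hno
  have h0 := ind_of_not (hno j (by simp))
  have h1 := ind_of_not (a := ¬ P.Pinned F ∧ P.MulBalanced (j - 1) F)
    fun h => hno (j - 1) (by simp) h.2
  have h2 := ind_of_not (a := ¬ P.Pinned F ∧ P.MulBalanced (j + 1) F)
    fun h => hno (j + 1) (by simp) h.2
  unfold groupDim at h
  omega

/-- The case in which the dimension of `X` comes only from splitting a vertex. Supermodularity of
`groupDim` gives nothing here, and the gluing lemmas for split potentials take its place. -/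
theorem card_inter_add_le_of_split (hj : 1 ≤ j) (hI : P.Indep j (X ∩ Y)) (hne : (X ∩ Y).Nonempty)
    (h : ¬ ∃ A, P.Separates (X ∩ Y) (P.freeVerts X ∩ P.freeVerts Y) A)
    (h0 : P.groupDim j X = 0) (h1 : P.dim j X = 1) (hX : ¬ P.Pinned X)
    (hXs : P.SplitBalanced X) :
    (X ∩ Y).card + P.dim j X + P.dim j Y ≤
      2 * (P.freeVerts X ∩ P.freeVerts Y).card + P.dim j (X ∪ Y) := by
  have hbase := (hI _ subset_rfl hne).trans
    (Nat.mul_le_mul_left 2 (Finset.card_le_card (freeVerts_inter_subset (P := P))))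
  have hdX := dim_anti (P := P) (j := j) (Finset.inter_subset_left (s₁ := X) (s₂ := Y))
  have hdY := dim_anti (P := P) (j := j) (Finset.inter_subset_right (s₁ := X) (s₂ := Y))
  have hpin : ¬ P.Pinned (X ∩ Y) := fun h => hX (h.mono Finset.inter_subset_left)
  by_cases hb : P.MulBalanced 1 (X ∩ Y)
  · have h3 : P.dim j (X ∩ Y) = 3 := dim_eq_three hpin hb
    by_cases hY3 : P.dim j Y = 3
    · obtain ⟨hYp, hYb⟩ := dim_eq_three_iff.1 hY3
      rcases splitBalanced_union_of_split_balanced hX hYp hXs hYb hI h with h' | h'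
      · have := one_le_dim_of_split (j := j) (not_pinned_union hX hYp) h'
        omega
      · omega
    · have := dim_le_three (P := P) (j := j) (F := Y)
      omega
  · obtain ⟨p, q, b, hpq, hp⟩ := id hXs
    -- A multiple balanced on `Y` is balanced on the unbalanced intersection, hence identifies the
    -- two copies of the split vertex and is balanced on `X` as well.
    have hY0 : P.groupDim j Y = 0 := by
      by_contra hpos
      obtain ⟨m, hm, hmY⟩ := exists_mulBalanced_of_groupDim_pos (Nat.pos_of_ne_zero hpos)
      have hmb := mulBalanced_of_split hpin hpq
        (fun e he => hp e (Finset.inter_subset_left he)) (hmY.mono Finset.inter_subset_right) hb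
      have := groupDim_pos_of hX hm (mulBalanced_of_smul_eq hpq hp hmb)
      omega
    rcases dim_cases (P := P) (j := j) (F := Y) with hY | ⟨-, hY1, hYp, hYs⟩
    · omega
    · rcases splitBalanced_union_of_split hX hYp hpq hp
        (two_smul_ne_of_groupDim_eq_zero hj hX hpq hp h0) hYs hI hb with h' | h'
      · have := one_le_dim_of_split (j := j) (not_pinned_union hX hYp) h'
        omega
      · omega

/-- The submodular inequality behind the circuit elimination property. -/
theorem card_inter_add_le (hj : 1 ≤ j) (hI : P.Indep j (X ∩ Y)) (hne : (X ∩ Y).Nonempty) :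
    (X ∩ Y).card + P.dim j X + P.dim j Y ≤
      2 * (P.freeVerts X ∩ P.freeVerts Y).card + P.dim j (X ∪ Y) := by
  have hdX := dim_anti (P := P) (j := j) (Finset.inter_subset_left (s₁ := X) (s₂ := Y))
  have hdY := dim_anti (P := P) (j := j) (Finset.inter_subset_right (s₁ := X) (s₂ := Y))
  by_cases h : ∃ A, P.Separates (X ∩ Y) (P.freeVerts X ∩ P.freeVerts Y) A
  · obtain ⟨A, hA⟩ := h
    have hX3 := dim_le_three (P := P) (j := j) (F := X)
    have hY3 := dim_le_three (P := P) (j := j) (F := Y)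
    have := card_add_le_of_separates hI hne freeVerts_inter_subset
      (fun x hx => not_fixed_of_mem_freeVerts (Finset.mem_inter.1 hx).1) hA
    -- The separation yields `dim + min 2 dim` of the intersection, which suffices unless both sets
    -- have dimension 3: then it gives 5 and the right side needs one more, from the union or from
    -- the intersection.
    by_cases hX : P.dim j X = 3
    · by_cases hY : P.dim j Y = 3
      · obtain ⟨hXp, hXb⟩ := dim_eq_three_iff.1 hX
        obtain ⟨hYp, hYb⟩ := dim_eq_three_iff.1 hY
        rcases splitBalanced_union_of_balanced hXp hYp hXb hYb hI hne hA with h' | h'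
        · have := one_le_dim_of_split (j := j) (not_pinned_union hXp hYp) h'
          omega
        · omega
      · omega
    · omega
  · rcases dim_cases (P := P) (j := j) (F := X) with hX | ⟨h0, h1, hXp, hXs⟩
    · rcases dim_cases (P := P) (j := j) (F := Y) with hY | ⟨h0, h1, hYp, hYs⟩
      · have := groupDim_supermodular (j := j) h
        have := groupDim_le_dim (P := P) (j := j) (F := X ∩ Y)
        have := groupDim_le_dim (P := P) (j := j) (F := X ∪ Y)
        have := (hI _ subset_rfl hne).trans
          (Nat.mul_le_mul_left 2 (Finset.card_le_card (freeVerts_inter_subset (P := P))))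
        omega
      · have := card_inter_add_le_of_split (X := Y) (Y := X) hj (by rwa [Finset.inter_comm])
          (by rwa [Finset.inter_comm])
          (by rwa [Finset.inter_comm, Finset.inter_comm (P.freeVerts Y)]) h0 h1 hYp hYs
        rw [Finset.inter_comm, Finset.inter_comm (P.freeVerts Y), Finset.union_comm] at this
        omega
    · exact card_inter_add_le_of_split hj hI hne h h0 h1 hXp hXs

end Submodular

/-! ### Circuit elimination and the matroid -/

section Matroid

variable {V U Γ : Type*} [AddCommGroup Γ] {P : GainDatum V U Γ} {j : ℕ}
  {C C' I J K X E₀ S T : Finset U}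

variable (P j) in
/-- A minimal dependent edge set. -/
def Circuit (C : Finset U) : Prop := ¬ P.Indep j C ∧ ∀ D ⊂ C, P.Indep j D

theorem Circuit.card_lt (h : P.Circuit j C) :
    2 * (P.freeVerts C).card < C.card + P.dim j C := by
  obtain ⟨h1, h2⟩ := h
  unfold Indep at h1
  push Not at h1
  obtain ⟨F, hF, hne, hlt⟩ := h1
  rcases hF.eq_or_ssubset with rfl | hss
  · exact hlt
  · exact absurd (h2 F hss F subset_rfl hne) (by omega)

theorem exists_circuit (h : ¬ P.Indep j X) : ∃ C ⊆ X, P.Circuit j C := by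
  induction X using Finset.strongInduction with
  | H X ih =>
    by_cases hX : ∀ D ⊂ X, P.Indep j D
    · exact ⟨X, subset_rfl, h, hX⟩
    · push Not at hX
      obtain ⟨D, hD, hD'⟩ := hX
      obtain ⟨C, hC, hC'⟩ := ih D hD hD'
      exact ⟨C, hC.trans hD.1, hC'⟩

/-- Each circuit exceeds its count by at least one. Submodularity then makes the union exceed its
count by at least two, so it still does after one edge is removed. -/
theorem Circuit.elimination (hj : 1 ≤ j) (hC : P.Circuit j C) (hC' : P.Circuit j C')
    (hne : C ≠ C') {e : U} (he : e ∈ C) (he' : e ∈ C') :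
    ¬ P.Indep j ((C ∪ C').erase e) := by
  intro hI
  have hss : C ∩ C' ⊂ C := by
    refine Finset.inter_subset_left.ssubset_of_ne fun h => ?_
    have hsub : C ⊆ C' := Finset.inter_eq_left.1 h
    exact hC.1 (hC'.2 C (hsub.ssubset_of_ne hne))
  have h1 := card_inter_add_le hj (hC.2 _ hss) ⟨e, Finset.mem_inter.2 ⟨he, he'⟩⟩
  have h2 := hC.card_lt
  have h3 := hC'.card_lt
  have h4 := Finset.card_union_add_card_inter C C'
  have h5 := Finset.card_union_add_card_inter (P.freeVerts C) (P.freeVerts C')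
  rw [← freeVerts_union] at h5
  have h6 := Finset.card_erase_add_one (Finset.mem_union_left C' he)
  have h7 := dim_anti (P := P) (j := j) (Finset.erase_subset e (C ∪ C'))
  have h8 := Finset.card_le_card (freeVerts_mono (P := P) (Finset.erase_subset e (C ∪ C')))
  rcases ((C ∪ C').erase e).eq_empty_or_nonempty with h0 | h0
  -- The inequality for independent sets speaks of non-empty sets only; if nothing is left, both
  -- circuits are `{e}`.
  · apply hne
    have : ∀ D ⊆ C ∪ C', e ∈ D → D = {e} := fun D hD heD =>
      Finset.eq_singleton_iff_unique_mem.2 ⟨heD, fun x hx => by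
        by_contra hxe
        exact Finset.notMem_empty x (h0 ▸ Finset.mem_erase.2 ⟨hxe, hD hx⟩)⟩
    rw [this C Finset.subset_union_left he, this C' Finset.subset_union_right he']
  · have := hI _ subset_rfl h0
    omega

theorem Indep.augment (hj : 1 ≤ j) (hI : P.Indep j I) (hJ : P.Indep j J)
    (hlt : I.card < J.card) : ∃ e ∈ J, e ∉ I ∧ P.Indep j (insert e I) := by
  by_contra hno
  push Not at hno
  -- Among the larger independent sets inside `I ∪ J`, take one that misses as little of `I` as
  -- possible. Exchanging some `f ∈ K \ I` for a missing `e ∈ I` would contradict the choice, so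
  -- each such `f` has a circuit through `e` that avoids `f`. Eliminating `e` from two of these
  -- circuits puts a circuit inside `K`.
  obtain ⟨K, hK, hmin⟩ := Finset.exists_min_image
    ((I ∪ J).powerset.filter fun K => P.Indep j K ∧ I.card < K.card) (fun K => (I \ K).card)
    ⟨J, Finset.mem_filter.2 ⟨Finset.mem_powerset.2 Finset.subset_union_right, hJ, hlt⟩⟩
  simp only [Finset.mem_filter, Finset.mem_powerset] at hK hmin
  obtain ⟨hKsub, hKind, hKcard⟩ := hK
  obtain ⟨g, hgK, hgI⟩ : ∃ g ∈ K, g ∉ I := by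
    by_contra hcon
    push Not at hcon
    have := Finset.card_le_card (fun x hx => hcon x hx : K ⊆ I)
    omega
  obtain ⟨e, heI, heK⟩ : ∃ e ∈ I, e ∉ K := by
    by_contra hcon
    push Not at hcon
    have hgJ : g ∈ J := (Finset.mem_union.1 (hKsub hgK)).resolve_left hgI
    exact hno g hgJ hgI (hKind.subset (Finset.insert_subset hgK hcon))
  have key : ∀ f ∈ K, f ∉ I → ∃ C, P.Circuit j C ∧ C ⊆ (insert e K).erase f := by
    intro f hfK hfI
    have hdep : ¬ P.Indep j ((insert e K).erase f) := by
      intro hind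
      have hc : ((insert e K).erase f).card = K.card := by
        rw [Finset.card_erase_of_mem (Finset.mem_insert_of_mem hfK),
          Finset.card_insert_of_notMem heK]
        simp
      have := hmin ((insert e K).erase f) ⟨?_, hind, by omega⟩
      · have hss : I \ (insert e K).erase f ⊂ I \ K := by
          refine (Finset.ssubset_iff_of_subset fun x hx => ?_).2 ⟨e, ?_, ?_⟩
          · simp only [Finset.mem_sdiff, Finset.mem_erase, Finset.mem_insert] at hx ⊢
            refine ⟨hx.1, fun hxK => hx.2 ⟨?_, Or.inr hxK⟩⟩
            rintro rfl
            exact hfI hx.1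
          · simp [heI, heK]
          · have : e ≠ f := by rintro rfl; exact hfI heI
            simp [this]
        have := Finset.card_lt_card hss
        omega
      · refine (Finset.erase_subset _ _).trans (Finset.insert_subset ?_ hKsub)
        exact Finset.mem_union_left _ heI
    obtain ⟨C, hC, hC'⟩ := exists_circuit hdep
    exact ⟨C, hC', hC⟩
  have hmem : ∀ f C, P.Circuit j C → C ⊆ (insert e K).erase f → e ∈ C := by
    intro f C hC hsub
    by_contra heC
    refine hC.1 (hKind.subset fun x hx => ?_)
    have := Finset.mem_of_mem_erase (hsub hx)
    rcases Finset.mem_insert.1 this with rfl | h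
    exacts [absurd hx heC, h]
  obtain ⟨C, hC, hCsub⟩ := key g hgK hgI
  obtain ⟨h, hhC, hhK, hhI⟩ : ∃ h ∈ C, h ∈ K ∧ h ∉ I := by
    by_contra hcon
    push Not at hcon
    refine hC.1 (hI.subset fun x hx => ?_)
    rcases Finset.mem_insert.1 (Finset.mem_of_mem_erase (hCsub hx)) with rfl | hxK
    exacts [heI, hcon x hx hxK]
  obtain ⟨C', hC', hCsub'⟩ := key h hhK hhI
  have hne : C ≠ C' := by
    rintro rfl
    exact (Finset.mem_erase.1 (hCsub' hhC)).1 rfl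
  refine hC.elimination hj hC' hne (hmem _ _ hC hCsub) (hmem _ _ hC' hCsub')
    (hKind.subset fun x hx => ?_)
  obtain ⟨hxe, hx⟩ := Finset.mem_erase.1 hx
  rcases Finset.mem_union.1 hx with hx | hx
  · exact (Finset.mem_insert.1 (Finset.mem_of_mem_erase (hCsub hx))).resolve_left hxe
  · exact (Finset.mem_insert.1 (Finset.mem_of_mem_erase (hCsub' hx))).resolve_left hxe

theorem Indep.exists_extension (hj : 1 ≤ j) (hK : P.Indep j K) (hI : P.Indep j I)
    (hle : I.card ≤ K.card) : ∃ I', I ⊆ I' ∧ I' ⊆ I ∪ K ∧ P.Indep j I' ∧ I'.card = K.card := by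
  obtain ⟨n, hn⟩ := Nat.exists_eq_add_of_le hle
  induction n generalizing I with
  | zero => exact ⟨I, subset_rfl, Finset.subset_union_left, hI, by omega⟩
  | succ n ih =>
    obtain ⟨e, heK, heI, he⟩ := hI.augment hj hK (by omega)
    have hc := Finset.card_insert_of_notMem heI
    obtain ⟨I', h1, h2, h3, h4⟩ := ih he (by omega) (by omega)
    refine ⟨I', (Finset.subset_insert _ _).trans h1, h2.trans ?_, h3, h4⟩
    rw [Finset.insert_union]
    exact Finset.insert_subset (Finset.mem_union_right _ heK) subset_rfl

/-- If `E₀` spans `T` and `S` is independent over `E₀`, then it is independent over every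
independent subset of `T`. -/
theorem Indep.union_of_spanned (hj : 1 ≤ j) (hES : P.Indep j (E₀ ∪ S)) (hdisj : Disjoint E₀ S)
    (hT : ∀ t ∈ T, ¬ P.Indep j (insert t E₀)) (hJT : J ⊆ T) (hJ : P.Indep j J) :
    P.Indep j (J ∪ S) := by
  have hE := hES.subset (Finset.subset_union_left (s₁ := E₀) (s₂ := S))
  -- `E₀` is a basis of `E₀ ∪ T`.
  have hspan : ∀ K ⊆ E₀ ∪ T, P.Indep j K → K.card ≤ E₀.card := by
    intro K hK hKi
    by_contra hlt
    obtain ⟨e, heK, heE, he⟩ := hE.augment hj hKi (by omega)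
    exact hT e ((Finset.mem_union.1 (hK heK)).resolve_left heE) he
  obtain ⟨B, hB1, hB2, hB3, hB4⟩ := hE.exists_extension hj hJ
    (hspan J (hJT.trans Finset.subset_union_right) hJ)
  have hc := Finset.card_union_of_disjoint hdisj
  obtain ⟨B', hC1, hC2, hC3, hC4⟩ := hES.exists_extension hj hB3 (by omega)
  -- `B'` has `|E₀| + |S|` elements, of which at most `|E₀|` lie outside `S`, so it contains all of
  -- `S`.
  have h1 : (B' \ S).card ≤ E₀.card := by
    refine hspan _ (fun x hx => ?_) (hC3.subset Finset.sdiff_subset)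
    obtain ⟨hx, hxS⟩ := Finset.mem_sdiff.1 hx
    have a1 := hC2 hx
    simp only [Finset.mem_union] at a1 ⊢
    rcases a1 with a1 | a1 | a1
    · have a2 := hB2 a1
      rcases Finset.mem_union.1 a2 with a2 | a2
      exacts [Or.inr (hJT a2), Or.inl a2]
    · exact Or.inl a1
    · exact absurd a1 hxS
  have h2 := Finset.card_sdiff_add_card_inter B' S
  have h3 : B' ∩ S = S := Finset.eq_of_subset_of_card_le Finset.inter_subset_right (by omega)
  exact hC3.subset (Finset.union_subset (hB1.trans hC1) (Finset.inter_eq_right.1 h3))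

end Matroid

end GainDatum

namespace GainGraph

open Classical

/-! ### Walks, their gains and reachability -/

section Joined

variable {V E Γ : Type*} [Group Γ] {G : GainGraph V E Γ} {F : Finset E} {B : Set V}
  {u v w : V} {g h : Γ}

theorem isWalk_append {l l' : List (E × Bool)} :
    G.IsWalk u (l ++ l') w ↔ ∃ x, G.IsWalk u l x ∧ G.IsWalk x l' w := by
  induction l generalizing u with
  | nil => simp [IsWalk]
  | cons s l ih => simp [IsWalk, ih, and_assoc]

variable (G) in
/-- There is a walk in `F` of gain `g` from `u` to `w` that does not meet `B` after its start. -/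
def Joined (F : Finset E) (B : Set V) (u : V) (g : Γ) (w : V) : Prop :=
  ∃ l, G.IsWalk u l w ∧ (∀ s ∈ l, s.1 ∈ F) ∧ (∀ s ∈ l, G.head s ∉ B) ∧ G.walkGain l = g

theorem Joined.refl : G.Joined F B u 1 u := ⟨[], rfl, by simp, by simp, by simp [walkGain]⟩

theorem Joined.trans (h₁ : G.Joined F B u g v) (h₂ : G.Joined F B v h w) :
    G.Joined F B u (g * h) w := by
  obtain ⟨l, a1, a2, a3, a4⟩ := h₁
  obtain ⟨l', b1, b2, b3, b4⟩ := h₂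
  refine ⟨l ++ l', isWalk_append.2 ⟨v, a1, b1⟩, ?_, ?_, ?_⟩
  · simp only [List.mem_append]
    rintro s (hs | hs)
    exacts [a2 s hs, b2 s hs]
  · simp only [List.mem_append]
    rintro s (hs | hs)
    exacts [a3 s hs, b3 s hs]
  · simp only [walkGain, List.map_append, List.prod_append] at a4 b4 ⊢
    rw [a4, b4]

theorem joined_step {s : E × Bool} (hs : s.1 ∈ F) (hB : G.head s ∉ B) :
    G.Joined F B (G.tail s) (G.stepGain s) (G.head s) :=
  ⟨[s], ⟨rfl, rfl⟩, by simpa using hs, by simpa using hB, by simp [walkGain]⟩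

theorem Joined.cons {s : E × Bool} (hs : s.1 ∈ F) (hB : G.head s ∉ B)
    (h₁ : G.Joined F B (G.head s) g w) : G.Joined F B (G.tail s) (G.stepGain s * g) w :=
  (joined_step hs hB).trans h₁

/-- Induction on a walk from its end. -/
theorem Joined.induction {motive : Γ → V → Prop} (hj : G.Joined F B u g w) (h0 : motive 1 u)
    (hstep : ∀ g s, G.Joined F B u g (G.tail s) → motive g (G.tail s) → s.1 ∈ F → G.head s ∉ B →
      motive (g * G.stepGain s) (G.head s)) : motive g w := by
  obtain ⟨l, a1, a2, a3, rfl⟩ := hj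
  induction l using List.reverseRecOn generalizing w with
  | nil => simpa [walkGain, ← show u = w from a1] using h0
  | append_singleton l s ih =>
    obtain ⟨x, b1, b2, b3⟩ := isWalk_append.1 a1
    obtain rfl : G.head s = w := b3
    subst b2
    have h1 : ∀ t ∈ l, t.1 ∈ F := fun t ht => a2 t (by simp [ht])
    have h2 : ∀ t ∈ l, G.head t ∉ B := fun t ht => a3 t (by simp [ht])
    have := hstep (G.walkGain l) s ⟨l, b1, h1, h2, rfl⟩ (ih b1 h1 h2) (a2 s (by simp))
      (a3 s (by simp))
    simpa [walkGain] using this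

/-- The step against the direction of `s`. -/
def revStep : E × Bool → E × Bool
  | (e, b) => (e, !b)

theorem tail_revStep (s : E × Bool) : G.tail (revStep s) = G.head s := by
  obtain ⟨e, _ | _⟩ := s <;> rfl

theorem head_revStep (s : E × Bool) : G.head (revStep s) = G.tail s := by
  obtain ⟨e, _ | _⟩ := s <;> rfl

theorem stepGain_revStep (s : E × Bool) : G.stepGain (revStep s) = (G.stepGain s)⁻¹ := by
  obtain ⟨e, _ | _⟩ := s <;> simp [revStep, stepGain]

theorem revStep_fst (s : E × Bool) : (revStep s).1 = s.1 := rfl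

theorem Joined.not_mem (hj : G.Joined F B u g w) (hu : u ∉ B) : w ∉ B :=
  hj.induction (motive := fun _ w => w ∉ B) hu fun _ _ _ _ _ h => h

theorem Joined.symm (hj : G.Joined F B u g w) (hu : u ∉ B) : G.Joined F B w g⁻¹ u := by
  refine hj.induction (motive := fun g w => G.Joined F B w g⁻¹ u) (by simpa using .refl) ?_
  intro g s h1 h2 hs _
  have := Joined.cons (s := revStep s) (G := G) (B := B) (by simpa [revStep_fst] using hs)
    (by rw [head_revStep]; exact h1.not_mem hu) (by rw [head_revStep]; exact h2)
  simpa [tail_revStep, stepGain_revStep] using this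

theorem reachable_iff : G.Reachable F u w ↔ ∃ g, G.Joined F ∅ u g w := by
  constructor
  · rintro ⟨l, h1, h2⟩
    exact ⟨_, l, h1, h2, by simp, rfl⟩
  · rintro ⟨g, l, h1, h2, -, -⟩
    exact ⟨l, h1, h2⟩

theorem Reachable.refl : G.Reachable F u u := reachable_iff.2 ⟨1, .refl⟩

theorem Reachable.trans (h₁ : G.Reachable F u v) (h₂ : G.Reachable F v w) :
    G.Reachable F u w := by
  obtain ⟨g, h₁⟩ := reachable_iff.1 h₁
  obtain ⟨h, h₂⟩ := reachable_iff.1 h₂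
  exact reachable_iff.2 ⟨_, h₁.trans h₂⟩

theorem Reachable.symm (h₁ : G.Reachable F u v) : G.Reachable F v u := by
  obtain ⟨g, h₁⟩ := reachable_iff.1 h₁
  exact reachable_iff.2 ⟨_, h₁.symm (by simp)⟩

theorem reachable_step {s : E × Bool} (hs : s.1 ∈ F) :
    G.Reachable F (G.tail s) (G.head s) :=
  reachable_iff.2 ⟨_, joined_step hs (by simp)⟩

theorem reachable_edge {e : E} (he : e ∈ F) : G.Reachable F (G.src e) (G.tgt e) :=
  reachable_step (s := (e, true)) he

theorem gainGroup_eq : G.gainGroup F =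
    Subgroup.closure {g | ∃ u ∉ G.fixed, G.Joined F G.fixed u g u} := by
  unfold gainGroup Joined
  congr 1
  ext g
  constructor
  · rintro ⟨u, l, h1, h2, h3, h4, h5⟩
    exact ⟨u, h3, l, h1, h2, h4, h5⟩
  · rintro ⟨u, h3, l, h1, h2, h4, h5⟩
    exact ⟨u, l, h1, h2, h3, h4, h5⟩

end Joined

/-! ### Potentials and the gain group -/

section Datum

variable {V E Γ : Type*} [CommGroup Γ] (G : GainGraph V E Γ)

/-- The labelled multigraph underlying a gain graph, in additive notation. -/
def datum : GainDatum V E (Additive Γ) where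
  src := G.src
  tgt := G.tgt
  gain e := Additive.ofMul (G.gain e)
  fixed := G.fixed

variable {G} {F : Finset E} {m : ℕ} {u w : V} {g : Γ}

theorem smul_eq_of_joined {p : V → Additive Γ}
    (hp : ∀ e ∈ F, G.src e ∉ G.fixed → G.tgt e ∉ G.fixed →
      m • Additive.ofMul (G.gain e) = p (G.tgt e) - p (G.src e))
    (hj : G.Joined F G.fixed u g w) (hu : u ∉ G.fixed) :
    m • Additive.ofMul g = p w - p u := by
  refine hj.induction (motive := fun g w => m • Additive.ofMul g = p w - p u) (by simp) ?_
  intro g s h1 h2 hs hB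
  have ht := h1.not_mem hu
  rw [ofMul_mul, smul_add, h2]
  obtain ⟨e, _ | _⟩ := s
  · have := hp e hs hB ht
    simp only [tail, head, stepGain, ofMul_inv, smul_neg] at *
    rw [this]; abel
  · have := hp e hs ht hB
    simp only [tail, head, stepGain] at *
    rw [this]; abel

/-- Along a closed walk the differences of a potential cancel. Conversely, gains of walks from a
chosen root in each class of free vertices give a potential after multiplication by `m`. -/
theorem mulBalanced_iff : G.datum.MulBalanced m F ↔ ∀ g ∈ G.gainGroup F, g ^ m = 1 := by
  constructor
  · rintro ⟨p, hp⟩ g hg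
    rw [gainGroup_eq] at hg
    induction hg using Subgroup.closure_induction with
    | mem x hx =>
      obtain ⟨u, hu, hj⟩ := hx
      have := smul_eq_of_joined hp hj hu
      rw [sub_self, ← ofMul_pow] at this
      exact ofMul_eq_zero.1 this
    | one => simp
    | mul x y _ _ hx hy => rw [mul_pow, hx, hy, one_mul]
    | inv x _ hx => rw [inv_pow, hx, inv_one]
  · intro h
    let S : Setoid {x : V // x ∉ G.fixed} :=
      { r := fun x y => ∃ g, G.Joined F G.fixed x g y
        iseqv := ⟨fun x => ⟨1, .refl⟩, fun {x y} ⟨g, hg⟩ => ⟨g⁻¹, hg.symm x.2⟩,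
          fun ⟨g, hg⟩ ⟨g', hg'⟩ => ⟨g * g', hg.trans hg'⟩⟩ }
    have hroot : ∀ x : {x : V // x ∉ G.fixed}, ∃ g,
        G.Joined F G.fixed (Quotient.out (Quotient.mk S x) : {x : V // x ∉ G.fixed}) g x :=
      fun x => Quotient.mk_out (s := S) x
    choose a ha using hroot
    obtain ⟨p, hp⟩ : ∃ p : V → Additive Γ, ∀ x hx, p x = m • Additive.ofMul (a ⟨x, hx⟩) :=
      ⟨fun x => if hx : x ∉ G.fixed then m • Additive.ofMul (a ⟨x, hx⟩) else 0,
        fun x hx => dif_pos hx⟩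
    refine ⟨p, fun e he h1 h2 => ?_⟩
    have h1' : G.src e ∉ G.fixed := h1
    have h2' : G.tgt e ∉ G.fixed := h2
    have k0 : G.Joined F G.fixed (G.src e) (G.gain e) (G.tgt e) :=
      joined_step (s := (e, true)) he h2'
    have hq : Quotient.mk S ⟨G.src e, h1'⟩ = Quotient.mk S ⟨G.tgt e, h2'⟩ :=
      Quotient.sound ⟨_, k0⟩
    have k1 := ha ⟨G.src e, h1'⟩
    have k2 := ha ⟨G.tgt e, h2'⟩
    rw [← hq] at k2
    have k3 := (k1.trans k0).trans (k2.symm (Quotient.out (Quotient.mk S ⟨G.src e, h1'⟩)).2)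
    have k4 : a ⟨G.src e, h1'⟩ * G.gain e * (a ⟨G.tgt e, h2'⟩)⁻¹ ∈ G.gainGroup F := by
      -- The walk from the root along the edge and back to the same root is closed and avoids the
      -- fixed vertex.
      rw [gainGroup_eq]
      exact Subgroup.subset_closure ⟨_, (Quotient.out (Quotient.mk S ⟨G.src e, h1'⟩)).2, k3⟩
    have k5 := congrArg Additive.ofMul (h _ k4)
    rw [ofMul_pow, ofMul_mul, ofMul_mul, ofMul_inv, ofMul_one, smul_add, smul_add, smul_neg] at k5
    rw [← sub_eq_add_neg, sub_eq_zero] at k5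
    change m • Additive.ofMul (G.gain e) = p (G.tgt e) - p (G.src e)
    rw [hp _ h1', hp _ h2', ← k5]
    abel

end Datum

end GainGraph

namespace GainGraph

open Classical

/-! ### Near-balanced sets and vertex splitting -/

section NearBalanced

variable {V E Γ : Type*} [CommGroup Γ] {G : GainGraph V E Γ} {F : Finset E} {j k : ℕ}

theorem mem_verts {x : V} : x ∈ G.verts F ↔ ∃ e ∈ F, G.src e = x ∨ G.tgt e = x := by
  simp only [verts, Finset.mem_union, Finset.mem_image]
  constructor
  · rintro (⟨e, he, h⟩ | ⟨e, he, h⟩)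
    exacts [⟨e, he, Or.inl h⟩, ⟨e, he, Or.inr h⟩]
  · rintro ⟨e, he, h | h⟩
    exacts [Or.inl ⟨e, he, h⟩, Or.inr ⟨e, he, h⟩]

theorem mem_fixedVerts {x : V} : x ∈ G.fixedVerts F ↔ x ∈ G.verts F ∧ x ∈ G.fixed := by
  simp [fixedVerts]

theorem pinned_iff : G.datum.Pinned F ↔ (G.fixedVerts F).Nonempty := by
  constructor
  · rintro ⟨e, he, h | h⟩
    exacts [⟨_, mem_fixedVerts.2 ⟨mem_verts.2 ⟨e, he, Or.inl rfl⟩, h⟩⟩,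
      ⟨_, mem_fixedVerts.2 ⟨mem_verts.2 ⟨e, he, Or.inr rfl⟩, h⟩⟩]
  · rintro ⟨x, hx⟩
    obtain ⟨hx, h⟩ := mem_fixedVerts.1 hx
    obtain ⟨e, he, rfl | rfl⟩ := mem_verts.1 hx
    exacts [⟨e, he, Or.inl h⟩, ⟨e, he, Or.inr h⟩]

theorem card_fixedVerts_le : (G.fixedVerts F).card ≤ 1 :=
  Finset.card_le_one.2 fun _ ha _ hb =>
    G.fixed_subsingleton (mem_fixedVerts.1 ha).2 (mem_fixedVerts.1 hb).2

theorem card_fixedVerts_of_pinned (h : G.datum.Pinned F) : (G.fixedVerts F).card = 1 :=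
  le_antisymm card_fixedVerts_le (pinned_iff.1 h).card_pos

theorem card_fixedVerts_of_not_pinned (h : ¬ G.datum.Pinned F) : (G.fixedVerts F).card = 0 := by
  rw [pinned_iff, Finset.not_nonempty_iff_eq_empty] at h
  simp [h]

theorem card_verts : (G.verts F).card = (G.datum.freeVerts F).card + (G.fixedVerts F).card := by
  have := Finset.card_filter_add_card_filter_not (s := G.verts F) (· ∉ G.fixed)
  rw [← this]
  congr 2
  ext x
  simp [fixedVerts]

/-- The gain of a step between vertices with a split potential. -/
theorem explains_step {p q : V → Additive Γ} {s : E × Bool} (h : G.datum.Explains p q s.1) :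
    ∃ x y, (x = p (G.tail s) ∨ x = q (G.tail s)) ∧ (y = p (G.head s) ∨ y = q (G.head s)) ∧
      Additive.ofMul (G.stepGain s) = y - x := by
  obtain ⟨x, y, hx, hy, hg⟩ := h
  obtain ⟨e, _ | _⟩ := s
  · exact ⟨y, x, hy, hx, by
      change Additive.ofMul (G.gain e) = y - x at hg
      simp [stepGain, hg]⟩
  · exact ⟨x, y, hx, hy, hg⟩

theorem joined_of_dropLast {v : V} {l : List (E × Bool)} (h1 : G.IsWalk v l v)
    (h2 : ∀ s ∈ l, s.1 ∈ F) (h3 : ∀ s ∈ l.dropLast, G.head s ≠ v) :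
    G.walkGain l = 1 ∨ ∃ g s, G.Joined F {v} v g (G.tail s) ∧ s.1 ∈ F ∧ G.head s = v ∧
      G.walkGain l = g * G.stepGain s := by
  induction l using List.reverseRecOn with
  | nil => left; simp [walkGain]
  | append_singleton l s _ =>
    right
    obtain ⟨x, b1, b2, b3⟩ := isWalk_append.1 h1
    subst b2
    refine ⟨G.walkGain l, s, ⟨l, b1, fun t ht => h2 t (by simp [ht]), fun t ht => ?_, rfl⟩,
      h2 s (by simp), b3, by simp [walkGain]⟩
    exact h3 t (by simpa using ht)

/-- The base vertex is the split vertex `b`, and `δ` is the difference of its copies: a closed walk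
that meets `b` only at its ends has gain the difference of two values at `b`. -/
theorem nearBalanced_of_splitBalanced (hF : ¬ G.datum.Pinned F)
    (hs : G.datum.SplitBalanced F) (hb : ¬ G.Balanced F) : G.NearBalanced F := by
  obtain ⟨p, q, b, hpq, hp⟩ := hs
  refine ⟨Finset.not_nonempty_iff_eq_empty.1 fun h => hF (pinned_iff.2 h), hb, ?_⟩
  have hbF : b ∈ G.verts F := by
    by_contra hbF
    apply hb
    have : G.datum.MulBalanced 1 F := GainDatum.mulBalanced_one_of (r := p) fun e he =>
      (hp e he).eq_of_ne hpq (fun h => hbF (mem_verts.2 ⟨e, he, Or.inl h⟩))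
        (fun h => hbF (mem_verts.2 ⟨e, he, Or.inr h⟩))
    rw [mulBalanced_iff] at this
    exact (Subgroup.eq_bot_iff_forall _).2 fun g hg => by simpa using this g hg
  have key : ∀ g w, G.Joined F {b} b g w →
      (g = 1 ∧ w = b) ∨ (w ≠ b ∧ ∃ x, (x = p b ∨ x = q b) ∧ Additive.ofMul g = p w - x) := by
    intro g w hj
    refine hj.induction (motive := fun g w => (g = 1 ∧ w = b) ∨
      (w ≠ b ∧ ∃ x, (x = p b ∨ x = q b) ∧ Additive.ofMul g = p w - x)) (Or.inl ⟨rfl, rfl⟩) ?_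
    intro g s h1 h2 hs hB
    right
    obtain ⟨x, y, hx, hy, hg⟩ := explains_step (hp s.1 hs)
    have hB' : G.head s ≠ b := hB
    refine ⟨hB', ?_⟩
    have k1 := hpq _ hB'
    rcases h2 with ⟨rfl, h2⟩ | ⟨h2, z, hz, hz'⟩
    · rw [h2] at hx
      exact ⟨x, hx, by rw [one_mul, hg]; grind⟩
    · have k2 := hpq _ h2
      refine ⟨z, hz, ?_⟩
      rw [ofMul_mul, hz', hg]
      grind
  refine ⟨b, hbF, Additive.toMul (q b - p b), fun l h1 h2 h3 => ?_⟩
  rcases joined_of_dropLast h1 h2 h3 with h | ⟨g, s, hj, hsF, hsb, hgain⟩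
  · exact Or.inl h
  · obtain ⟨x, y, hx, hy, hg⟩ := explains_step (hp s.1 hsF)
    have : Additive.ofMul (G.walkGain l) = 0 ∨ Additive.ofMul (G.walkGain l) = q b - p b ∨
        Additive.ofMul (G.walkGain l) = -(q b - p b) := by
      rw [hgain, ofMul_mul, hg]
      rw [hsb] at hy
      rcases key g _ hj with ⟨rfl, h2⟩ | ⟨h2, z, hz, hz'⟩
      · rw [h2] at hx
        rw [ofMul_one]
        grind
      · have k2 := hpq _ h2
        rw [hz']
        grind
    rcases this with h | h | h
    · exact Or.inl (ofMul_eq_zero.1 h)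
    · exact Or.inr (Or.inl (by rw [← h]; rfl))
    · exact Or.inr (Or.inr (by rw [← toMul_neg, ← h]; rfl))

/-- Both `a - δ` and `a + δ` cannot occur, since `2 • δ` would then be `0`, `δ` or `-δ`. -/
theorem exists_base_gain {A : Type*} [AddCommGroup A] {R : Set A} {δ : A} (hne : R.Nonempty)
    (hR : ∀ a ∈ R, ∀ c ∈ R, a - c = 0 ∨ a - c = δ ∨ a - c = -δ)
    (h2 : 2 • δ ≠ 0) (h3 : 3 • δ ≠ 0) : ∃ c ∈ R, ∀ a ∈ R, a = c ∨ a = c + δ := by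
  obtain ⟨a, ha⟩ := hne
  by_cases h : a - δ ∈ R
  · refine ⟨a - δ, h, fun r hr => ?_⟩
    have k1 := hR r hr a ha
    have k2 := hR r hr _ h
    grind
  · refine ⟨a, ha, fun r hr => ?_⟩
    have k1 := hR r hr a ha
    have k2 : r ≠ a - δ := fun h' => h (h' ▸ hr)
    grind

theorem joined_base {v x : V} {g : Γ} (h : G.Joined F {v} v g x) :
    (g = 1 ∧ x = v) ∨ ∃ s g', s.1 ∈ F ∧ G.tail s = v ∧ G.head s ≠ v ∧
      G.Joined F {v} (G.head s) g' x ∧ g = G.stepGain s * g' := by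
  obtain ⟨l, h1, h2, h3, rfl⟩ := h
  cases l with
  | nil => exact Or.inl ⟨by simp [walkGain], (show v = x from h1).symm⟩
  | cons s l =>
    exact Or.inr ⟨s, G.walkGain l, h2 s (by simp), h1.1, h3 s (by simp),
      ⟨l, h1.2, fun t ht => h2 t (by simp [ht]), fun t ht => h3 t (by simp [ht]), rfl⟩,
      by simp [walkGain]⟩

theorem exists_joined_of_reachable {v x : V} (h : G.Reachable F v x) :
    ∃ g, G.Joined F {v} v g x := by
  obtain ⟨g, h⟩ := reachable_iff.1 h
  refine h.induction (motive := fun _ x => ∃ g, G.Joined F {v} v g x) ⟨1, .refl⟩ ?_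
  rintro _ s _ ⟨g, hg⟩ hs -
  by_cases hv : G.head s = v
  · rw [hv]; exact ⟨1, .refl⟩
  · exact ⟨_, hg.trans (joined_step hs hv)⟩

/-- If 2 or 3 kills `δ`, one of the multiples `j - 1`, `j`, `j + 1` does, and it is balanced.
Otherwise the gains of the walks from `v` that do not return to `v` determine a potential after `v`
is split. -/
theorem one_le_dim_of_nearBalanced (hj : 1 ≤ j)
    (hconn : ∀ x ∈ G.verts F, ∀ y ∈ G.verts F, G.Reachable F x y) (h : G.NearBalanced F) :
    1 ≤ G.datum.dim j F := by
  obtain ⟨hfix, -, v, hv, δ₀, hδ₀⟩ := h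
  have hpin : ¬ G.datum.Pinned F := by
    rw [pinned_iff, hfix]; simp
  set δ := Additive.ofMul δ₀ with hδ
  have hclose : ∀ g s, G.Joined F {v} v g (G.tail s) → s.1 ∈ F → G.head s = v →
      Additive.ofMul (g * G.stepGain s) = 0 ∨ Additive.ofMul (g * G.stepGain s) = δ ∨
        Additive.ofMul (g * G.stepGain s) = -δ := by
    rintro g s ⟨l, h1, h2, h3, rfl⟩ hs hsv
    have := hδ₀ (l ++ [s]) (isWalk_append.2 ⟨_, h1, rfl, hsv⟩) ?_ ?_
    · rw [show G.walkGain l * G.stepGain s = G.walkGain (l ++ [s]) by simp [walkGain]]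
      rcases this with h | h | h
      · exact Or.inl (by rw [h, ofMul_one])
      · exact Or.inr (Or.inl (by rw [h]))
      · exact Or.inr (Or.inr (by rw [h, ofMul_inv]))
    · simp only [List.mem_append, List.mem_singleton]
      rintro t (ht | rfl)
      exacts [h2 t ht, hs]
    · simpa using h3
  -- `R x` is the set of gains of walks from `v` to `x` that do not return to `v`. Two of them
  -- differ by `0` or `±δ`, because one followed by the reverse of the other is closed at `v`.
  obtain ⟨R, hR⟩ : ∃ R : V → Set (Additive Γ), ∀ x a, a ∈ R x ↔
      G.Joined F {v} v (Additive.toMul a) x := ⟨fun x => {a | _}, fun x a => Iff.rfl⟩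
  have hRv : ∀ a, a ∈ R v ↔ a = 0 := by
    intro a
    rw [hR]
    constructor
    · intro h
      rcases joined_base h with ⟨h, -⟩ | ⟨s, g', hs, -, hsv, hj', -⟩
      · exact h
      · exact absurd rfl (hj'.not_mem (by simpa using hsv))
    · rintro rfl
      exact .refl
  have hratio : ∀ x, ∀ a ∈ R x, ∀ c ∈ R x, a - c = 0 ∨ a - c = δ ∨ a - c = -δ := by
    intro x a ha c hc
    rcases joined_base ((hR _ _).1 hc) with ⟨h, rfl⟩ | ⟨s, g', hs, hst, hsv, hj', hcg⟩
    · left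
      rw [hRv] at ha hc
      rw [ha, hc, sub_zero]
    · have := hclose (Additive.toMul a * g'⁻¹) (revStep s) (((hR _ _).1 ha).trans (by
        rw [tail_revStep]
        exact hj'.symm (by simpa using hsv))) hs (by rw [head_revStep, hst])
      rw [stepGain_revStep, mul_assoc, ← mul_inv, mul_comm g', ← hcg, ofMul_mul, ofMul_inv,
        ofMul_toMul, ofMul_toMul, ← sub_eq_add_neg] at this
      exact this
  have hne : ∀ x ∈ G.verts F, (R x).Nonempty := by
    intro x hx
    obtain ⟨g, hg⟩ := exists_joined_of_reachable (hconn v hv x hx)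
    exact ⟨Additive.ofMul g, (hR _ _).2 hg⟩
  have hstep : ∀ s : E × Bool, s.1 ∈ F → G.head s ≠ v → ∀ a ∈ R (G.tail s),
      a + Additive.ofMul (G.stepGain s) ∈ R (G.head s) := by
    intro s hs hsv a ha
    rw [hR] at ha ⊢
    exact ha.trans (joined_step hs hsv)
  have hedge : ∀ e ∈ F, ∀ a ∈ R (G.src e), ∀ c ∈ R (G.tgt e),
      a + Additive.ofMul (G.gain e) - c = 0 ∨ a + Additive.ofMul (G.gain e) - c = δ ∨
        a + Additive.ofMul (G.gain e) - c = -δ := by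
    intro e he a ha c hc
    by_cases hev : G.tgt e = v
    · rw [hev, hRv] at hc
      rw [hc, sub_zero]
      exact hclose (Additive.toMul a) (e, true) ((hR _ _).1 ha) he hev
    · exact hratio _ _ (hstep (e, true) he hev a ha) c hc
  have hsrc : ∀ e ∈ F, G.src e ∈ G.verts F := fun e he => mem_verts.2 ⟨e, he, Or.inl rfl⟩
  have htgt : ∀ e ∈ F, G.tgt e ∈ G.verts F := fun e he => mem_verts.2 ⟨e, he, Or.inr rfl⟩
  have hmul : ∀ m, (m = j ∨ m = j - 1 ∨ m = j + 1) → m • δ = 0 → 1 ≤ G.datum.dim j F := by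
    intro m hm hmδ
    refine le_trans (GainDatum.groupDim_pos_of hpin hm ?_) GainDatum.groupDim_le_dim
    have : ∀ x, ∃ a, x ∈ G.verts F → a ∈ R x := fun x => by
      by_cases hx : x ∈ G.verts F
      · obtain ⟨a, ha⟩ := hne x hx
        exact ⟨a, fun _ => ha⟩
      · exact ⟨0, fun h => absurd h hx⟩
    choose p hp using this
    refine ⟨fun x => m • p x, fun e he _ _ => ?_⟩
    change m • Additive.ofMul (G.gain e) = m • p (G.tgt e) - m • p (G.src e)
    have hz : m • (p (G.src e) + Additive.ofMul (G.gain e) - p (G.tgt e)) = 0 := by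
      rcases hedge e he _ (hp _ (hsrc e he)) _ (hp _ (htgt e he)) with h | h | h <;> rw [h]
      · simp
      · exact hmδ
      · rw [smul_neg, hmδ, neg_zero]
    rw [smul_sub, smul_add, sub_eq_zero] at hz
    rw [← hz]
    abel
  by_cases h2 : 2 • δ = 0
  · rcases Nat.even_or_odd' j with ⟨c, hc | hc⟩
    · exact hmul j (by simp) (by rw [hc, mul_comm, mul_smul, h2, smul_zero])
    · exact hmul (j - 1) (by simp) (by
        rw [show j - 1 = c * 2 by omega, mul_smul, h2, smul_zero])
  by_cases h3 : 3 • δ = 0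
  · have : ∃ c, j = c * 3 ∨ j - 1 = c * 3 ∨ j + 1 = c * 3 := by
      rcases (show j % 3 = 0 ∨ j % 3 = 1 ∨ j % 3 = 2 by omega) with h | h | h
      exacts [⟨j / 3, by omega⟩, ⟨j / 3, by omega⟩, ⟨j / 3 + 1, by omega⟩]
    obtain ⟨c, hc | hc | hc⟩ := this
    · exact hmul j (by simp) (by rw [hc, mul_smul, h3, smul_zero])
    · exact hmul (j - 1) (by simp) (by rw [hc, mul_smul, h3, smul_zero])
    · exact hmul (j + 1) (by simp) (by rw [hc, mul_smul, h3, smul_zero])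
  refine GainDatum.one_le_dim_of_split hpin ?_
  have : ∀ x, ∃ c, x ∈ G.verts F → c ∈ R x ∧ ∀ a ∈ R x, a = c ∨ a = c + δ := fun x => by
    by_cases hx : x ∈ G.verts F
    · obtain ⟨c, hc⟩ := exists_base_gain (hne x hx) (hratio x) h2 h3
      exact ⟨c, fun _ => hc⟩
    · exact ⟨0, fun h => absurd h hx⟩
  choose p hp using this
  have hpv : p v = 0 := (hRv _).1 (hp v hv).1
  -- The elements of `R x` are `p x` or `p x + δ`; measured from the two copies `0` and `-δ` of `v`,
  -- both occur as gains of edges from `v` to `x`.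
  refine ⟨p, Function.update p v (-δ), v, fun x hx => by simp [hx], fun e he => ?_⟩
  have hps := hp _ (hsrc e he)
  have hpt := hp _ (htgt e he)
  by_cases c1 : G.src e = v <;> by_cases c2 : G.tgt e = v
  · have := hedge e he 0 (by rw [c1, hRv]) 0 (by rw [c2, hRv])
    rw [zero_add, sub_zero] at this
    rcases this with h | h | h
    · exact ⟨0, 0, Or.inl (by change _ = p (G.src e); rw [c1, hpv]),
        Or.inl (by change _ = p (G.tgt e); rw [c2, hpv]), by rw [sub_zero]; exact h⟩
    · refine ⟨-δ, 0, Or.inr ?_, Or.inl (by change _ = p (G.tgt e); rw [c2, hpv]), ?_⟩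
      · change _ = Function.update p v (-δ) (G.src e)
        rw [c1]; simp
      · rw [zero_sub, neg_neg]; exact h
    · refine ⟨0, -δ, Or.inl (by change _ = p (G.src e); rw [c1, hpv]), Or.inr ?_, ?_⟩
      · change _ = Function.update p v (-δ) (G.tgt e)
        rw [c2]; simp
      · rw [sub_zero]; exact h
  · have := hpt.2 _ (hstep (e, true) he c2 0 (by
      change _ ∈ R (G.src e); rw [c1, hRv]))
    rw [zero_add] at this
    rcases this with h | h
    · exact ⟨0, _, Or.inl (by change _ = p (G.src e); rw [c1, hpv]), Or.inl rfl,
        by rw [sub_zero]; exact h⟩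
    · refine ⟨-δ, _, Or.inr ?_, Or.inl rfl, by rw [sub_neg_eq_add]; exact h⟩
      change _ = Function.update p v (-δ) (G.src e)
      rw [c1]; simp
  · have := hps.2 _ (hstep (e, false) he c1 0 (by
      change _ ∈ R (G.tgt e); rw [c2, hRv]))
    rw [zero_add] at this
    change Additive.ofMul (G.gain e)⁻¹ = _ ∨ Additive.ofMul (G.gain e)⁻¹ = _ at this
    rw [ofMul_inv] at this
    rcases this with h | h
    · refine ⟨_, 0, Or.inl rfl, Or.inl (by change _ = p (G.tgt e); rw [c2, hpv]), ?_⟩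
      change Additive.ofMul (G.gain e) = 0 - p (G.src e)
      rw [← h]; simp
    · refine ⟨_, -δ, Or.inl rfl, Or.inr ?_, ?_⟩
      · change _ = Function.update p v (-δ) (G.tgt e)
        rw [c2]; simp
      · change Additive.ofMul (G.gain e) = -δ - p (G.src e)
        rw [neg_eq_iff_eq_neg.1 h]; abel
  -- Read in its two directions, an edge off `v` deviates from `p` by some `d` and by `-d`, both in
  -- `{0, δ}`; as `2 • δ ≠ 0`, this forces `d = 0`.
  · refine ⟨_, _, Or.inl rfl, Or.inl rfl, ?_⟩
    change Additive.ofMul (G.gain e) = p (G.tgt e) - p (G.src e)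
    have k1 := hpt.2 _ (hstep (e, true) he c2 _ hps.1)
    have k2 := hps.2 _ (hstep (e, false) he c1 _ hpt.1)
    change p (G.src e) + Additive.ofMul (G.gain e) = _ ∨
      p (G.src e) + Additive.ofMul (G.gain e) = _ at k1
    change p (G.tgt e) + Additive.ofMul (G.gain e)⁻¹ = _ ∨
      p (G.tgt e) + Additive.ofMul (G.gain e)⁻¹ = _ at k2
    rw [ofMul_inv] at k2
    grind

end NearBalanced

end GainGraph

namespace GainGraph

open Classical

/-! ### `alpha` and `dim` are complementary -/

section Alpha

variable {V E Γ : Type*} [CommGroup Γ] {G : GainGraph V E Γ}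
  {F : Finset E} {j k m n : ℕ}

theorem balanced_iff : G.Balanced F ↔ Nat.card (G.gainGroup F) = 1 := by
  rw [Balanced, Subgroup.card_eq_one]

theorem card_dvd (hk : Nat.card Γ = k) : Nat.card (G.gainGroup F) ∣ k :=
  hk ▸ Subgroup.card_subgroup_dvd_card _

variable [IsCyclic Γ]

theorem hasGroup_iff : G.HasGroup F n ↔ Nat.card (G.gainGroup F) = n := by
  constructor
  · rintro ⟨φ⟩
    rw [Nat.card_congr φ.toEquiv, Nat.card_congr Multiplicative.toAdd, Nat.card_zmod]
  · rintro rfl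
    exact ⟨(zmodCyclicMulEquiv inferInstance).symm⟩

/-- In a cyclic group the exponent of a subgroup is its order. -/
theorem mulBalanced_iff_dvd : G.datum.MulBalanced m F ↔ Nat.card (G.gainGroup F) ∣ m := by
  rw [mulBalanced_iff, ← IsCyclic.exponent_eq_card, Monoid.exponent_dvd_iff_forall_pow_eq_one]
  constructor
  · intro h g
    exact Subtype.ext (by simpa using h g g.2)
  · intro h g hg
    simpa using congrArg Subtype.val (h ⟨g, hg⟩)

variable [Finite Γ]

theorem isSZero_iff (hk : Nat.card Γ = k) (h1 : ¬ Nat.card (G.gainGroup F) = 1) :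
    G.IsSZero k j F ↔ Nat.card (G.gainGroup F) ∣ j := by
  have hdvd := card_dvd (F := F) (G := G) hk
  have hpos : 0 < Nat.card (G.gainGroup F) := Nat.card_pos
  simp only [IsSZero, hasGroup_iff, SSet, Set.mem_ofPred_eq, exists_eq_right']
  rw [Int.modEq_zero_iff_dvd, Int.natCast_dvd_natCast]
  constructor
  · exact fun h => h.2.2.2
  · intro h
    refine ⟨by omega, hdvd, fun hj h2 => ?_, h⟩
    rw [h2] at h
    exact (Nat.not_even_iff_odd.2 hj) (even_iff_two_dvd.2 h)

theorem isSOne_iff (hj : 1 ≤ j) (hk : Nat.card Γ = k) (h1 : ¬ Nat.card (G.gainGroup F) = 1)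
    (h2 : ¬ (Odd j ∧ Nat.card (G.gainGroup F) = 2)) :
    G.IsSOne k j F ↔ Nat.card (G.gainGroup F) ∣ j - 1 ∨ Nat.card (G.gainGroup F) ∣ j + 1 := by
  have hdvd := card_dvd (F := F) (G := G) hk
  have hpos : 0 < Nat.card (G.gainGroup F) := Nat.card_pos
  have e1 : ((j : ℤ) ≡ 1 [ZMOD Nat.card (G.gainGroup F)]) ↔
      Nat.card (G.gainGroup F) ∣ j - 1 := by
    rw [← Int.natCast_dvd_natCast, Nat.cast_sub hj, Int.modEq_comm, Int.modEq_iff_dvd]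
    simp
  have e2 : ((j : ℤ) ≡ -1 [ZMOD Nat.card (G.gainGroup F)]) ↔
      Nat.card (G.gainGroup F) ∣ j + 1 := by
    rw [← Int.natCast_dvd_natCast, Int.modEq_comm, Int.modEq_iff_dvd]
    simp
  simp only [IsSOne, hasGroup_iff, SSet, Set.mem_union, Set.mem_ofPred_eq, exists_eq_right']
  rw [e1, e2]
  have h3 : 2 ≤ Nat.card (G.gainGroup F) := by omega
  tauto

/-- The number `α` in terms of the order of the gain group. -/
theorem alpha_eq (hj : 1 ≤ j) (hk : Nat.card Γ = k) :
    (Nat.card (G.gainGroup F) = 1 ∧ G.alpha k j F = 0) ∨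
    (Odd j ∧ Nat.card (G.gainGroup F) = 2 ∧ G.alpha k j F = 1) ∨
    (Nat.card (G.gainGroup F) ≠ 1 ∧ ¬ (Odd j ∧ Nat.card (G.gainGroup F) = 2) ∧
      (((Nat.card (G.gainGroup F) ∣ j - 1 ∨ Nat.card (G.gainGroup F) ∣ j + 1) ∧
        G.alpha k j F = 2 - (G.fixedVerts F).card) ∨
      (¬ (Nat.card (G.gainGroup F) ∣ j - 1 ∨ Nat.card (G.gainGroup F) ∣ j + 1) ∧
        (Nat.card (G.gainGroup F) ∣ j ∨ G.ProperNearBalanced F) ∧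
        G.alpha k j F = 2 - 2 * (G.fixedVerts F).card) ∨
      (¬ (Nat.card (G.gainGroup F) ∣ j - 1 ∨ Nat.card (G.gainGroup F) ∣ j + 1) ∧
        ¬ (Nat.card (G.gainGroup F) ∣ j) ∧ ¬ G.ProperNearBalanced F ∧
        G.alpha k j F = 3 - 2 * (G.fixedVerts F).card))) := by
  by_cases h1 : Nat.card (G.gainGroup F) = 1
  · left
    exact ⟨h1, if_pos (balanced_iff.2 h1)⟩
  by_cases h2 : Odd j ∧ Nat.card (G.gainGroup F) = 2
  · right; left
    refine ⟨h2.1, h2.2, ?_⟩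
    rw [alpha, if_neg (mt balanced_iff.1 h1), if_pos ⟨h2.1, hasGroup_iff.2 h2.2⟩]
  right; right
  refine ⟨h1, h2, ?_⟩
  have h2' : ¬ (Odd j ∧ G.HasGroup F 2) := by rwa [hasGroup_iff]
  by_cases h3 : Nat.card (G.gainGroup F) ∣ j - 1 ∨ Nat.card (G.gainGroup F) ∣ j + 1
  · left
    refine ⟨h3, ?_⟩
    rw [alpha, if_neg (mt balanced_iff.1 h1), if_neg h2', if_pos ((isSOne_iff hj hk h1 h2).2 h3)]
  right
  have h3' := mt (isSOne_iff hj hk h1 h2).1 h3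
  by_cases h4 : Nat.card (G.gainGroup F) ∣ j ∨ G.ProperNearBalanced F
  · left
    refine ⟨h3, h4, ?_⟩
    rw [← isSZero_iff hk h1] at h4
    rw [alpha, if_neg (mt balanced_iff.1 h1), if_neg h2', if_neg h3', if_pos h4]
  · right
    refine ⟨h3, fun h => h4 (Or.inl h), fun h => h4 (Or.inr h), ?_⟩
    rw [← isSZero_iff hk h1] at h4
    rw [alpha, if_neg (mt balanced_iff.1 h1), if_neg h2', if_neg h3', if_neg h4]

theorem dvd_one_of_dvd_dvd {n j : ℕ} (h : n ∣ j) (h' : n ∣ j + 1) : n = 1 := by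
  simpa using (Nat.dvd_add_right h).1 h'

/-- The order `n` of the gain group divides two of `j - 1`, `j`, `j + 1` only if `n = 1`, or if `n =
2` and `j` is odd. In the last case of `alpha`, `n` is neither 2 nor 3, since 2 and 3 are caught by
earlier cases; a split balanced set would be proper near-balanced there. -/
theorem dim_add_alpha_le (hj : 1 ≤ j) (hk : Nat.card Γ = k) :
    (G.datum.dim j F : ℤ) + G.alpha k j F + 2 * (G.fixedVerts F).card ≤ 3 := by
  have ha := alpha_eq (G := G) (F := F) hj hk
  set n := Nat.card (G.gainGroup F) with hn
  have b0 := mulBalanced_iff_dvd (G := G) (F := F) (m := j)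
  have b1 := mulBalanced_iff_dvd (G := G) (F := F) (m := j - 1)
  have b2 := mulBalanced_iff_dvd (G := G) (F := F) (m := j + 1)
  rw [← hn] at b0 b1 b2
  have d01 : n ∣ j → n ∣ j + 1 → n = 1 := dvd_one_of_dvd_dvd
  have d02 : n ∣ j → n ∣ j - 1 → n = 1 := fun h h' =>
    dvd_one_of_dvd_dvd h' (by rwa [Nat.sub_add_cancel hj])
  have d12 : n ∣ j - 1 → n ∣ j + 1 → n = 1 ∨ (Odd j ∧ n = 2) := by
    intro h h'
    have : n ∣ 2 := by
      have := (Nat.dvd_add_right h).1 (show n ∣ j - 1 + 2 by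
        rwa [show j - 1 + 2 = j + 1 by omega])
      exact this
    rcases (Nat.dvd_prime Nat.prime_two).1 this with h1 | h1
    · exact Or.inl h1
    · right
      rw [h1] at h'
      refine ⟨?_, h1⟩
      rw [Nat.odd_iff]
      omega
  have d2 : Odd j → n = 2 → ¬ n ∣ j := fun h h' h'' => by
    rw [h'] at h''
    rw [Nat.odd_iff] at h
    omega
  have i0 := GainDatum.ind_le_one (G.datum.MulBalanced j F)
  have i1 := GainDatum.ind_le_one (¬ G.datum.Pinned F ∧ G.datum.MulBalanced (j - 1) F)
  have i2 := GainDatum.ind_le_one (¬ G.datum.Pinned F ∧ G.datum.MulBalanced (j + 1) F)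
  have i3 := GainDatum.ind_le_one (¬ G.datum.Pinned F ∧ G.datum.SplitBalanced F)
  have hd3 := GainDatum.dim_le_three (P := G.datum) (j := j) (F := F)
  by_cases hp : G.datum.Pinned F
  · have hc := card_fixedVerts_of_pinned hp
    have z1 := GainDatum.ind_of_not (a := ¬ G.datum.Pinned F ∧ G.datum.MulBalanced (j - 1) F)
      (fun h => h.1 hp)
    have z2 := GainDatum.ind_of_not (a := ¬ G.datum.Pinned F ∧ G.datum.MulBalanced (j + 1) F)
      (fun h => h.1 hp)
    have z3 := GainDatum.ind_of_not (a := ¬ G.datum.Pinned F ∧ G.datum.SplitBalanced F)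
      (fun h => h.1 hp)
    have z0 : ¬ n ∣ j → GainDatum.ind (G.datum.MulBalanced j F) = 0 := fun h =>
      GainDatum.ind_of_not (mt b0.1 h)
    have hle : G.datum.dim j F = GainDatum.ind (G.datum.MulBalanced j F) := by
      unfold GainDatum.dim GainDatum.groupDim
      omega
    rw [hc] at ha ⊢
    rcases ha with ⟨h, h'⟩ | ⟨h, h', h''⟩ | ⟨h1, h2, ⟨h3, h4⟩ | ⟨h3, h4, h5⟩ | ⟨h3, h4, h5, h6⟩⟩
    · omega
    · have := z0 (d2 h h')
      omega
    · have := z0 (fun h => h3.elim (fun h' => h1 (d02 h h')) (fun h' => h1 (d01 h h')))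
      push_cast at h4 ⊢
      omega
    · push_cast at h5 ⊢
      omega
    · have := z0 h4
      push_cast at h6 ⊢
      omega
  · have hc := card_fixedVerts_of_not_pinned hp
    rw [hc] at ha ⊢
    have z0 : ¬ n ∣ j → GainDatum.ind (G.datum.MulBalanced j F) = 0 := fun h =>
      GainDatum.ind_of_not (mt b0.1 h)
    have z1 : ¬ n ∣ j - 1 →
        GainDatum.ind (¬ G.datum.Pinned F ∧ G.datum.MulBalanced (j - 1) F) = 0 := fun h =>
      GainDatum.ind_of_not fun h' => h (b1.1 h'.2)
    have z2 : ¬ n ∣ j + 1 →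
        GainDatum.ind (¬ G.datum.Pinned F ∧ G.datum.MulBalanced (j + 1) F) = 0 := fun h =>
      GainDatum.ind_of_not fun h' => h (b2.1 h'.2)
    have hone : n ≠ 1 → ¬ (Odd j ∧ n = 2) → G.datum.dim j F ≤ 1 := by
      intro h1 h2
      unfold GainDatum.dim GainDatum.groupDim
      by_cases a0 : n ∣ j
      · have := z1 (fun h => h1 (d02 a0 h))
        have := z2 (fun h => h1 (d01 a0 h))
        omega
      · by_cases a1 : n ∣ j - 1
        · have := z0 a0
          have := z2 (fun h => (d12 a1 h).elim h1 h2)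
          omega
        · have := z0 a0
          have := z1 a1
          omega
    rcases ha with ⟨h, h'⟩ | ⟨h, h', h''⟩ | ⟨h1, h2, ⟨h3, h4⟩ | ⟨h3, h4, h5⟩ | ⟨h3, h4, h5, h6⟩⟩
    · push_cast
      omega
    · have := z0 (d2 h h')
      have : G.datum.dim j F ≤ 2 := by
        unfold GainDatum.dim GainDatum.groupDim
        omega
      push_cast
      omega
    · have := hone h1 h2
      push_cast at h4 ⊢
      omega
    · have := hone h1 h2
      push_cast at h5 ⊢
      omega
    · have := z0 h4
      have := z1 (fun h => h3 (Or.inl h))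
      have := z2 (fun h => h3 (Or.inr h))
      have n2 : n ≠ 2 := by
        intro h
        refine h2 ⟨?_, h⟩
        rw [h] at h4
        rw [Nat.odd_iff]
        omega
      have n3 : n ≠ 3 := by
        intro h
        rw [h] at h3 h4
        omega
      have := GainDatum.ind_of_not (a := ¬ G.datum.Pinned F ∧ G.datum.SplitBalanced F)
        (fun h => h5 ⟨nearBalanced_of_splitBalanced h.1 h.2 (mt balanced_iff.1 h1),
          mt hasGroup_iff.1 n2, mt hasGroup_iff.1 n3⟩)
      have : G.datum.dim j F = 0 := by
        unfold GainDatum.dim GainDatum.groupDim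
        omega
      push_cast at h6 ⊢
      omega

/-- Connectedness is needed only to turn near-balancedness into a dimension: every vertex must be
reachable from the base vertex. -/
theorem three_le_dim_add_alpha (hj : 1 ≤ j) (hk : Nat.card Γ = k)
    (hconn : ∀ x ∈ G.verts F, ∀ y ∈ G.verts F, G.Reachable F x y) :
    3 ≤ (G.datum.dim j F : ℤ) + G.alpha k j F + 2 * (G.fixedVerts F).card := by
  have ha := alpha_eq (G := G) (F := F) hj hk
  set n := Nat.card (G.gainGroup F) with hn
  have b0 := mulBalanced_iff_dvd (G := G) (F := F) (m := j)
  have b1 := mulBalanced_iff_dvd (G := G) (F := F) (m := j - 1)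
  have b2 := mulBalanced_iff_dvd (G := G) (F := F) (m := j + 1)
  rw [← hn] at b0 b1 b2
  have hg := GainDatum.groupDim_le_dim (P := G.datum) (j := j) (F := F)
  have p0 : n ∣ j → GainDatum.ind (G.datum.MulBalanced j F) = 1 := fun h =>
    GainDatum.ind_of (b0.2 h)
  by_cases hp : G.datum.Pinned F
  · have hc := card_fixedVerts_of_pinned hp
    have hle : GainDatum.ind (G.datum.MulBalanced j F) ≤ G.datum.dim j F := by
      refine le_trans ?_ hg
      unfold GainDatum.groupDim
      omega
    rw [hc] at ha ⊢
    rcases ha with ⟨h, h'⟩ | ⟨h, h', h''⟩ | ⟨h1, h2, ⟨h3, h4⟩ | ⟨h3, h4, h5⟩ | ⟨h3, h4, h5, h6⟩⟩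
    · have := p0 (by rw [h]; exact one_dvd _)
      omega
    · omega
    · push_cast at h4 ⊢
      omega
    · rcases h4 with h4 | h4
      · have := p0 h4
        push_cast at h5 ⊢
        omega
      · exact absurd (pinned_iff.1 hp) (by rw [h4.1.1]; simp)
    · push_cast at h6 ⊢
      omega
  · have hc := card_fixedVerts_of_not_pinned hp
    rw [hc] at ha ⊢
    have p1 : n ∣ j - 1 →
        GainDatum.ind (¬ G.datum.Pinned F ∧ G.datum.MulBalanced (j - 1) F) = 1 := fun h =>
      GainDatum.ind_of ⟨hp, b1.2 h⟩
    have p2 : n ∣ j + 1 →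
        GainDatum.ind (¬ G.datum.Pinned F ∧ G.datum.MulBalanced (j + 1) F) = 1 := fun h =>
      GainDatum.ind_of ⟨hp, b2.2 h⟩
    unfold GainDatum.groupDim at hg
    rcases ha with ⟨h, h'⟩ | ⟨h, h', h''⟩ | ⟨h1, h2, ⟨h3, h4⟩ | ⟨h3, h4, h5⟩ | ⟨h3, h4, h5, h6⟩⟩
    · rw [h] at p0 p1 p2
      have := p0 (one_dvd _)
      have := p1 (one_dvd _)
      have := p2 (one_dvd _)
      push_cast
      omega
    · rw [Nat.odd_iff] at h
      rw [h'] at p1 p2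
      have := p1 (by omega)
      have := p2 (by omega)
      push_cast
      omega
    · push_cast at h4 ⊢
      rcases h3 with h3 | h3
      · have := p1 h3
        omega
      · have := p2 h3
        omega
    · push_cast at h5 ⊢
      rcases h4 with h4 | h4
      · have := p0 h4
        omega
      · have := one_le_dim_of_nearBalanced hj hconn h4.1
        omega
    · push_cast at h6 ⊢
      omega

end Alpha

end GainGraph

namespace GainGraph

open Classical

/-! ### Gain sparsity as independence -/

section Components

variable {V E Γ : Type*} [CommGroup Γ] {G : GainGraph V E Γ} {F X Y : Finset E} {e f : E} {x y : V}

variable (G) in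
/-- The connected component of the edge `e` in `F`. -/
noncomputable def component (F : Finset E) (e : E) : Finset E :=
  F.filter fun f => G.Reachable F (G.src e) (G.src f)

theorem mem_component : f ∈ G.component F e ↔ f ∈ F ∧ G.Reachable F (G.src e) (G.src f) := by
  simp [component]

theorem component_subset : G.component F e ⊆ F := Finset.filter_subset _ _

theorem self_mem_component (he : e ∈ F) : e ∈ G.component F e :=
  mem_component.2 ⟨he, .refl⟩

theorem mem_components : X ∈ G.components F ↔ ∃ e ∈ F, G.component F e = X := by
  simp [components, component]

theorem component_eq_of_reachable (h : G.Reachable F (G.src e) (G.src f)) :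
    G.component F e = G.component F f := by
  ext x
  simp only [mem_component, and_congr_right_iff]
  exact fun _ => ⟨fun h' => h.symm.trans h', fun h' => h.trans h'⟩

theorem reachable_of_mem_verts (hx : x ∈ G.verts (G.component F e)) :
    G.Reachable F (G.src e) x := by
  obtain ⟨f, hf, rfl | rfl⟩ := mem_verts.1 hx
  · exact (mem_component.1 hf).2
  · exact (mem_component.1 hf).2.trans (reachable_edge (mem_component.1 hf).1)

theorem mem_component_of_step {s : E × Bool} (hs : s.1 ∈ F)
    (h : G.Reachable F (G.src e) (G.tail s)) : s.1 ∈ G.component F e := by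
  refine mem_component.2 ⟨hs, ?_⟩
  obtain ⟨f, _ | _⟩ := s
  · exact h.trans (reachable_step (s := (f, false)) hs)
  · exact h

theorem reachable_component (h : G.Reachable F (G.src e) x) :
    G.Reachable (G.component F e) (G.src e) x := by
  obtain ⟨g, hg⟩ := reachable_iff.1 h
  refine hg.induction (motive := fun _ x => G.Reachable (G.component F e) (G.src e) x) .refl ?_
  intro g s h1 h2 hs _
  exact h2.trans (reachable_step (mem_component_of_step hs (reachable_iff.2 ⟨_, h1⟩)))

theorem component_connected (hx : x ∈ G.verts (G.component F e))
    (hy : y ∈ G.verts (G.component F e)) : G.Reachable (G.component F e) x y :=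
  (reachable_component (reachable_of_mem_verts hx)).symm.trans
    (reachable_component (reachable_of_mem_verts hy))

theorem components_connected (hX : X ∈ G.components F) :
    ∀ x ∈ G.verts X, ∀ y ∈ G.verts X, G.Reachable X x y := by
  obtain ⟨e, -, rfl⟩ := mem_components.1 hX
  exact fun x hx y hy => component_connected hx hy

theorem mem_verts_of_mem_freeVerts (hx : x ∈ G.datum.freeVerts F) : x ∈ G.verts F := by
  obtain ⟨⟨e, he, h⟩, -⟩ := GainDatum.mem_freeVerts.1 hx
  exact mem_verts.2 ⟨e, he, h⟩

theorem disjoint_freeVerts_component :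
    Disjoint (G.datum.freeVerts (G.component F e))
      (G.datum.freeVerts (F \ G.component F e)) := by
  rw [Finset.disjoint_left]
  intro x hx hx'
  have h1 := reachable_of_mem_verts (mem_verts_of_mem_freeVerts hx)
  obtain ⟨f, hf, hfx⟩ := mem_verts.1 (mem_verts_of_mem_freeVerts hx')
  obtain ⟨hf, hf'⟩ := Finset.mem_sdiff.1 hf
  rcases hfx with rfl | rfl
  · exact hf' (mem_component_of_step (s := (f, true)) hf h1)
  · exact hf' (mem_component_of_step (s := (f, false)) hf h1)

variable [Finite Γ] [IsCyclic Γ] {j k : ℕ}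

/-- A disconnected set splits off a component; the free vertices of the two pieces are disjoint and
each piece has at least the dimension of the whole. -/
theorem indep_of_gainSparse (hj : 1 ≤ j) (hk : Nat.card Γ = k) (h : G.GainSparse k j) :
    G.datum.Indep j F := by
  suffices ∀ F : Finset E, F.Nonempty →
      F.card + G.datum.dim j F ≤ 2 * (G.datum.freeVerts F).card from fun F _ => this F
  intro F
  induction F using Finset.strongInduction with
  | H F ih =>
    rintro ⟨e, he⟩
    by_cases hF : G.component F e = F
    · have hcomp : G.components F = {F} := by
        ext X
        rw [mem_components, Finset.mem_singleton]
        constructor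
        · rintro ⟨f, hf, rfl⟩
          rw [← component_eq_of_reachable (mem_component.1 (hF.symm ▸ hf)).2, hF]
        · rintro rfl
          exact ⟨e, he, hF⟩
      have h1 := h F ⟨e, he⟩
      rw [count, hcomp, Finset.sum_singleton, card_verts] at h1
      have h2 := dim_add_alpha_le (G := G) (F := F) hj hk
      push_cast at h1
      omega
    · have hss : G.component F e ⊂ F := component_subset.ssubset_of_ne hF
      have h1 := ih _ hss ⟨e, self_mem_component he⟩
      have h2 := ih (F \ G.component F e)
        (Finset.sdiff_ssubset component_subset ⟨e, self_mem_component he⟩)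
        (Finset.sdiff_nonempty.2 fun h => hF (component_subset.antisymm h))
      have h3 := Finset.card_sdiff_add_card_eq_card (component_subset (G := G) (F := F) (e := e))
      have h4 := Finset.card_union_of_disjoint (disjoint_freeVerts_component (G := G) (F := F)
        (e := e))
      rw [← GainDatum.freeVerts_union, Finset.union_sdiff_of_subset component_subset] at h4
      have h5 := GainDatum.dim_anti (P := G.datum) (j := j)
        (component_subset (G := G) (F := F) (e := e))
      omega

theorem component_count_eq (hj : 1 ≤ j) (hk : Nat.card Γ = k) (hX : X ∈ G.components F) :
    2 * ((G.verts X).card : ℤ) - 3 + G.alpha k j X =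
      2 * (G.datum.freeVerts X).card - G.datum.dim j X := by
  have h1 := dim_add_alpha_le (G := G) (F := X) hj hk
  have h2 := three_le_dim_add_alpha hj hk (components_connected hX)
  rw [card_verts]
  push_cast
  omega

theorem gainSparse_of_indep (hj : 1 ≤ j) (hk : Nat.card Γ = k)
    (h : ∀ F, G.datum.Indep j F) : G.GainSparse k j := by
  intro F hF
  have h1 : F ⊆ (G.components F).biUnion id := fun e he =>
    Finset.mem_biUnion.2 ⟨_, mem_components.2 ⟨e, he, rfl⟩, self_mem_component he⟩
  have h2 := (Finset.card_le_card h1).trans Finset.card_biUnion_le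
  calc (F.card : ℤ) ≤ ∑ X ∈ G.components F, (X.card : ℤ) := by exact_mod_cast h2
    _ ≤ _ := Finset.sum_le_sum fun X hX => by
      rw [component_count_eq hj hk hX]
      obtain ⟨e, he, rfl⟩ := mem_components.1 hX
      have := h (G.component F e) _ subset_rfl ⟨e, self_mem_component he⟩
      omega

theorem count_eq (hj : 1 ≤ j) (hk : Nat.card Γ = k) :
    G.count k j F = 2 * (G.datum.freeVerts F).card - ∑ X ∈ G.components F, (G.datum.dim j X : ℤ) := by
  have h1 : G.datum.freeVerts F = (G.components F).biUnion fun X => G.datum.freeVerts X := by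
    ext x
    rw [Finset.mem_biUnion]
    constructor
    · intro hx
      obtain ⟨⟨e, he, h⟩, hx⟩ := GainDatum.mem_freeVerts.1 hx
      exact ⟨_, mem_components.2 ⟨e, he, rfl⟩,
        GainDatum.mem_freeVerts.2 ⟨⟨e, self_mem_component he, h⟩, hx⟩⟩
    · rintro ⟨X, hX, hx⟩
      obtain ⟨e, he, rfl⟩ := mem_components.1 hX
      exact GainDatum.freeVerts_mono component_subset hx
  have h2 : (G.datum.freeVerts F).card = ∑ X ∈ G.components F, (G.datum.freeVerts X).card := by
    rw [h1]
    refine Finset.card_biUnion fun X hX Y hY hXY => Finset.disjoint_left.2 fun x hx hx' => hXY ?_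
    obtain ⟨e, he, rfl⟩ := mem_components.1 hX
    obtain ⟨f, hf, rfl⟩ := mem_components.1 hY
    exact component_eq_of_reachable ((reachable_of_mem_verts (mem_verts_of_mem_freeVerts hx)).trans
      (reachable_of_mem_verts (mem_verts_of_mem_freeVerts hx')).symm)
  rw [count, Finset.sum_congr rfl fun X hX => component_count_eq hj hk hX,
    Finset.sum_sub_distrib, ← Finset.mul_sum, h2]
  push_cast
  rfl

end Components

end GainGraph

namespace GainDatum

open Classical

/-! ### Invariance under embeddings -/

section Embedding

variable {V U V' U' Γ : Type*} {P : GainDatum V U Γ} {P' : GainDatum V' U' Γ}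
  {ι : U' → U} {κ : V' → V} {F : Finset U'} {j m : ℕ}

variable (P P' ι κ) in
/-- `ι` and `κ` embed the labelled multigraph `P'` into `P`. -/
structure Embeds : Prop where
  inj_edge : Function.Injective ι
  inj_vert : Function.Injective κ
  src : ∀ e, P.src (ι e) = κ (P'.src e)
  tgt : ∀ e, P.tgt (ι e) = κ (P'.tgt e)
  gain : ∀ e, P.gain (ι e) = P'.gain e
  fixed : ∀ x, κ x ∈ P.fixed ↔ x ∈ P'.fixed

theorem Embeds.freeVerts (h : P.Embeds P' ι κ) :
    P.freeVerts (F.image ι) = (P'.freeVerts F).image κ := by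
  ext x
  simp only [mem_freeVerts, Finset.mem_image]
  constructor
  · rintro ⟨⟨_, ⟨e, he, rfl⟩, hx⟩, hf⟩
    rw [h.src, h.tgt] at hx
    rcases hx with rfl | rfl
    · exact ⟨_, ⟨⟨e, he, Or.inl rfl⟩, fun h' => hf ((h.fixed _).2 h')⟩, rfl⟩
    · exact ⟨_, ⟨⟨e, he, Or.inr rfl⟩, fun h' => hf ((h.fixed _).2 h')⟩, rfl⟩
  · rintro ⟨y, ⟨⟨e, he, hy⟩, hf⟩, rfl⟩
    refine ⟨⟨_, ⟨e, he, rfl⟩, ?_⟩, fun h' => hf ((h.fixed _).1 h')⟩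
    rw [h.src, h.tgt]
    exact hy.imp (congrArg κ) (congrArg κ)

theorem Embeds.pinned (h : P.Embeds P' ι κ) : P.Pinned (F.image ι) ↔ P'.Pinned F := by
  simp [Pinned, h.src, h.tgt, h.fixed]

variable [AddCommGroup Γ]

theorem Embeds.mulBalanced (h : P.Embeds P' ι κ) :
    P.MulBalanced m (F.image ι) ↔ P'.MulBalanced m F := by
  simp only [MulBalanced, Finset.forall_mem_image, h.src, h.tgt, h.gain, h.fixed]
  constructor
  · rintro ⟨p, hp⟩
    exact ⟨p ∘ κ, hp⟩
  · rintro ⟨p, hp⟩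
    refine ⟨Function.extend κ p 0, ?_⟩
    simpa only [h.inj_vert.extend_apply] using hp

/-- A split vertex outside the image of `κ` is harmless and may be replaced by any vertex; `F` is
non-empty so that there is one. -/
theorem Embeds.splitBalanced (h : P.Embeds P' ι κ) (hF : F.Nonempty) :
    P.SplitBalanced (F.image ι) ↔ P'.SplitBalanced F := by
  simp only [SplitBalanced, Explains, Finset.forall_mem_image, h.src, h.tgt, h.gain]
  constructor
  · rintro ⟨p, q, b, hb, hp⟩
    by_cases hbκ : ∃ b', κ b' = b
    · obtain ⟨b', rfl⟩ := hbκ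
      exact ⟨p ∘ κ, q ∘ κ, b', fun x hx => hb _ fun h' => hx (h.inj_vert h'), hp⟩
    · obtain ⟨e, -⟩ := hF
      exact ⟨p ∘ κ, q ∘ κ, P'.src e, fun x _ => hb _ fun h' => hbκ ⟨x, h'⟩, hp⟩
  · rintro ⟨p, q, b, hb, hp⟩
    refine ⟨Function.extend κ p 0, Function.extend κ q 0, κ b, fun x hx => ?_, ?_⟩
    · by_cases hxκ : ∃ y, κ y = x
      · obtain ⟨y, rfl⟩ := hxκ
        rw [h.inj_vert.extend_apply, h.inj_vert.extend_apply]
        exact hb y fun h' => hx (h' ▸ rfl)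
      · rw [Function.extend_apply' _ _ _ hxκ, Function.extend_apply' _ _ _ hxκ]
    · simpa only [h.inj_vert.extend_apply] using hp

theorem Embeds.dim (h : P.Embeds P' ι κ) (hF : F.Nonempty) :
    P.dim j (F.image ι) = P'.dim j F := by
  simp only [GainDatum.dim, groupDim, h.pinned, h.mulBalanced, h.splitBalanced hF]

theorem Embeds.indep (h : P.Embeds P' ι κ) : P.Indep j (F.image ι) ↔ P'.Indep j F := by
  constructor
  · intro hI X hX hne
    have := hI _ (Finset.image_subset_image hX) (hne.image ι)
    rwa [h.dim hne, h.freeVerts, Finset.card_image_of_injective _ h.inj_edge,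
      Finset.card_image_of_injective _ h.inj_vert] at this
  · intro hI Y hY hne
    obtain ⟨X, hX, rfl⟩ := Finset.subset_image_iff.1 hY
    have hne' : X.Nonempty := Finset.image_nonempty.1 hne
    rw [h.dim hne', h.freeVerts, Finset.card_image_of_injective _ h.inj_edge,
      Finset.card_image_of_injective _ h.inj_vert]
    exact hI X hX hne'

theorem Embeds.indep_of_forall_mem (h : P.Embeds P' ι κ) {I : Finset U} (hI : P.Indep j I)
    (hF : ∀ e ∈ F, ι e ∈ I) : P'.Indep j F :=
  h.indep.1 (hI.subset (Finset.image_subset_iff.2 hF))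

theorem Embeds.indep_of_forall_exists (h : P.Embeds P' ι κ) (hF : P'.Indep j F)
    {I : Finset U} (hI : ∀ e ∈ I, ∃ f ∈ F, ι f = e) : P.Indep j I :=
  (h.indep.2 hF).subset fun e he => Finset.mem_image.2 (hI e he)

end Embedding

end GainDatum

namespace GainDatum

open Classical

/-! ### Independent data are gain graphs -/

section Parallel

variable {V U Γ : Type*} [AddCommGroup Γ] {P : GainDatum V U Γ} {j : ℕ} {e f : U}

theorem mulBalanced_of_forall_fixed {F : Finset U} {m : ℕ}
    (h : ∀ e ∈ F, P.src e ∈ P.fixed ∨ P.tgt e ∈ P.fixed) : P.MulBalanced m F :=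
  ⟨0, fun e he h1 h2 => absurd (h e he) (by tauto)⟩

theorem Indep.ne_of_fixed (h : P.Indep j {e}) (he : P.src e ∈ P.fixed) : P.src e ≠ P.tgt e := by
  intro hst
  have h1 := h {e} subset_rfl (by simp)
  have h2 : P.freeVerts {e} ⊆ ∅ := freeVerts_subset_iff.2 fun f hf => by
    rw [Finset.mem_singleton.1 hf, ← hst]
    exact ⟨fun h => absurd he h, fun h => absurd he h⟩
  have := Finset.card_le_card h2
  simp only [Finset.card_singleton, Finset.card_empty] at *
  omega

theorem Indep.loop_gain_ne_zero (h : P.Indep j {e}) (he : P.src e = P.tgt e) :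
    P.gain e ≠ 0 := by
  intro hg
  by_cases hfix : P.src e ∈ P.fixed
  · exact h.ne_of_fixed hfix he
  have hp : ¬ P.Pinned {e} := by
    rintro ⟨f, hf, h'⟩
    rw [Finset.mem_singleton.1 hf, ← he] at h'
    tauto
  have h1 := h {e} subset_rfl (by simp)
  rw [dim_eq_three hp (mulBalanced_one_of (r := 0) fun f hf => by
    rw [Finset.mem_singleton.1 hf, hg]; simp)] at h1
  have h2 : P.freeVerts {e} ⊆ {P.src e} := freeVerts_subset_iff.2 fun f hf => by
    rw [Finset.mem_singleton.1 hf, ← he]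
    simp
  have := Finset.card_le_card h2
  simp only [Finset.card_singleton] at *
  omega

/-- The two edges have at most one free end vertex, and edges at a fixed vertex are balanced for
trivial reasons: `2 + 1 > 2`. -/
theorem Indep.eq_of_fixed (h : P.Indep j {e, f}) (he : P.src e ∈ P.fixed ∨ P.tgt e ∈ P.fixed)
    (hef : s(P.src e, P.tgt e) = s(P.src f, P.tgt f)) : e = f := by
  by_contra hne
  have h1 := h {e, f} subset_rfl (by simp)
  have hf : P.src f ∈ P.fixed ∨ P.tgt f ∈ P.fixed := by
    rcases Sym2.eq_iff.1 hef with ⟨h1, h2⟩ | ⟨h1, h2⟩ <;> rw [h1, h2] at he <;> tauto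
  have h2 : P.MulBalanced j {e, f} := mulBalanced_of_forall_fixed (by
    simp only [Finset.mem_insert, Finset.mem_singleton]
    rintro _ (rfl | rfl)
    exacts [he, hf])
  have h3 := one_le_dim_of_mulBalanced h2
  have h4 : ∃ x, P.freeVerts {e, f} ⊆ {x} := by
    rcases he with he | he
    · refine ⟨P.tgt e, freeVerts_subset_iff.2 ?_⟩
      simp only [Finset.mem_insert, Finset.mem_singleton]
      rintro _ (rfl | rfl)
      · tauto
      · rcases Sym2.eq_iff.1 hef with ⟨h1, h2⟩ | ⟨h1, h2⟩ <;> grind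
    · refine ⟨P.src e, freeVerts_subset_iff.2 ?_⟩
      simp only [Finset.mem_insert, Finset.mem_singleton]
      rintro _ (rfl | rfl)
      · tauto
      · rcases Sym2.eq_iff.1 hef with ⟨h1, h2⟩ | ⟨h1, h2⟩ <;> grind
  obtain ⟨x, hx⟩ := h4
  have h5 := Finset.card_le_card hx
  rw [Finset.card_pair hne] at h1
  simp only [Finset.card_singleton] at h5
  omega

/-- Two such edges between distinct free vertices would be balanced, `2 + 3 > 4`; two such loops
would be split balanced, `2 + 1 > 2`. -/
theorem Indep.eq_of_parallel (h : P.Indep j {e, f})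
    (hef : (P.src e = P.src f ∧ P.tgt e = P.tgt f ∧ P.gain e = P.gain f) ∨
      (P.src e = P.tgt f ∧ P.tgt e = P.src f ∧ P.gain e = -P.gain f)) : e = f := by
  by_cases hfix : P.src e ∈ P.fixed ∨ P.tgt e ∈ P.fixed
  · exact h.eq_of_fixed hfix (by
      rcases hef with ⟨h1, h2, -⟩ | ⟨h1, h2, -⟩
      · rw [h1, h2]
      · rw [h1, h2, Sym2.eq_swap])
  by_contra hne
  push Not at hfix
  have h1 := h {e, f} subset_rfl (by simp)
  rw [Finset.card_pair hne] at h1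
  have hp : ¬ P.Pinned {e, f} := by
    rintro ⟨d, hd, h'⟩
    simp only [Finset.mem_insert, Finset.mem_singleton] at hd
    rcases hd with rfl | rfl
    · tauto
    · rcases hef with ⟨h1, h2, -⟩ | ⟨h1, h2, -⟩ <;> rw [h1, h2] at hfix <;> tauto
  have h2 : P.freeVerts {e, f} ⊆ {P.src e, P.tgt e} := by
    refine freeVerts_subset_iff.2 ?_
    simp only [Finset.mem_insert, Finset.mem_singleton]
    rintro _ (rfl | rfl)
    · tauto
    · rcases hef with ⟨h1, h2, -⟩ | ⟨h1, h2, -⟩ <;> grind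
  have h3 := Finset.card_le_card h2
  by_cases hst : P.src e = P.tgt e
  · have h4 : P.SplitBalanced {e, f} := by
      refine ⟨0, Function.update 0 (P.tgt e) (P.gain e), P.tgt e, fun x hx => by simp [hx], ?_⟩
      simp only [Finset.mem_insert, Finset.mem_singleton]
      rintro _ (rfl | rfl)
      · exact ⟨0, _, Or.inl rfl, Or.inr rfl, by simp⟩
      · rcases hef with ⟨h1, h2, h3⟩ | ⟨h1, h2, h3⟩
        · exact ⟨0, _, Or.inl rfl, Or.inr rfl, by simp [h2, h3]⟩
        · exact ⟨_, 0, Or.inr rfl, Or.inl rfl, by simp [h2, h3]⟩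
    have := one_le_dim_of_split (j := j) hp h4
    rw [← hst, Finset.pair_eq_singleton, Finset.card_singleton] at h3
    omega
  · have h4 : P.MulBalanced 1 {e, f} := by
      refine mulBalanced_one_of (r := Function.update 0 (P.tgt e) (P.gain e)) ?_
      simp only [Finset.mem_insert, Finset.mem_singleton]
      rintro _ (rfl | rfl)
      · simp [hst]
      · rcases hef with ⟨h1, h2, h3⟩ | ⟨h1, h2, h3⟩
        · rw [← h1, ← h2]; simp [hst, h3]
        · rw [← h1, ← h2]; simp [hst, h3]
    rw [dim_eq_three hp h4] at h1
    rw [Finset.card_pair hst] at h3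
    omega

/-- An independent labelled multigraph is a gain graph. -/
def toGainGraph {Γ : Type*} [CommGroup Γ] (P : GainDatum V U (Additive Γ))
    (hfix : P.fixed.Subsingleton) (h : ∀ F, P.Indep j F) : GainGraph V U Γ where
  src := P.src
  tgt := P.tgt
  gain e := Additive.toMul (P.gain e)
  fixed := P.fixed
  fixed_subsingleton := hfix
  gain_ne_of_parallel _ _ hne h1 h2 h3 := hne ((h _).eq_of_parallel (Or.inl ⟨h1, h2, h3⟩))
  gain_ne_of_antiparallel _ _ hne h1 h2 h3 := hne ((h _).eq_of_parallel (Or.inr ⟨h1, h2, h3⟩))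
  fixed_no_loop _ := (h _).ne_of_fixed
  fixed_no_parallel _ _ := (h _).eq_of_fixed
  loop_gain_ne_one _ := (h _).loop_gain_ne_zero

end Parallel

end GainDatum

namespace GainGraph

open Classical

/-! ### The star at `v` and the new edges -/

section Star

variable {V E Γ : Type*} [Group Γ] {G : GainGraph V E Γ} {v : V} {s : Fin 3 → E × Bool}

variable (G v s) in
/-- `s` lists the three edges at `v`, none of which is a loop, as steps that start at `v`. -/
structure IsStar : Prop where
  tail : ∀ i, G.tail (s i) = v
  head : ∀ i, G.head (s i) ≠ v
  inj : Function.Injective fun i => (s i).1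
  complete : ∀ e, G.src e = v ∨ G.tgt e = v → ∃ i, (s i).1 = e

theorem exists_isStar [Fintype E] (hdeg : G.degree v = 3)
    (hloop : ∀ e, ¬ (G.src e = v ∧ G.tgt e = v)) : ∃ s, G.IsStar v s := by
  have hcard : (Finset.univ.filter fun e => G.src e = v ∨ G.tgt e = v).card = 3 := by
    rw [Finset.filter_or, Finset.card_union_of_disjoint]
    · exact hdeg
    · refine Finset.disjoint_left.2 fun e h1 h2 => hloop e ⟨?_, ?_⟩
      · simpa using h1
      · simpa using h2
  let φ := (Finset.equivFinOfCardEq hcard).symm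
  let d : E → E × Bool := fun e => (e, decide (G.src e = v))
  have hφ : ∀ i, G.src (φ i) = v ∨ G.tgt (φ i) = v := fun i =>
    (Finset.mem_filter.1 (φ i).2).2
  have hd : ∀ e, G.src e = v ∨ G.tgt e = v → G.tail (d e) = v ∧ G.head (d e) ≠ v := by
    intro e he
    have := hloop e
    by_cases h : G.src e = v
    · simp only [d, h, decide_true]
      exact ⟨h, fun h' => this ⟨h, h'⟩⟩
    · simp only [d, h, decide_false]
      exact ⟨he.resolve_left h, h⟩
  refine ⟨fun i => d (φ i), fun i => (hd _ (hφ i)).1, fun i => (hd _ (hφ i)).2, fun i i' h => ?_,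
    fun e he => ⟨φ.symm ⟨e, by simpa using he⟩, by simp [d]⟩⟩
  exact φ.injective (Subtype.ext h)

theorem IsStar.incident (h : G.IsStar v s) (i : Fin 3) :
    G.src (s i).1 = v ∨ G.tgt (s i).1 = v := by
  have := h.tail i
  rcases hs : s i with ⟨e, _ | _⟩ <;> rw [hs] at this
  exacts [Or.inr this, Or.inl this]

end Star

section Reduction

variable {V E Γ : Type*} [CommGroup Γ] (G : GainGraph V E Γ) {v : V} {s : Fin 3 → E × Bool}

/-- The gain graph `G` with the three edges that the possible 1-reductions add. -/
def withTriangle (s : Fin 3 → E × Bool) : GainDatum V (E ⊕ Fin 3) (Additive Γ) where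
  src := Sum.elim G.src fun i => G.head (s (i + 1))
  tgt := Sum.elim G.tgt fun i => G.head (s (i + 2))
  gain := Sum.elim (fun e => Additive.ofMul (G.gain e)) fun i =>
    Additive.ofMul ((G.stepGain (s (i + 1)))⁻¹ * G.stepGain (s (i + 2)))
  fixed := G.fixed

/-- The result of the 1-reduction at `v` that adds the `i`-th new edge. -/
def reduction (h : G.IsStar v s) (i : Fin 3) :
    GainDatum {w : V // w ≠ v} (Option (G.EdgesAway v)) (Additive Γ) where
  src
    | some e => ⟨G.src e, e.2.1⟩
    | none => ⟨G.head (s (i + 1)), h.head _⟩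
  tgt
    | some e => ⟨G.tgt e, e.2.2⟩
    | none => ⟨G.head (s (i + 2)), h.head _⟩
  gain
    | some e => Additive.ofMul (G.gain e)
    | none => Additive.ofMul ((G.stepGain (s (i + 1)))⁻¹ * G.stepGain (s (i + 2)))
  fixed := {w | (w : V) ∈ G.fixed}

variable {G}

theorem embeds_inl : (G.withTriangle s).Embeds G.datum Sum.inl id where
  inj_edge := Sum.inl_injective
  inj_vert := Function.injective_id
  src _ := rfl
  tgt _ := rfl
  gain _ := rfl
  fixed _ := Iff.rfl

theorem embeds_reduction (h : G.IsStar v s) (i : Fin 3) :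
    (G.withTriangle s).Embeds (G.reduction h i)
      (fun e => e.elim (Sum.inr i) fun e => Sum.inl e.1) Subtype.val where
  inj_edge := by
    rintro (_ | e) (_ | f) hef
    · rfl
    · exact absurd hef (by simp)
    · exact absurd hef (by simp)
    · have : (e : E) = f := by simpa using hef
      rw [Subtype.ext this]
  inj_vert := Subtype.val_injective
  src e := by cases e <;> rfl
  tgt e := by cases e <;> rfl
  gain e := by cases e <;> rfl
  fixed _ := Iff.rfl

end Reduction

end GainGraph

namespace GainGraph

open Classical

/-! ### Tightness of an independent reduction -/

section ReductionCount

variable {V E Γ : Type*} [CommGroup Γ] {G : GainGraph V E Γ} {v : V} {s : Fin 3 → E × Bool}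
  {i : Fin 3} {j m : ℕ}

theorem smul_stepGain_eq {X : Finset E} {p : V → Additive Γ}
    (hp : ∀ e ∈ X, G.src e ∉ G.fixed → G.tgt e ∉ G.fixed →
      m • Additive.ofMul (G.gain e) = p (G.tgt e) - p (G.src e)) {t : E × Bool} (ht : t.1 ∈ X)
    (h1 : G.tail t ∉ G.fixed) (h2 : G.head t ∉ G.fixed) :
    m • Additive.ofMul (G.stepGain t) = p (G.head t) - p (G.tail t) := by
  obtain ⟨e, _ | _⟩ := t
  · have := hp e ht h2 h1
    simp only [stepGain, head, tail, ofMul_inv, smul_neg, this]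
    abel
  · exact hp e ht h1 h2

section Dim

variable {X : Finset E} {X' : Finset (Option (G.EdgesAway v))}

theorem pinned_of_reduction (h : G.IsStar v s) (hX : ∀ e, some e ∈ X' → e.1 ∈ X)
    (hnone : none ∈ X' → ∀ i, (s i).1 ∈ X) (hp : (G.reduction h i).Pinned X') :
    G.datum.Pinned X := by
  have key : ∀ t : E × Bool, t.1 ∈ X → G.head t ∈ G.fixed → G.datum.Pinned X := by
    rintro ⟨e, _ | _⟩ he hf
    exacts [⟨e, he, Or.inl hf⟩, ⟨e, he, Or.inr hf⟩]
  obtain ⟨_ | e, he, h'⟩ := hp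
  · rcases h' with h' | h'
    exacts [key _ (hnone he _) h', key _ (hnone he _) h']
  · exact ⟨e, hX e he, h'⟩

theorem mulBalanced_reduction (h : G.IsStar v s) (hv : v ∉ G.fixed)
    (hX : ∀ e, some e ∈ X' → e.1 ∈ X) (hnone : none ∈ X' → ∀ i, (s i).1 ∈ X)
    (hp : G.datum.MulBalanced m X) : (G.reduction h i).MulBalanced m X' := by
  obtain ⟨p, hp⟩ := hp
  refine ⟨fun x => p x, ?_⟩
  rintro (_ | e) he h1 h2
  · have e1 := smul_stepGain_eq hp (hnone he (i + 1)) (by rwa [h.tail]) h1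
    have e2 := smul_stepGain_eq hp (hnone he (i + 2)) (by rwa [h.tail]) h2
    rw [h.tail] at e1 e2
    simp only [reduction, ofMul_mul, ofMul_inv, smul_add, smul_neg, e1, e2]
    abel
  · exact hp e (hX e he) h1 h2

theorem splitBalanced_reduction (h : G.IsStar v s)
    (hX : ∀ e, some e ∈ X' → e.1 ∈ X) (hnone : none ∈ X' → ∀ i, (s i).1 ∈ X)
    (hp : G.datum.SplitBalanced X) : (G.reduction h i).SplitBalanced X' := by
  obtain ⟨p, q, b, hb, hp⟩ := hp
  by_cases hbv : b = v
  · subst hbv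
    let a : {w : V // w ≠ b} := ⟨G.head (s (i + 1)), h.head _⟩
    let c : {w : V // w ≠ b} := ⟨G.head (s (i + 2)), h.head _⟩
    -- With `v` deleted, `p` explains all old edges. Only the new edge may fail, and the second copy
    -- of its head `c` is chosen to explain it.
    refine ⟨fun x => p x, Function.update (fun x => p x) c
      (p a + (G.reduction h i).gain none), c, fun x hx => by simp [hx], ?_⟩
    rintro (_ | e) he
    · exact ⟨_, _, Or.inl rfl, Or.inr rfl, by simp [reduction, a, c]⟩
    · obtain ⟨x, y, hx, hy, hg⟩ := hp e (hX e he)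
      have h1 : x = p (G.src e) := hx.elim id fun h' => h'.trans (hb _ e.2.1).symm
      have h2 : y = p (G.tgt e) := hy.elim id fun h' => h'.trans (hb _ e.2.2).symm
      exact ⟨x, y, Or.inl h1, Or.inl h2, hg⟩
  · refine ⟨fun x => p x, fun x => q x, if h' : b ≠ v then ⟨b, h'⟩ else ⟨_, h.head 0⟩,
      fun x hx => hb _ fun h' => hx (by simp [← h', x.2]), ?_⟩
    rintro (_ | e) he
    · obtain ⟨x1, y1, hx1, hy1, hg1⟩ := explains_step (s := s (i + 1)) (hp _ (hnone he (i + 1)))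
      obtain ⟨x2, y2, hx2, hy2, hg2⟩ := explains_step (s := s (i + 2)) (hp _ (hnone he (i + 2)))
      rw [h.tail, ← hb v (Ne.symm hbv), or_self] at hx1 hx2
      refine ⟨y1, y2, hy1, hy2, ?_⟩
      simp only [reduction, ofMul_mul, ofMul_inv, hg1, hg2, hx1, hx2]
      abel
    · exact hp e (hX e he)

theorem dim_le_reduction (h : G.IsStar v s) (hv : v ∉ G.fixed)
    (hX : ∀ e, some e ∈ X' → e.1 ∈ X) (hnone : none ∈ X' → ∀ i, (s i).1 ∈ X) :
    G.datum.dim j X ≤ (G.reduction h i).dim j X' := by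
  have h0 : ∀ m, G.datum.MulBalanced m X → (G.reduction h i).MulBalanced m X' := fun m =>
    mulBalanced_reduction h hv hX hnone
  have h1 : ¬ G.datum.Pinned X → ¬ (G.reduction h i).Pinned X' := fun h' h'' =>
    h' (pinned_of_reduction h hX hnone h'')
  exact max_le_max (Nat.add_le_add (Nat.add_le_add (GainDatum.ind_le_ind (h0 _))
    (GainDatum.ind_le_ind fun h => ⟨h1 h.1, h0 _ h.2⟩))
    (GainDatum.ind_le_ind fun h => ⟨h1 h.1, h0 _ h.2⟩))
    (GainDatum.ind_le_ind fun h' => ⟨h1 h'.1, splitBalanced_reduction h hX hnone h'.2⟩)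

end Dim

variable [Fintype E] [Fintype (Option (G.EdgesAway v))]
  {G' : GainGraph {w : V // w ≠ v} (Option (G.EdgesAway v)) Γ}

theorem reachable_of_reduction (h : G.IsStar v s) (hG' : G'.datum = G.reduction h i)
    {x y : {w : V // w ≠ v}} (hxy : G'.Reachable Finset.univ x y) :
    G.Reachable Finset.univ (x : V) y := by
  have hsrc : G'.src = (G.reduction h i).src := congrArg GainDatum.src hG'
  have htgt : G'.tgt = (G.reduction h i).tgt := congrArg GainDatum.tgt hG'
  have hnew : G.Reachable Finset.univ (G.head (s (i + 1))) (G.head (s (i + 2))) := by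
    have h1 := reachable_step (G := G) (Finset.mem_univ (s (i + 1)).1)
    have h2 := reachable_step (G := G) (Finset.mem_univ (s (i + 2)).1)
    rw [h.tail] at h1 h2
    exact h1.symm.trans h2
  obtain ⟨g, hg⟩ := reachable_iff.1 hxy
  refine hg.induction (motive := fun _ (y : {w : V // w ≠ v}) => G.Reachable Finset.univ (x : V) y)
    .refl ?_
  rintro g ⟨_ | e, _ | _⟩ - h2 - - <;> refine h2.trans ?_ <;>
    simp only [tail, head, hsrc, htgt]
  · exact hnew.symm
  · exact hnew
  · exact (reachable_edge (Finset.mem_univ e.1)).symm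
  · exact reachable_edge (Finset.mem_univ e.1)

/-- The component of `v` is matched with that of the new edge; a component away from `v` is matched
with the component of one of its own edges. -/
theorem exists_component_reduction (h : G.IsStar v s) (hG' : G'.datum = G.reduction h i)
    {X : Finset E} (hX : X ∈ G.components Finset.univ) :
    ∃ X' ∈ G'.components Finset.univ, X'.Nonempty ∧ (∀ e, some e ∈ X' → e.1 ∈ X) ∧
      (none ∈ X' → ∀ i, (s i).1 ∈ X) := by
  have hsrc : G'.src = (G.reduction h i).src := congrArg GainDatum.src hG'
  obtain ⟨e, -, rfl⟩ := mem_components.1 hX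
  by_cases hv : G.Reachable Finset.univ (G.src e) v
  · refine ⟨_, mem_components.2 ⟨none, Finset.mem_univ _, rfl⟩,
      ⟨none, self_mem_component (Finset.mem_univ _)⟩, fun f hf => ?_, fun _ i' => ?_⟩
    · have h1 := reachable_of_reduction h hG' (mem_component.1 hf).2
      rw [hsrc] at h1
      have h2 := reachable_step (G := G) (Finset.mem_univ (s (i + 1)).1)
      rw [h.tail] at h2
      exact mem_component.2 ⟨Finset.mem_univ _, hv.trans (h2.trans h1)⟩
    · exact mem_component_of_step (Finset.mem_univ _) (by rwa [h.tail])
  · have h1 : G.src e ≠ v := fun h' => hv (h' ▸ .refl)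
    have h2 : G.tgt e ≠ v := fun h' => hv (h' ▸ reachable_edge (Finset.mem_univ _))
    refine ⟨_, mem_components.2 ⟨some ⟨e, h1, h2⟩, Finset.mem_univ _, rfl⟩,
      ⟨_, self_mem_component (Finset.mem_univ _)⟩, fun f hf => ?_, fun hf => ?_⟩
    · have h1 := reachable_of_reduction h hG' (mem_component.1 hf).2
      rw [hsrc] at h1
      exact mem_component.2 ⟨Finset.mem_univ _, h1⟩
    · have h1 := reachable_of_reduction h hG' (mem_component.1 hf).2
      rw [hsrc] at h1
      have h2 := reachable_step (G := G) (Finset.mem_univ (s (i + 1)).1)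
      rw [h.tail] at h2
      exact absurd (h1.trans h2.symm) hv

/-- Deleting `v` may disconnect the graph, so the matching of components is only injective; further
components contribute non-negative dimensions. -/
theorem sum_dim_le_reduction (h : G.IsStar v s) (hv : v ∉ G.fixed)
    (hG' : G'.datum = G.reduction h i) :
    ∑ X ∈ G.components Finset.univ, (G.datum.dim j X : ℤ) ≤
      ∑ X ∈ G'.components Finset.univ, (G'.datum.dim j X : ℤ) := by
  choose! φ h1 h2 h3 h4 using fun X hX => exists_component_reduction h hG' (X := X) hX
  have hinj : Set.InjOn φ (G.components Finset.univ) := by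
    intro X hX Y hY hXY
    have hmeet : ∃ e ∈ X, e ∈ Y := by
      obtain ⟨_ | e, he⟩ := h2 X hX
      · exact ⟨_, h4 X hX he 0, h4 Y hY (hXY ▸ he) 0⟩
      · exact ⟨_, h3 X hX e he, h3 Y hY e (hXY ▸ he)⟩
    obtain ⟨f, hf, hf'⟩ := hmeet
    obtain ⟨a, -, rfl⟩ := mem_components.1 hX
    obtain ⟨b, -, rfl⟩ := mem_components.1 hY
    exact component_eq_of_reachable ((mem_component.1 hf).2.trans (mem_component.1 hf').2.symm)
  calc _ ≤ ∑ X ∈ G.components Finset.univ, (G'.datum.dim j (φ X) : ℤ) :=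
        Finset.sum_le_sum fun X hX => by
          rw [hG']
          exact_mod_cast dim_le_reduction h hv (h3 X hX) (h4 X hX)
    _ = ∑ X' ∈ (G.components Finset.univ).image φ, (G'.datum.dim j X' : ℤ) :=
        (Finset.sum_image (f := fun X' => (G'.datum.dim j X' : ℤ)) hinj).symm
    _ ≤ _ := Finset.sum_le_sum_of_subset_of_nonneg (Finset.image_subset_iff.2 h1)
        fun _ _ _ => Int.natCast_nonneg _

theorem card_freeVerts_reduction_lt (h : G.IsStar v s) (hv : v ∉ G.fixed) :
    ((G.reduction h i).freeVerts Finset.univ).card + 1 ≤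
      (G.datum.freeVerts Finset.univ).card := by
  have hmem : v ∈ G.datum.freeVerts Finset.univ :=
    GainDatum.mem_freeVerts.2 ⟨⟨_, Finset.mem_univ _, h.incident 0⟩, hv⟩
  have key : ∀ t : E × Bool, G.head t ∉ G.fixed → G.head t ∈ G.datum.freeVerts Finset.univ := by
    rintro ⟨e, _ | _⟩ he
    exacts [GainDatum.src_mem_freeVerts (P := G.datum) (Finset.mem_univ e) he,
      GainDatum.tgt_mem_freeVerts (P := G.datum) (Finset.mem_univ e) he]
  have hsub : ((G.reduction h i).freeVerts Finset.univ).image Subtype.val ⊆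
      (G.datum.freeVerts Finset.univ).erase v := by
    refine Finset.image_subset_iff.2 fun x hx => Finset.mem_erase.2 ⟨x.2, ?_⟩
    obtain ⟨⟨_ | e, -, rfl | rfl⟩, hx⟩ := GainDatum.mem_freeVerts.1 hx
    · exact key _ hx
    · exact key _ hx
    · exact key (e, false) hx
    · exact key (e, true) hx
  have := Finset.card_le_card hsub
  rw [Finset.card_image_of_injective _ Subtype.val_injective, Finset.card_erase_of_mem hmem] at this
  have := Finset.card_pos.2 ⟨v, hmem⟩
  omega

theorem card_edges_reduction (h : G.IsStar v s) :
    Fintype.card (Option (G.EdgesAway v)) + 2 = Fintype.card E := by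
  have h1 : (Finset.univ.filter fun e => ¬ (G.src e ≠ v ∧ G.tgt e ≠ v)) =
      Finset.univ.image fun i => (s i).1 := by
    ext e
    simp only [Finset.mem_filter, Finset.mem_univ, true_and, Finset.mem_image]
    constructor
    · exact fun he => h.complete e (by tauto)
    · rintro ⟨i, rfl⟩
      have := h.incident i
      tauto
  have h2 := Finset.card_filter_add_card_filter_not (s := (Finset.univ : Finset E))
    fun e => G.src e ≠ v ∧ G.tgt e ≠ v
  rw [h1, Finset.card_image_of_injective _ h.inj, ← Fintype.card_subtype] at h2
  have h3 := Finite.card_option (α := G.EdgesAway v)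
  simp only [Finset.card_univ, Fintype.card_fin] at h2
  have h4 : Nat.card (G.EdgesAway v) + 3 = Fintype.card E := by
    rw [Nat.card_eq_fintype_card]
    exact h2
  rw [← Nat.card_eq_fintype_card]
  omega

variable [Finite Γ] [IsCyclic Γ] {k : ℕ}

/-- Two edges are lost, at least one free vertex is lost and the sum of the dimensions does not
drop, so the upper count falls by at least 2; sparsity gives the other inequality. -/
theorem gainTight_reduction (hj : 1 ≤ j) (hk : Nat.card Γ = k) (hG : G.GainTight k j)
    (h : G.IsStar v s) (hv : v ∉ G.fixed) (hG' : G'.datum = G.reduction h i)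
    (hI : ∀ F, G'.datum.Indep j F) : G'.GainTight k j := by
  have h0 := gainSparse_of_indep hj hk hI
  refine ⟨h0, le_antisymm (h0 Finset.univ ⟨none, Finset.mem_univ _⟩) ?_⟩
  have h1 := hG.2
  rw [count_eq hj hk] at h1 ⊢
  have h2 := sum_dim_le_reduction (j := j) h hv hG'
  have h3 := card_freeVerts_reduction_lt (i := i) h hv
  have h4 := card_edges_reduction h
  rw [← hG'] at h3
  omega

end ReductionCount

section Admissible

variable {V E Γ : Type*} [CommGroup Γ] {G : GainGraph V E Γ} {v : V} {s : Fin 3 → E × Bool}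
  {i : Fin 3} {j k : ℕ} [Fintype E] [Finite Γ] [IsCyclic Γ]

theorem hasAdmissibleOneReduction_of_indep (hj : 1 ≤ j) (hk : Nat.card Γ = k)
    (hG : G.GainTight k j) (h : G.IsStar v s) (hv : v ∉ G.fixed) (hdeg : G.degree v = 3)
    (hloop : ∀ e, ¬ (G.src e = v ∧ G.tgt e = v))
    {I : Finset (E ⊕ Fin 3)} (hI : (G.withTriangle s).Indep j I) (hi : Sum.inr i ∈ I)
    (he : ∀ e, G.src e ≠ v ∧ G.tgt e ≠ v → Sum.inl e ∈ I) :
    G.HasAdmissibleOneReduction k j v := by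
  have hI' : ∀ F, (G.reduction h i).Indep j F := by
    intro F
    refine (embeds_reduction h i).indep_of_forall_mem hI ?_
    rintro (_ | e) -
    exacts [hi, he e.1 e.2]
  have hfix : (G.reduction h i).fixed.Subsingleton := fun x hx y hy =>
    Subtype.ext (G.fixed_subsingleton hx hy)
  refine ⟨(G.reduction h i).toGainGraph hfix hI', ⟨hv, hdeg, hloop, fun _ => Iff.rfl,
    fun e => ⟨rfl, rfl, rfl⟩, s (i + 1), s (i + 2), fun h' => ?_, h.tail _, h.tail _, rfl, rfl,
    rfl⟩, gainTight_reduction hj hk hG h hv (i := i) rfl hI'⟩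
  have : i + 1 = i + 2 := h.inj h'
  omega

end Admissible

end GainGraph

namespace GainDatum

open Classical

/-! ### Small independent sets -/

section Small

variable {V U Γ : Type*} [AddCommGroup Γ] {P : GainDatum V U Γ} {j m : ℕ} {e f : U}
  {F I : Finset U} {a : Γ}

theorem indep_empty : P.Indep j ∅ := fun _ hF hne =>
  absurd (Finset.subset_empty.1 hF) hne.ne_empty

theorem indep_of_forall_erase [DecidableEq U] (h : ∀ e ∈ I, P.Indep j (I.erase e))
    (hI : I.card + P.dim j I ≤ 2 * (P.freeVerts I).card) : P.Indep j I := by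
  intro F hF hne
  rcases hF.eq_or_ssubset with rfl | hss
  · exact hI
  · obtain ⟨e, he, he'⟩ := Finset.exists_of_ssubset hss
    exact h e he F (Finset.subset_erase.2 ⟨hF, he'⟩) hne

theorem indep_singleton (h : 1 + P.dim j {e} ≤ 2 * (P.freeVerts {e}).card) :
    P.Indep j {e} :=
  indep_of_forall_erase (fun f hf => by
    rw [Finset.mem_singleton.1 hf, Finset.erase_singleton]
    exact indep_empty) (by simpa using h)

theorem indep_pair [DecidableEq U] (hef : e ≠ f) (he : P.Indep j {e}) (hf : P.Indep j {f})
    (h : 2 + P.dim j {e, f} ≤ 2 * (P.freeVerts {e, f}).card) : P.Indep j {e, f} := by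
  refine indep_of_forall_erase ?_ (by simpa [Finset.card_pair hef] using h)
  simp only [Finset.mem_insert, Finset.mem_singleton]
  rintro _ (rfl | rfl)
  · refine hf.subset ?_
    grind
  · refine he.subset ?_
    grind

theorem dim_of_pinned (h : P.Pinned F) : P.dim j F = ind (P.MulBalanced j F) := by
  simp [dim, groupDim, h, ind]

theorem dim_le_one_of_pinned (h : P.Pinned F) : P.dim j F ≤ 1 :=
  dim_of_pinned h ▸ ind_le_one _

/-- If two of `j - 1`, `j`, `j + 1` were balanced, both would kill `a`. Consecutive ones give `a =
0`; `j - 1` and `j + 1` give `2 • a = 0`, which for even `j` again forces `a = 0`. -/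
theorem dim_le_one_of_forall (hj : 1 ≤ j) (h : ∀ m, P.MulBalanced m F → m • a = 0) (ha : a ≠ 0)
    (h2 : Odd j → 2 • a ≠ 0) : P.dim j F ≤ 1 := by
  obtain ⟨i, rfl⟩ : ∃ i, j = i + 1 := ⟨j - 1, by omega⟩
  refine max_le ?_ (ind_le_one _)
  have h01 : P.MulBalanced (i + 1) F → ¬ P.MulBalanced i F := fun h0 h1 => ha (by
    have := h _ h0
    rwa [add_smul, h _ h1, zero_add, one_smul] at this)
  have h02 : P.MulBalanced (i + 1 + 1) F → ¬ P.MulBalanced (i + 1) F := fun h0 h1 => ha (by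
    have := h _ h0
    rwa [add_smul, h _ h1, zero_add, one_smul] at this)
  have h12 : P.MulBalanced (i + 1 + 1) F → ¬ P.MulBalanced i F := fun h0 h1 => by
    have e0 := h _ h0
    have e1 := h _ h1
    rw [add_assoc, add_smul, e1, zero_add] at e0
    rcases Nat.even_or_odd i with hi | hi
    · exact h2 hi.add_one e0
    · obtain ⟨c, rfl⟩ := hi
      rw [add_smul, mul_comm, mul_smul, show 2 • a = 0 from e0, smul_zero, zero_add,
        one_smul] at e1
      exact ha e1
  unfold groupDim ind
  simp only [Nat.add_sub_cancel]
  split_ifs <;> first | omega | tauto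

theorem smul_gain_eq_zero (h : P.MulBalanced m F) (he : e ∈ F) (hst : P.src e = P.tgt e)
    (hf : P.src e ∉ P.fixed) : m • P.gain e = 0 := by
  obtain ⟨p, hp⟩ := h
  rw [hp e he hf (hst ▸ hf), hst, sub_self]

theorem dim_le_one_of_loop (hj : 1 ≤ j) (he : e ∈ F) (hst : P.src e = P.tgt e)
    (hf : P.src e ∉ P.fixed) (h0 : P.gain e ≠ 0) (h2 : Odd j → 2 • P.gain e ≠ 0) :
    P.dim j F ≤ 1 :=
  dim_le_one_of_forall hj (fun _ h => smul_gain_eq_zero h he hst hf) h0 h2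

theorem indep_singleton_of_loop (hj : 1 ≤ j) (hst : P.src e = P.tgt e)
    (hf : P.src e ∉ P.fixed) (h0 : P.gain e ≠ 0) (h2 : Odd j → 2 • P.gain e ≠ 0) :
    P.Indep j {e} := by
  refine indep_singleton ?_
  have h1 := dim_le_one_of_loop hj (Finset.mem_singleton_self e) hst hf h0 h2
  have h3 := Finset.card_pos.2 ⟨_, src_mem_freeVerts (Finset.mem_singleton_self e) hf⟩
  omega

theorem two_le_card_freeVerts {V U Γ : Type*} {P : GainDatum V U Γ} {F : Finset U} {x y : V} (hxy : x ≠ y) (hx : x ∈ P.freeVerts F)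
    (hy : y ∈ P.freeVerts F) : 2 ≤ (P.freeVerts F).card := by
  rw [← Finset.card_pair hxy]
  exact Finset.card_le_card (by grind)

theorem indep_singleton_of_ne (hfix : P.fixed.Subsingleton) (hst : P.src e ≠ P.tgt e) :
    P.Indep j {e} := by
  refine indep_singleton ?_
  have he := Finset.mem_singleton_self e
  by_cases h1 : P.src e ∈ P.fixed
  · have h2 : P.tgt e ∉ P.fixed := fun h2 => hst (hfix h1 h2)
    have h3 := dim_le_one_of_pinned (j := j) ⟨e, he, Or.inl h1⟩
    have h4 := Finset.card_pos.2 ⟨_, tgt_mem_freeVerts he h2⟩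
    omega
  · by_cases h2 : P.tgt e ∈ P.fixed
    · have h3 := dim_le_one_of_pinned (j := j) ⟨e, he, Or.inr h2⟩
      have h4 := Finset.card_pos.2 ⟨_, src_mem_freeVerts he h1⟩
      omega
    · have h3 := dim_le_three (P := P) (j := j) (F := {e})
      have h4 := two_le_card_freeVerts hst (src_mem_freeVerts he h1) (tgt_mem_freeVerts he h2)
      omega

theorem gain_eq_of_splitBalanced_loops (h : P.SplitBalanced F) (he : e ∈ F) (hf : f ∈ F)
    (h1 : P.src e = P.tgt e) (h2 : P.src f = P.src e) (h3 : P.tgt f = P.src e)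
    (he0 : P.gain e ≠ 0) (hf0 : P.gain f ≠ 0) :
    P.gain e = P.gain f ∨ P.gain e = - P.gain f := by
  obtain ⟨p, q, b, -, hp⟩ := h
  obtain ⟨x, y, hx, hy, e1⟩ := hp e he
  obtain ⟨z, w, hz, hw, e2⟩ := hp f hf
  rw [← h1] at hy
  rw [h2] at hz
  rw [h3] at hw
  rcases hx with rfl | rfl <;> rcases hy with rfl | rfl <;> rcases hz with rfl | rfl <;>
    rcases hw with rfl | rfl <;> simp_all

end Small

/-! ### Independent subsets of the triangle -/

section Triangle

variable {V Γ : Type*} [AddCommGroup Γ] {B : Set V} {n : Fin 3 → V} {g : Fin 3 → Γ}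
  {j m : ℕ} {i : Fin 3}

variable (B n g) in
/-- The triangle on the vertices `n i` with the gains that the potentials `g i` induce. -/
def triangle : GainDatum V (Fin 3) Γ where
  src i := n (i + 1)
  tgt i := n (i + 2)
  gain i := g (i + 2) - g (i + 1)
  fixed := B

theorem triangle_exists_end {F : Finset (Fin 3)} (hF : 2 ≤ F.card) (i : Fin 3) :
    ∃ e ∈ F, e + 1 = i ∨ e + 2 = i := by
  obtain ⟨e, he, hei⟩ := Finset.exists_mem_ne hF i
  exact ⟨e, he, by omega⟩

theorem mem_freeVerts_triangle {F : Finset (Fin 3)} (hF : 2 ≤ F.card) (hi : n i ∉ B) :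
    n i ∈ (triangle B n g).freeVerts F := by
  obtain ⟨e, he, h⟩ := triangle_exists_end hF i
  exact mem_freeVerts.2 ⟨⟨e, he, h.imp (congrArg n) (congrArg n)⟩, hi⟩

theorem pinned_triangle {F : Finset (Fin 3)} (hF : 2 ≤ F.card) (hi : n i ∈ B) :
    (triangle B n g).Pinned F := by
  obtain ⟨e, he, h | h⟩ := triangle_exists_end hF i
  exacts [⟨e, he, Or.inl (by subst h; exact hi)⟩, ⟨e, he, Or.inr (by subst h; exact hi)⟩]

/-- Two edges already meet all three vertices. Without a fixed vertex at most `3 + 3` is needed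
against 6, with one at most `3 + 1` against 4. -/
theorem indep_triangle_of_injective (hB : B.Subsingleton) (hn : Function.Injective n)
    (I : Finset (Fin 3)) : (triangle B n g).Indep j I := by
  intro F _ hne
  rcases Nat.lt_or_ge F.card 2 with hF | hF
  · obtain ⟨e, rfl⟩ := Finset.card_eq_one.1 (Nat.le_antisymm (by omega) hne.card_pos)
    refine (indep_singleton_of_ne hB ?_) _ subset_rfl (by simp)
    exact fun h => by
      have : e + 1 = e + 2 := hn h
      omega
  · have h3 : F.card ≤ 3 := (Finset.card_le_univ F).trans (by simp)
    have hcard : ((Finset.univ.filter fun i => n i ∉ B).image n).card ≤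
        ((triangle B n g).freeVerts F).card := by
      refine Finset.card_le_card (Finset.image_subset_iff.2 fun i hi => ?_)
      exact mem_freeVerts_triangle hF (Finset.mem_filter.1 hi).2
    rw [Finset.card_image_of_injective _ hn] at hcard
    have hsplit := Finset.card_filter_add_card_filter_not (s := (Finset.univ : Finset (Fin 3)))
      fun i => n i ∉ B
    rw [Finset.card_univ, Fintype.card_fin] at hsplit
    have hle : (Finset.univ.filter fun i => ¬ n i ∉ B).card ≤ 1 :=
      Finset.card_le_one.2 fun a ha b hb => hn (hB (by simpa using ha) (by simpa using hb))
    by_cases hp : ∃ i, n i ∈ B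
    · obtain ⟨i, hi⟩ := hp
      have h1 := dim_le_one_of_pinned (j := j) (pinned_triangle (g := g) hF hi)
      omega
    · have h0 : (Finset.univ.filter fun i => ¬ n i ∉ B).card = 0 := by
        rw [Finset.card_eq_zero, Finset.filter_eq_empty_iff]
        exact fun i _ h' => hp ⟨i, not_not.1 h'⟩
      have h1 := dim_le_three (P := triangle B n g) (j := j) (F := F)
      omega

theorem indep_triangle_singleton_next (hB : B.Subsingleton) (h12 : n (i + 1) = n (i + 2))
    (hi : n i ≠ n (i + 1)) : (triangle B n g).Indep j {i + 1} := by
  refine indep_singleton_of_ne hB ?_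
  simp only [triangle, show i + 1 + 1 = i + 2 by omega, show i + 1 + 2 = i by omega, ← h12]
  exact hi.symm

theorem indep_triangle_singleton_prev (hB : B.Subsingleton) (hi : n i ≠ n (i + 1)) :
    (triangle B n g).Indep j {i + 2} := by
  refine indep_singleton_of_ne hB ?_
  simp only [triangle, show i + 2 + 1 = i by omega, show i + 2 + 2 = i + 1 by omega]
  exact hi

/-- The two parallel edges have different gains, so their dimension is at most 2 on two free
vertices. -/
theorem indep_triangle_pair (hB : B.Subsingleton) (h12 : n (i + 1) = n (i + 2))
    (h1 : n (i + 1) ∉ B) (hi : n i ≠ n (i + 1)) (hiB : n i ∉ B)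
    (h0 : g (i + 2) - g (i + 1) ≠ 0) : (triangle B n g).Indep j {i + 1, i + 2} := by
  have hne : i + 1 ≠ i + 2 := by omega
  have hc : 2 ≤ ({i + 1, i + 2} : Finset (Fin 3)).card := by rw [Finset.card_pair hne]
  refine indep_pair hne (indep_triangle_singleton_next hB h12 hi)
    (indep_triangle_singleton_prev hB hi) ?_
  have h2 := two_le_card_freeVerts hi (mem_freeVerts_triangle (g := g) hc hiB)
    (mem_freeVerts_triangle hc h1)
  have h3 := dim_le_three (P := triangle B n g) (j := j) (F := {i + 1, i + 2})
  have h4 : (triangle B n g).dim j {i + 1, i + 2} ≠ 3 := by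
    intro h4
    obtain ⟨-, p, hp⟩ := dim_eq_three_iff.1 h4
    have e1 := hp (i + 1) (by simp)
    have e2 := hp (i + 2) (by simp)
    simp only [triangle, show i + 1 + 1 = i + 2 by omega, show i + 1 + 2 = i by omega,
      show i + 2 + 1 = i by omega, show i + 2 + 2 = i + 1 by omega, ← h12, one_smul] at e1 e2
    have e1 := e1 h1 hiB
    have e2 := e2 hiB h1
    apply h0
    grind
  omega

/-- The loop keeps the dimension at most 1, so all three edges need at most `3 + 1` on two free
vertices. -/
theorem indep_triangle_univ (hj : 1 ≤ j) (hB : B.Subsingleton) (h12 : n (i + 1) = n (i + 2))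
    (h1 : n (i + 1) ∉ B) (hi : n i ≠ n (i + 1)) (hiB : n i ∉ B)
    (h0 : g (i + 2) - g (i + 1) ≠ 0) (h2 : Odd j → 2 • (g (i + 2) - g (i + 1)) ≠ 0) :
    (triangle B n g).Indep j Finset.univ := by
  have hloop : (triangle B n g).Indep j {i} := indep_singleton_of_loop hj h12 h1 h0 h2
  have hdim : ∀ F : Finset (Fin 3), i ∈ F → (triangle B n g).dim j F ≤ 1 := fun F hF =>
    dim_le_one_of_loop hj hF h12 h1 h0 h2
  have hcard : ∀ F : Finset (Fin 3), 2 ≤ F.card → 2 ≤ ((triangle B n g).freeVerts F).card :=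
    fun F hF => two_le_card_freeVerts hi (mem_freeVerts_triangle hF hiB)
      (mem_freeVerts_triangle hF h1)
  have hpair : ∀ f, i ≠ f → (triangle B n g).Indep j {f} → (triangle B n g).Indep j {i, f} := by
    intro f hf hI
    refine indep_pair hf hloop hI ?_
    have e1 := hdim {i, f} (by simp)
    have e2 := hcard {i, f} (by rw [Finset.card_pair hf])
    omega
  refine indep_of_forall_erase (fun e _ => ?_) ?_
  · have he : e = i ∨ e = i + 1 ∨ e = i + 2 := by omega
    rcases he with rfl | rfl | rfl
    · refine (indep_triangle_pair hB h12 h1 hi hiB h0).subset fun f hf => ?_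
      have := (Finset.mem_erase.1 hf).1
      simp only [Finset.mem_insert, Finset.mem_singleton]
      omega
    · refine (hpair (i + 2) (by omega) (indep_triangle_singleton_prev hB hi)).subset
        fun f hf => ?_
      have := (Finset.mem_erase.1 hf).1
      simp only [Finset.mem_insert, Finset.mem_singleton]
      omega
    · refine (hpair (i + 1) (by omega) (indep_triangle_singleton_next hB h12 hi)).subset
        fun f hf => ?_
      have := (Finset.mem_erase.1 hf).1
      simp only [Finset.mem_insert, Finset.mem_singleton]
      omega
  · have e1 := hdim Finset.univ (Finset.mem_univ _)
    have e2 := hcard Finset.univ (by simp)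
    simp only [Finset.card_univ, Fintype.card_fin]
    omega

/-- A pinned set has only the multiple `j` available, and the loop excludes it. -/
theorem indep_triangle_loop_pin (hj : 1 ≤ j) (hB : B.Subsingleton) (h12 : n (i + 1) = n (i + 2))
    (h1 : n (i + 1) ∉ B) (hi : n i ≠ n (i + 1)) (hiB : n i ∈ B)
    (h0 : j • (g (i + 2) - g (i + 1)) ≠ 0) (h2 : Odd j → 2 • (g (i + 2) - g (i + 1)) ≠ 0) :
    (triangle B n g).Indep j {i, i + 1} := by
  have hne : i ≠ i + 1 := by omega
  have hc : 2 ≤ ({i, i + 1} : Finset (Fin 3)).card := by rw [Finset.card_pair hne]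
  have h0' : g (i + 2) - g (i + 1) ≠ 0 := fun h => h0 (by rw [h, smul_zero])
  refine indep_pair hne (indep_singleton_of_loop hj h12 h1 h0' h2)
    (indep_triangle_singleton_next hB h12 hi) ?_
  rw [dim_of_pinned (pinned_triangle hc hiB), ind_of_not]
  · have := Finset.card_pos.2 ⟨_, mem_freeVerts_triangle (g := g) hc h1⟩
    omega
  · exact fun h => h0 (smul_gain_eq_zero h (e := i) (by simp) h12 h1)

/-- The three gains sum to zero, so a multiple that kills two of them kills the third. Splitting the
vertex would make the two gains equal or opposite, and opposite gains make the third one zero. The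
dimension is therefore 0. -/
theorem indep_triangle_two_loops {x : V} (hj : 1 ≤ j) (hn : ∀ i, n i = x) (hx : x ∉ B)
    (hg : ∀ i, g (i + 2) - g (i + 1) ≠ 0) {e f : Fin 3} (hef : e ≠ f)
    (hm : ∀ m, m = j ∨ m = j - 1 ∨ m = j + 1 → ∃ i, m • (g (i + 2) - g (i + 1)) ≠ 0)
    (he : Odd j → 2 • (g (e + 2) - g (e + 1)) ≠ 0)
    (hf : Odd j → 2 • (g (f + 2) - g (f + 1)) ≠ 0)
    (hne : g (e + 2) - g (e + 1) ≠ g (f + 2) - g (f + 1)) :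
    (triangle B n g).Indep j {e, f} := by
  have hfree : ∀ i, n i ∉ B := fun i => hn i ▸ hx
  have hloop : ∀ i, n (i + 1) = n (i + 2) := fun i => (hn _).trans (hn _).symm
  have hsum : ∀ i, (g (i + 2) - g (i + 1)) + ((g (e + 2) - g (e + 1)) + (g (f + 2) - g (f + 1))) = 0
      ∨ i = e ∨ i = f := by
    intro i
    by_cases h : i = e ∨ i = f
    · exact Or.inr h
    · left
      have h' : (e = i + 1 ∧ f = i + 2) ∨ (e = i + 2 ∧ f = i + 1) := by omega
      rcases h' with ⟨rfl, rfl⟩ | ⟨rfl, rfl⟩ <;>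
        simp only [show i + 1 + 1 = i + 2 by omega, show i + 1 + 2 = i by omega,
          show i + 2 + 1 = i by omega, show i + 2 + 2 = i + 1 by omega] <;> abel
  have hsingle : ∀ i, (Odd j → 2 • (g (i + 2) - g (i + 1)) ≠ 0) →
      (triangle B n g).Indep j {i} := fun i hi =>
    indep_singleton_of_loop hj (hloop i) (hfree _) (hg i) hi
  refine indep_pair hef (hsingle e he) (hsingle f hf) ?_
  have hcard := Finset.card_pos.2 ⟨_, src_mem_freeVerts (P := triangle B n g)
    (F := {e, f}) (e := e) (by simp) (hfree _)⟩
  have h0 : (triangle B n g).groupDim j {e, f} = 0 := by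
    by_contra h0
    obtain ⟨m, hmj, hmb⟩ := exists_mulBalanced_of_groupDim_pos (Nat.pos_of_ne_zero h0)
    obtain ⟨i, hi⟩ := hm m hmj
    have e1 : m • (g (e + 2) - g (e + 1)) = 0 :=
      smul_gain_eq_zero hmb (e := e) (by simp) (hloop _) (hfree _)
    have e2 : m • (g (f + 2) - g (f + 1)) = 0 :=
      smul_gain_eq_zero hmb (e := f) (by simp) (hloop _) (hfree _)
    rcases hsum i with h | rfl | rfl
    · have := congrArg (m • ·) h
      simp only [smul_add, e1, e2, smul_zero, add_zero] at this
      exact hi this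
    · exact hi e1
    · exact hi e2
  have hs : ¬ (triangle B n g).SplitBalanced {e, f} := by
    intro hs
    have := gain_eq_of_splitBalanced_loops hs (e := e) (f := f) (by simp) (by simp) (hloop _)
      ((hn _).trans (hn _).symm) ((hn _).trans (hn _).symm) (hg e) (hg f)
    rcases this with h | h
    · exact hne h
    · obtain ⟨i, hie, hif⟩ : ∃ i, i ≠ e ∧ i ≠ f := by
        by_contra! h
        have := h (e + 1)
        have := h (e + 2)
        omega
      rcases hsum i with h' | h' | h'
      · apply hg i
        simp only [triangle] at h
        rw [h] at h'
        simpa using h'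
      · exact hie h'
      · exact hif h'
  rcases dim_cases (P := triangle B n g) (j := j) (F := {e, f}) with h | ⟨-, -, -, h⟩
  · omega
  · exact absurd h hs

end Triangle

end GainDatum

namespace GainDatum

open Classical

section Spanned

variable {V U Γ : Type*} [AddCommGroup Γ] {P : GainDatum V U Γ} {j : ℕ} {E₀ S T J R : Finset U}

theorem Indep.of_spanned (hj : 1 ≤ j) (hES : ∀ I, (∀ e ∈ I, e ∈ E₀ ∨ e ∈ S) → P.Indep j I)
    (hdisj : Disjoint E₀ S) (hT : ∀ t ∈ T, ∀ I, t ∈ I → E₀ ⊆ I → ¬ P.Indep j I)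
    (hJT : J ⊆ T) (hJ : P.Indep j J) (hR : ∀ e ∈ R, e ∈ J ∨ e ∈ S) : P.Indep j R :=
  (Indep.union_of_spanned hj (hES (E₀ ∪ S) fun _ => Finset.mem_union.1) hdisj
    (fun t ht => hT t ht _ (Finset.mem_insert_self _ _) (Finset.subset_insert _ _)) hJT hJ).subset
      fun e he => Finset.mem_union.2 (hR e he)

end Spanned

section Triangle

variable {Γ : Type*} [AddCommGroup Γ] {j : ℕ} {g : Fin 3 → Γ}

theorem triangle_sum_eq_zero (g : Fin 3 → Γ) (i : Fin 3) :
    (g (i + 2) - g (i + 1)) + (g (i + 1 + 2) - g (i + 1 + 1)) +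
      (g (i + 2 + 2) - g (i + 2 + 1)) = 0 := by
  simp only [show i + 1 + 1 = i + 2 by omega, show i + 1 + 2 = i by omega,
    show i + 2 + 1 = i by omega, show i + 2 + 2 = i + 1 by omega]
  abel

/-- Two gains of order 2 would be the same involution, and the third gain would vanish. -/
theorem two_smul_triangle_ne (hinv : ∀ x y : Γ, 2 • x = 0 → 2 • y = 0 → x ≠ 0 → y ≠ 0 → x = y)
    (hg : ∀ i, g (i + 2) - g (i + 1) ≠ 0) {e f : Fin 3} (hef : e ≠ f)
    (he : 2 • (g (e + 2) - g (e + 1)) = 0) : 2 • (g (f + 2) - g (f + 1)) ≠ 0 := by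
  intro hf
  have h := hinv _ _ he hf (hg e) (hg f)
  have h' : f = e + 1 ∨ f = e + 2 := by omega
  have hsum := triangle_sum_eq_zero g e
  rcases h' with rfl | rfl
  · rw [← h, ← two_nsmul, he, zero_add] at hsum
    exact hg (e + 2) hsum
  · rw [← h, add_right_comm, ← two_nsmul, he, zero_add] at hsum
    exact hg (e + 1) hsum

/-- If no relevant character kills all three gains, then two of them generate a group that is large
enough. -/
theorem exists_triangle_pair (hj : 1 ≤ j)
    (hinv : ∀ x y : Γ, 2 • x = 0 → 2 • y = 0 → x ≠ 0 → y ≠ 0 → x = y)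
    (hg : ∀ i, g (i + 2) - g (i + 1) ≠ 0)
    (hm : ∀ m, m = j ∨ m = j - 1 ∨ m = j + 1 → ∃ i, m • (g (i + 2) - g (i + 1)) ≠ 0) :
    ∃ e f : Fin 3, e ≠ f ∧ (Odd j → 2 • (g (e + 2) - g (e + 1)) ≠ 0) ∧
      (Odd j → 2 • (g (f + 2) - g (f + 1)) ≠ 0) ∧
      g (e + 2) - g (e + 1) ≠ g (f + 2) - g (f + 1) := by
  have hdvd : ∀ (d : ℕ) (c : ℕ) (x : Γ), d • x = 0 → (d * c) • x = 0 := fun d c x h => by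
    rw [mul_comm, mul_smul, h, smul_zero]
  by_cases hbad : Odd j ∧ ∃ i, 2 • (g (i + 2) - g (i + 1)) = 0
  · obtain ⟨hodd, i, hi⟩ := hbad
    refine ⟨i + 1, i + 2, by omega, fun _ => two_smul_triangle_ne hinv hg (by omega) hi,
      fun _ => two_smul_triangle_ne hinv hg (by omega) hi, fun h => ?_⟩
    have hsum := triangle_sum_eq_zero g i
    rw [← h, add_assoc, ← two_nsmul] at hsum
    -- One gain is an involution. If the other two were equal, all three would be killed by 4, which
    -- divides `j - 1` or `j + 1` as `j` is odd.
    have h4 : 4 • (g (i + 1 + 2) - g (i + 1 + 1)) = 0 := by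
      have := congrArg (2 • ·) hsum
      simp only [smul_add, hi, zero_add, smul_smul, smul_zero] at this
      exact this
    obtain ⟨m, hmj, c, hc⟩ : ∃ m, (m = j ∨ m = j - 1 ∨ m = j + 1) ∧ 4 ∣ m := by
      obtain ⟨c, rfl⟩ := hodd
      rcases Nat.even_or_odd' c with ⟨d, rfl | rfl⟩
      · exact ⟨_, Or.inr (Or.inl rfl), d, by omega⟩
      · exact ⟨_, Or.inr (Or.inr rfl), d + 1, by omega⟩
    obtain ⟨e, he⟩ := hm m hmj
    have he' : e = i ∨ e = i + 1 ∨ e = i + 2 := by omega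
    rw [hc] at he
    rcases he' with rfl | rfl | rfl
    · exact he (hdvd _ _ _ (by rw [show 4 = 2 * 2 by rfl, mul_smul, hi, smul_zero]))
    · exact he (hdvd _ _ _ h4)
    · exact he (hdvd _ _ _ (h ▸ h4))
  · have hgood : ∀ i, Odd j → 2 • (g (i + 2) - g (i + 1)) ≠ 0 := fun i h h' => hbad ⟨h, i, h'⟩
    by_contra! hno
    have heq : ∀ e f : Fin 3, g (e + 2) - g (e + 1) = g (f + 2) - g (f + 1) := fun e f => by
      by_cases hef : e = f
      · rw [hef]
      · exact hno e f hef (hgood e) (hgood f)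
    -- If all three gains are equal, their zero sum shows that 3 kills them, and 3 divides one of `j
    -- - 1`, `j`, `j + 1`.
    have h3 : ∀ i, 3 • (g (i + 2) - g (i + 1)) = 0 := fun i => by
      have hsum := triangle_sum_eq_zero g i
      rw [heq (i + 1) i, heq (i + 2) i] at hsum
      rw [← hsum]
      abel
    obtain ⟨m, hmj, c, hc⟩ : ∃ m, (m = j ∨ m = j - 1 ∨ m = j + 1) ∧ 3 ∣ m := by
      have : 3 ∣ j ∨ 3 ∣ j - 1 ∨ 3 ∣ j + 1 := by omega
      rcases this with h | h | h
      exacts [⟨_, Or.inl rfl, h⟩, ⟨_, Or.inr (Or.inl rfl), h⟩, ⟨_, Or.inr (Or.inr rfl), h⟩]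
    obtain ⟨i, hi⟩ := hm m hmj
    exact hi (hc ▸ hdvd _ _ _ (h3 i))

end Triangle

end GainDatum

namespace GainGraph

open Classical

/-! ### The wheel bound -/

section Wheel

variable {V E Γ : Type*} [CommGroup Γ] {G : GainGraph V E Γ} {v : V} {s : Fin 3 → E × Bool}
  {j m : ℕ}

variable (G s) in
/-- The end vertices of the three edges of a star. -/
def leaf (i : Fin 3) : V := G.head (s i)

variable (G s) in
/-- The gains of the three edges of a star, directed away from its centre. -/
def leafGain (i : Fin 3) : Additive Γ := Additive.ofMul (G.stepGain (s i))

variable (G s) in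
/-- The triangle that the possible 1-reductions at the centre of a star add. -/
abbrev leafTriangle : GainDatum V (Fin 3) (Additive Γ) :=
  GainDatum.triangle G.fixed (G.leaf s) (G.leafGain s)

theorem embeds_inr : (G.withTriangle s).Embeds (G.leafTriangle s) Sum.inr id where
  inj_edge := Sum.inr_injective
  inj_vert := Function.injective_id
  src _ := rfl
  tgt _ := rfl
  gain i := by
    simp only [withTriangle, GainDatum.triangle, leafGain, Sum.elim_inr, ofMul_mul, ofMul_inv]
    abel
  fixed _ := Iff.rfl

theorem IsStar.leaf_ne (h : G.IsStar v s) (i : Fin 3) : G.leaf s i ≠ v := h.head i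

theorem IsStar.leaf_not_fixed (h : G.IsStar v s) {i i' : Fin 3} (hne : i ≠ i')
    (hl : G.leaf s i = G.leaf s i') : G.leaf s i ∉ G.fixed := by
  intro hf
  refine hne (h.inj (?_ : (s i).1 = (s i').1))
  have h1 := h.tail i
  have h2 := h.tail i'
  unfold leaf at hl hf
  rcases hs : s i with ⟨e, _ | _⟩ <;> rcases hs' : s i' with ⟨e', _ | _⟩ <;>
    rw [hs] at h1 hl hf <;> rw [hs'] at h2 hl <;> simp only [GainGraph.head, GainGraph.tail] at h1 h2 hl hf
  · exact G.fixed_no_parallel e e' (Or.inl hf) (by rw [h1, h2, hl])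
  · exact G.fixed_no_parallel e e' (Or.inl hf) (by rw [h1, h2, hl, Sym2.eq_swap])
  · exact G.fixed_no_parallel e e' (Or.inr hf) (by rw [h1, h2, hl, Sym2.eq_swap])
  · exact G.fixed_no_parallel e e' (Or.inr hf) (by rw [h1, h2, hl])

theorem IsStar.leafGain_ne (h : G.IsStar v s) {i i' : Fin 3} (hne : i ≠ i')
    (hl : G.leaf s i = G.leaf s i') : G.leafGain s i ≠ G.leafGain s i' := by
  intro hg
  have hne' : (s i).1 ≠ (s i').1 := fun h' => hne (h.inj h')
  have h1 := h.tail i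
  have h2 := h.tail i'
  unfold leaf at hl
  have hg : G.stepGain (s i) = G.stepGain (s i') := hg
  rcases hs : s i with ⟨e, _ | _⟩ <;> rcases hs' : s i' with ⟨e', _ | _⟩ <;>
    rw [hs] at h1 hl hg hne' <;> rw [hs'] at h2 hl hg hne' <;>
    simp only [GainGraph.head, GainGraph.tail, stepGain] at h1 h2 hl hg hne'
  · exact G.gain_ne_of_parallel e e' hne' hl (h1.trans h2.symm) (inv_injective hg)
  · exact G.gain_ne_of_antiparallel e e' hne' hl (h1.trans h2.symm) (by rw [← hg, inv_inv])
  · exact G.gain_ne_of_antiparallel e e' hne' (h1.trans h2.symm) hl hg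
  · exact G.gain_ne_of_parallel e e' hne' (h1.trans h2.symm) hl hg

variable [Fintype E]

variable (G v) in
/-- The edges at `v`. -/
noncomputable def incidentEdges : Finset E := Finset.univ.filter fun e => G.src e = v ∨ G.tgt e = v

variable (G v) in
/-- The edges at `v` and the three edges that the possible 1-reductions add. -/
noncomputable def wheel : Finset (E ⊕ Fin 3) := (G.incidentEdges v).disjSum Finset.univ

theorem mem_incidentEdges {e : E} : e ∈ G.incidentEdges v ↔ G.src e = v ∨ G.tgt e = v := by
  simp [incidentEdges]

theorem IsStar.card_incidentEdges (h : G.IsStar v s) : (G.incidentEdges v).card = 3 := by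
  have : G.incidentEdges v = Finset.univ.image fun i => (s i).1 := by
    ext e
    simp only [mem_incidentEdges, Finset.mem_image, Finset.mem_univ, true_and]
    constructor
    · exact h.complete e
    · rintro ⟨i, rfl⟩
      exact h.incident i
  rw [this, Finset.card_image_of_injective _ h.inj]
  simp

theorem IsStar.wheel_cases (h : G.IsStar v s) {e : E ⊕ Fin 3} (he : e ∈ G.wheel v) :
    (∃ i, e = Sum.inl (s i).1 ∧
      (((G.withTriangle s).src e = v ∧ (G.withTriangle s).tgt e = G.leaf s i ∧
        (G.withTriangle s).gain e = G.leafGain s i) ∨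
      ((G.withTriangle s).src e = G.leaf s i ∧ (G.withTriangle s).tgt e = v ∧
        (G.withTriangle s).gain e = - G.leafGain s i))) ∨
    ∃ i, (G.withTriangle s).src e = G.leaf s (i + 1) ∧
      (G.withTriangle s).tgt e = G.leaf s (i + 2) ∧
      (G.withTriangle s).gain e = G.leafGain s (i + 2) - G.leafGain s (i + 1) := by
  rcases e with e | i
  · left
    obtain ⟨i, rfl⟩ := h.complete e (mem_incidentEdges.1 (Finset.inl_mem_disjSum.1 he))
    refine ⟨i, rfl, ?_⟩
    have ht := h.tail i
    unfold leaf leafGain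
    rcases hs : s i with ⟨e, _ | _⟩ <;> rw [hs] at ht
    · exact Or.inr ⟨rfl, ht, by simp [withTriangle, stepGain]⟩
    · exact Or.inl ⟨ht, rfl, rfl⟩
  · exact Or.inr ⟨i, rfl, rfl, embeds_inr.gain i⟩

theorem IsStar.not_pinned_wheel (h : G.IsStar v s) (hv : v ∉ G.fixed)
    (hn : ∀ i, G.leaf s i ∉ G.fixed) : ¬ (G.withTriangle s).Pinned (G.wheel v) := by
  rintro ⟨e, he, hfix⟩
  change _ ∈ G.fixed ∨ _ ∈ G.fixed at hfix
  rcases h.wheel_cases he with ⟨i, -, ⟨h1, h2, -⟩ | ⟨h1, h2, -⟩⟩ | ⟨i, h1, h2, -⟩ <;>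
    rw [h1, h2] at hfix
  · exact hfix.elim hv (hn _)
  · exact hfix.elim (hn _) hv
  · exact hfix.elim (hn _) (hn _)

/-- New edges carry differences of star gains, so checking the star suffices. -/
theorem IsStar.mulBalanced_wheel (h : G.IsStar v s) (p : V → Additive Γ)
    (hp : ∀ i, G.leaf s i ∉ G.fixed → m • G.leafGain s i = p (G.leaf s i) - p v) :
    (G.withTriangle s).MulBalanced m (G.wheel v) := by
  refine ⟨p, fun e he hs ht => ?_⟩
  change _ ∉ G.fixed at hs ht
  rcases h.wheel_cases he with ⟨i, -, ⟨h1, h2, h3⟩ | ⟨h1, h2, h3⟩⟩ | ⟨i, h1, h2, h3⟩ <;>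
    rw [h1] at hs <;> rw [h2] at ht <;> rw [h1, h2, h3]
  · exact hp i ht
  · rw [smul_neg, hp i hs, neg_sub]
  · rw [smul_sub, hp _ hs, hp _ ht]
    abel

theorem IsStar.splitBalanced_wheel (h : G.IsStar v s) {p q : V → Additive Γ} {b : V}
    (hb : ∀ x, x ≠ b → p x = q x)
    (hp : ∀ i, ∃ y, (y = p (G.leaf s i) ∨ y = q (G.leaf s i)) ∧ G.leafGain s i = y - p v) :
    (G.withTriangle s).SplitBalanced (G.wheel v) := by
  refine ⟨p, q, b, hb, fun e he => ?_⟩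
  rcases h.wheel_cases he with ⟨i, -, ⟨h1, h2, h3⟩ | ⟨h1, h2, h3⟩⟩ | ⟨i, h1, h2, h3⟩ <;>
    unfold GainDatum.Explains <;> rw [h1, h2, h3]
  · obtain ⟨y, hy, hg⟩ := hp i
    exact ⟨_, y, Or.inl rfl, hy, hg⟩
  · obtain ⟨y, hy, hg⟩ := hp i
    exact ⟨y, _, hy, Or.inl rfl, by rw [hg, neg_sub]⟩
  · obtain ⟨y, hy, hg⟩ := hp (i + 1)
    obtain ⟨z, hz, hg'⟩ := hp (i + 2)
    exact ⟨y, z, hy, hz, by rw [hg, hg']; abel⟩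

theorem IsStar.card_freeVerts_wheel_le (h : G.IsStar v s) {A : Finset V} (hv : v ∈ A)
    (hA : ∀ i, G.leaf s i ∉ G.fixed → G.leaf s i ∈ A) :
    ((G.withTriangle s).freeVerts (G.wheel v)).card ≤ A.card := by
  refine Finset.card_le_card (GainDatum.freeVerts_subset_iff.2 fun e he => ?_)
  change (_ ∉ G.fixed → _) ∧ (_ ∉ G.fixed → _)
  rcases h.wheel_cases he with ⟨i, -, ⟨h1, h2, -⟩ | ⟨h1, h2, -⟩⟩ | ⟨i, h1, h2, -⟩ <;> rw [h1, h2]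
  · exact ⟨fun _ => hv, hA i⟩
  · exact ⟨hA i, fun _ => hv⟩
  · exact ⟨hA _, hA _⟩

variable [Finite Γ] [IsCyclic Γ] {k : ℕ}

theorem IsStar.card_add_dim_wheel_le (h : G.IsStar v s) (hj : 1 ≤ j) (hk : Nat.card Γ = k)
    (hG : G.GainTight k j) (hv : v ∉ G.fixed) (hdeg : G.degree v = 3)
    (hloop : ∀ e, ¬ (G.src e = v ∧ G.tgt e = v)) (hno : ¬ G.HasAdmissibleOneReduction k j v)
    {K : Finset (Fin 3)} (hK : (G.leafTriangle s).Indep j K) :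
    K.card + 3 + (G.withTriangle s).dim j (G.wheel v) ≤
      2 * ((G.withTriangle s).freeVerts (G.wheel v)).card := by
  let S := G.incidentEdges v
  let E₀ : Finset E := Finset.univ.filter fun e => G.src e ≠ v ∧ G.tgt e ≠ v
  have hmem : ∀ {A : Finset E} {K : Finset (Fin 3)} {e}, e ∈ A.disjSum K ↔
      (∃ a ∈ A, Sum.inl a = e) ∨ ∃ b ∈ K, Sum.inr b = e := Finset.mem_disjSum
  have hI : (G.withTriangle s).Indep j (S.disjSum K) := by
    -- Each triangle edge depends on the edges away from `v`, for otherwise its reduction would be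
    -- admissible; those edges and the star together are the independent set of all edges of `G`.
    refine GainDatum.Indep.of_spanned hj (E₀ := E₀.disjSum ∅) (S := S.disjSum ∅)
      (T := (∅ : Finset E).disjSum Finset.univ) (J := (∅ : Finset E).disjSum K) ?_ ?_ ?_ ?_ ?_ ?_
    · intro I hI
      refine embeds_inl.indep_of_forall_exists
        (indep_of_gainSparse (F := Finset.univ) hj hk hG.1) fun e he => ?_
      rcases e with e | i
      · exact ⟨e, Finset.mem_univ _, rfl⟩
      · exact absurd (hI _ he) (by simp)
    · rw [Finset.disjoint_left]
      rintro (e | i) he he'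
      · have h1 := (Finset.mem_filter.1 (Finset.inl_mem_disjSum.1 he)).2
        have h2 := mem_incidentEdges.1 (Finset.inl_mem_disjSum.1 he')
        tauto
      · simp at he
    · rintro (e | i) hi I hiI hE hI
      · simp at hi
      · refine hno (hasAdmissibleOneReduction_of_indep (i := i) hj hk hG h hv hdeg hloop hI hiI
          fun e he => hE (Finset.inl_mem_disjSum.2 ?_))
        exact Finset.mem_filter.2 ⟨Finset.mem_univ _, he⟩
    · exact Finset.disjSum_mono subset_rfl (Finset.subset_univ _)
    · refine embeds_inr.indep_of_forall_exists hK fun e he => ?_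
      rcases hmem.1 he with ⟨a, ha, -⟩ | h'
      exacts [absurd ha (by simp), h']
    · rintro (e | i) he
      · exact Or.inr (Finset.inl_mem_disjSum.2 (Finset.inl_mem_disjSum.1 he))
      · exact Or.inl (Finset.inr_mem_disjSum.2 (Finset.inr_mem_disjSum.1 he))
  have hsub : S.disjSum K ⊆ G.wheel v := Finset.disjSum_mono subset_rfl (Finset.subset_univ _)
  have hcard : (S.disjSum K).card = 3 + K.card := by
    rw [Finset.card_disjSum, h.card_incidentEdges]
  have h1 := hI _ subset_rfl (Finset.card_pos.1 (by omega))
  have h2 := GainDatum.dim_anti (P := G.withTriangle s) (j := j) hsub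
  have h3 := Finset.card_le_card (GainDatum.freeVerts_mono (P := G.withTriangle s) hsub)
  omega

end Wheel

end GainGraph

namespace GainGraph

open Classical

/-! ### Case analysis on the neighbours of `v` -/

section Cases

variable {V E Γ : Type*} [CommGroup Γ] {G : GainGraph V E Γ} {v : V} {s : Fin 3 → E × Bool}
  {i : Fin 3} {j : ℕ}

theorem leaf_cases (h12 : G.leaf s (i + 1) = G.leaf s (i + 2)) (e : Fin 3) :
    e = i ∨ G.leaf s e = G.leaf s (i + 1) := by
  have : e = i ∨ e = i + 1 ∨ e = i + 2 := by omega
  rcases this with rfl | rfl | rfl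
  exacts [Or.inl rfl, Or.inr rfl, Or.inr h12.symm]

variable [Fintype E]

variable (G v s j) in
/-- The bound that holds if every new edge depends on the edges away from `v`. -/
def WheelBound : Prop := ∀ K : Finset (Fin 3), (G.leafTriangle s).Indep j K →
  K.card + 3 + (G.withTriangle s).dim j (G.wheel v) ≤
    2 * ((G.withTriangle s).freeVerts (G.wheel v)).card

/-- The whole triangle is independent and the wheel is balanced: `3 + 3 + 3 > 2 · 4`, or `3 + 3 + 1
> 2 · 3` if a neighbour is fixed. -/
theorem IsStar.not_injective_leaf (h : G.IsStar v s) (hv : v ∉ G.fixed) (hW : G.WheelBound v s j) :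
    ¬ Function.Injective (G.leaf s) := by
  intro hn
  have hb := hW Finset.univ (GainDatum.indep_triangle_of_injective G.fixed_subsingleton hn _)
  rw [Finset.card_univ, Fintype.card_fin] at hb
  let p : V → Additive Γ := fun x => if hx : ∃ i, G.leaf s i = x then G.leafGain s hx.choose else 0
  have hp : ∀ i, p (G.leaf s i) = G.leafGain s i := fun i => by
    have hx : ∃ i', G.leaf s i' = G.leaf s i := ⟨i, rfl⟩
    simp only [p, dif_pos hx, hn hx.choose_spec]
  have hpv : p v = 0 := dif_neg fun ⟨i, hi⟩ => h.leaf_ne i hi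
  have hbal : (G.withTriangle s).MulBalanced 1 (G.wheel v) :=
    h.mulBalanced_wheel p fun i _ => by rw [hp, hpv, one_smul, sub_zero]
  let A : Finset (Fin 3) := Finset.univ.filter fun i => G.leaf s i ∉ G.fixed
  have hN := h.card_freeVerts_wheel_le (A := insert v (A.image (G.leaf s)))
    (Finset.mem_insert_self _ _) fun i hi => Finset.mem_insert_of_mem
      (Finset.mem_image_of_mem _ (Finset.mem_filter.2 ⟨Finset.mem_univ _, hi⟩))
  have hN' := hN.trans ((Finset.card_insert_le _ _).trans
    (Nat.add_le_add_right Finset.card_image_le 1))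
  by_cases hfix : ∀ i, G.leaf s i ∉ G.fixed
  · rw [GainDatum.dim_eq_three (h.not_pinned_wheel hv hfix) hbal] at hb
    have hA : A.card ≤ 3 := (Finset.card_le_univ _).trans (by simp)
    omega
  · push Not at hfix
    obtain ⟨i, hi⟩ := hfix
    have hA : A.card < 3 := by
      have : A ⊂ Finset.univ := Finset.filter_ssubset.2 ⟨i, Finset.mem_univ _, not_not.2 hi⟩
      simpa using Finset.card_lt_card this
    have hd := GainDatum.one_le_dim_of_mulBalanced (hbal.smul j)
    omega

theorem IsStar.mulBalanced_wheel_of_smul_eq (h : G.IsStar v s) {m : ℕ}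
    (h12 : G.leaf s (i + 1) = G.leaf s (i + 2)) (hi : G.leaf s i ≠ G.leaf s (i + 1))
    (hm : m • (G.leafGain s (i + 2) - G.leafGain s (i + 1)) = 0) :
    (G.withTriangle s).MulBalanced m (G.wheel v) := by
  rw [smul_sub, sub_eq_zero] at hm
  refine h.mulBalanced_wheel (Function.update (Function.update 0 (G.leaf s i)
    (m • G.leafGain s i)) (G.leaf s (i + 1)) (m • G.leafGain s (i + 1))) fun e _ => ?_
  have hv1 := (h.leaf_ne (i + 1)).symm
  have hvi := (h.leaf_ne i).symm
  have he : e = i ∨ e = i + 1 ∨ e = i + 2 := by omega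
  rcases he with rfl | rfl | rfl
  · simp [hi, hv1, hvi]
  · simp [hv1, hvi]
  · simp [← h12, hv1, hvi, hm]

/-- Otherwise the wheel has at most three free vertices. If `j` is odd and 2 kills the gain of the
loop, the two parallel edges are independent and `j - 1` and `j + 1` are balanced: `2 + 3 + 2 > 6`.
If not, the whole triangle is independent and splitting the double neighbour balances the wheel: `3
+ 3 + 1 > 6`. -/
theorem IsStar.fixed_of_two_leaves (h : G.IsStar v s) (hj : 1 ≤ j) (hv : v ∉ G.fixed)
    (hW : G.WheelBound v s j) (h12 : G.leaf s (i + 1) = G.leaf s (i + 2))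
    (hi : G.leaf s i ≠ G.leaf s (i + 1)) : G.leaf s i ∈ G.fixed := by
  by_contra hiB
  have h1 : G.leaf s (i + 1) ∉ G.fixed := h.leaf_not_fixed (by omega) h12
  have h0 : G.leafGain s (i + 2) - G.leafGain s (i + 1) ≠ 0 :=
    sub_ne_zero.2 (h.leafGain_ne (by omega) h12.symm)
  have hfree : ∀ e, G.leaf s e ∉ G.fixed := fun e => by
    rcases leaf_cases h12 e with rfl | h'
    exacts [hiB, h' ▸ h1]
  have hp := h.not_pinned_wheel hv hfree
  have hN := (h.card_freeVerts_wheel_le (A := {v, G.leaf s i, G.leaf s (i + 1)}) (by simp)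
    fun e _ => by rcases leaf_cases h12 e with rfl | h' <;> simp [*]).trans Finset.card_le_three
  by_cases h2 : Odd j ∧ 2 • (G.leafGain s (i + 2) - G.leafGain s (i + 1)) = 0
  · obtain ⟨hodd, h2⟩ := h2
    have hb := hW _ (GainDatum.indep_triangle_pair G.fixed_subsingleton h12 h1 hi hiB h0)
    rw [Finset.card_pair (by omega)] at hb
    obtain ⟨c, rfl⟩ := hodd
    have hm : ∀ c : ℕ, (2 * c) • (G.leafGain s (i + 2) - G.leafGain s (i + 1)) = 0 := fun c => by
      rw [mul_comm, mul_smul, h2, smul_zero]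
    have e1 : (G.withTriangle s).MulBalanced (2 * c + 1 - 1) (G.wheel v) :=
      h.mulBalanced_wheel_of_smul_eq h12 hi (hm c)
    have e2 : (G.withTriangle s).MulBalanced (2 * c + 1 + 1) (G.wheel v) :=
      h.mulBalanced_wheel_of_smul_eq h12 hi (hm (c + 1))
    have hd : 2 ≤ (G.withTriangle s).groupDim (2 * c + 1) (G.wheel v) := by
      unfold GainDatum.groupDim
      rw [GainDatum.ind_of (And.intro hp e1), GainDatum.ind_of (And.intro hp e2)]
      omega
    have hd' := hd.trans GainDatum.groupDim_le_dim
    omega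
  · have hb := hW _ (GainDatum.indep_triangle_univ hj G.fixed_subsingleton h12 h1 hi hiB h0
      fun ho h' => h2 ⟨ho, h'⟩)
    rw [Finset.card_univ, Fintype.card_fin] at hb
    have hs : (G.withTriangle s).SplitBalanced (G.wheel v) := by
      let p : V → Additive Γ := Function.update (Function.update 0 (G.leaf s i)
        (G.leafGain s i)) (G.leaf s (i + 1)) (G.leafGain s (i + 1))
      have hv1 := (h.leaf_ne (i + 1)).symm
      have hvi := (h.leaf_ne i).symm
      have hpv : p v = 0 := by simp [p, hv1, hvi]
      refine h.splitBalanced_wheel (p := p) (q := Function.update p (G.leaf s (i + 1))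
        (G.leafGain s (i + 2))) (b := G.leaf s (i + 1)) (fun x hx => by simp [hx])
        fun e => ⟨_, ?_, by rw [hpv, sub_zero]⟩
      have he : e = i ∨ e = i + 1 ∨ e = i + 2 := by omega
      rcases he with rfl | rfl | rfl
      · exact Or.inl (by simp [p, hi])
      · exact Or.inl (by simp [p])
      · exact Or.inr (by simp [← h12])
    have hd := GainDatum.one_le_dim_of_split (j := j) hp hs
    omega

/-- Otherwise the wheel has at most two free vertices. If `j` kills the gain of the loop, one edge
to the fixed vertex gives `1 + 3 + 1 > 4`; if not, that edge and the loop give `2 + 3 > 4`. -/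
theorem IsStar.two_smul_of_fixed (h : G.IsStar v s) (hj : 1 ≤ j) (hW : G.WheelBound v s j)
    (h12 : G.leaf s (i + 1) = G.leaf s (i + 2)) (hi : G.leaf s i ≠ G.leaf s (i + 1))
    (hiB : G.leaf s i ∈ G.fixed) :
    Odd j ∧ 2 • (G.leafGain s (i + 2) - G.leafGain s (i + 1)) = 0 := by
  by_contra h2
  have h1 : G.leaf s (i + 1) ∉ G.fixed := h.leaf_not_fixed (by omega) h12
  have hN := (h.card_freeVerts_wheel_le (A := {v, G.leaf s (i + 1)}) (by simp)
    fun e he => by rcases leaf_cases h12 e with rfl | h' <;> simp_all).trans Finset.card_le_two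
  by_cases h0 : j • (G.leafGain s (i + 2) - G.leafGain s (i + 1)) = 0
  · have hb := hW _ (GainDatum.indep_triangle_singleton_next G.fixed_subsingleton h12 hi)
    rw [Finset.card_singleton] at hb
    have hd := GainDatum.one_le_dim_of_mulBalanced (h.mulBalanced_wheel_of_smul_eq h12 hi h0)
    omega
  · have hb := hW _ (GainDatum.indep_triangle_loop_pin hj G.fixed_subsingleton h12 h1 hi hiB h0
      fun ho h' => h2 ⟨ho, h'⟩)
    rw [Finset.card_pair (by omega)] at hb
    omega

/-- All new edges would be loops, with at most two free vertices in the wheel. If no relevant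
multiple kills all three gains, two loops are independent: `2 + 3 > 4`. Otherwise the wheel has
positive dimension and one loop of order greater than 2 is independent: `1 + 3 + 1 > 4`. -/
theorem IsStar.not_forall_leaf_eq (h : G.IsStar v s) (hj : 1 ≤ j) (hv : v ∉ G.fixed)
    (hinv : ∀ x y : Additive Γ, 2 • x = 0 → 2 • y = 0 → x ≠ 0 → y ≠ 0 → x = y)
    (hW : G.WheelBound v s j) {x : V} : ¬ ∀ i, G.leaf s i = x := by
  intro hn
  have hx : x ∉ G.fixed := hn 0 ▸ h.leaf_not_fixed (i' := 1) (by omega) ((hn _).trans (hn _).symm)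
  have hg : ∀ i, G.leafGain s (i + 2) - G.leafGain s (i + 1) ≠ 0 := fun i =>
    sub_ne_zero.2 (h.leafGain_ne (by omega) ((hn _).trans (hn _).symm))
  have hN := (h.card_freeVerts_wheel_le (A := {v, x}) (by simp)
    fun e _ => by simp [hn]).trans Finset.card_le_two
  have hp := h.not_pinned_wheel hv fun i => hn i ▸ hx
  by_cases hm : ∀ m, m = j ∨ m = j - 1 ∨ m = j + 1 →
      ∃ i, m • (G.leafGain s (i + 2) - G.leafGain s (i + 1)) ≠ 0
  · obtain ⟨e, f, hef, he, hf, hne⟩ := GainDatum.exists_triangle_pair hj hinv hg hm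
    have hb := hW _ (GainDatum.indep_triangle_two_loops hj hn hx hg hef hm he hf hne)
    rw [Finset.card_pair hef] at hb
    omega
  · push Not at hm
    obtain ⟨m, hmj, hm⟩ := hm
    have hgood : ∃ i, 2 • (G.leafGain s (i + 2) - G.leafGain s (i + 1)) ≠ 0 := by
      by_cases h' : 2 • (G.leafGain s (0 + 2) - G.leafGain s (0 + 1)) = 0
      · exact ⟨1, GainDatum.two_smul_triangle_ne hinv hg (by omega) h'⟩
      · exact ⟨0, h'⟩
    obtain ⟨i, hi⟩ := hgood
    have hi' : G.leaf s (i + 1) ∉ G.fixed := hn (i + 1) ▸ hx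
    have hb := hW {i} (GainDatum.indep_singleton_of_loop hj ((hn _).trans (hn _).symm)
      hi' (hg i) fun _ => hi)
    rw [Finset.card_singleton] at hb
    have hbal : (G.withTriangle s).MulBalanced m (G.wheel v) := by
      have hxv : v ≠ x := hn 0 ▸ (h.leaf_ne 0).symm
      refine h.mulBalanced_wheel (Function.update 0 x (m • G.leafGain s 0)) fun e _ => ?_
      have he : m • G.leafGain s e = m • G.leafGain s 0 := by
        have e1 := hm 1
        have e2 := hm 2
        simp only [smul_sub, sub_eq_zero] at e1 e2
        have : e = 0 ∨ e = 1 ∨ e = 2 := by omega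
        rcases this with rfl | rfl | rfl
        exacts [rfl, e2, e1.symm]
      simp [hn, hxv, he]
    have hd := (GainDatum.groupDim_pos_of hp hmj hbal).trans_le GainDatum.groupDim_le_dim
    omega

theorem IsStar.exists_fixed_leaf (h : G.IsStar v s) (hj : 1 ≤ j) (hv : v ∉ G.fixed)
    (hinv : ∀ x y : Additive Γ, 2 • x = 0 → 2 • y = 0 → x ≠ 0 → y ≠ 0 → x = y)
    (hW : G.WheelBound v s j) :
    Odd j ∧ ∃ i, G.leaf s (i + 1) = G.leaf s (i + 2) ∧ G.leaf s i ∈ G.fixed ∧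
      2 • (G.leafGain s (i + 2) - G.leafGain s (i + 1)) = 0 := by
  have hn := h.not_injective_leaf hv hW
  simp only [Function.Injective, not_forall] at hn
  obtain ⟨a, b, hab, hne⟩ := hn
  obtain ⟨i, h12⟩ : ∃ i, G.leaf s (i + 1) = G.leaf s (i + 2) := by
    have : (b + 1 = a ∧ b + 2 = a + 1) ∨ (a + 1 = b ∧ a + 2 = b + 1) := by omega
    rcases this with ⟨h1, h2⟩ | ⟨h1, h2⟩
    · exact ⟨a + 1, by rw [show a + 1 + 1 = b by omega, show a + 1 + 2 = a by omega, hab]⟩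
    · exact ⟨b + 1, by rw [show b + 1 + 1 = a by omega, show b + 1 + 2 = b by omega, hab]⟩
  have hi : G.leaf s i ≠ G.leaf s (i + 1) := fun h' =>
    h.not_forall_leaf_eq hj hv hinv hW fun e => by
      rcases leaf_cases h12 e with rfl | h''
      exacts [h', h'']
  have hiB := h.fixed_of_two_leaves hj hv hW h12 hi
  obtain ⟨h1, h2⟩ := h.two_smul_of_fixed hj hW h12 hi hiB
  exact ⟨h1, i, h12, hiB, h2⟩

end Cases

/-- In a cyclic group `a ^ 2 = 1` has at most two solutions. -/
theorem eq_of_sq_eq_one {Γ : Type*} [Group Γ] [Finite Γ] [IsCyclic Γ] {x y : Γ}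
    (hx : x ^ 2 = 1) (hy : y ^ 2 = 1) (hx1 : x ≠ 1) (hy1 : y ≠ 1) : x = y := by
  have := Fintype.ofFinite Γ
  by_contra hxy
  have h1 := IsCyclic.card_pow_eq_one_le (α := Γ) (n := 2) (by norm_num)
  have h2 : ({1, x, y} : Finset Γ) ⊆ Finset.univ.filter fun a => a ^ 2 = 1 := by
    intro a ha
    simp only [Finset.mem_insert, Finset.mem_singleton] at ha
    rcases ha with rfl | rfl | rfl <;> simp [*]
  have h3 := Finset.card_le_card h2
  rw [Finset.card_eq_three.2 ⟨1, x, y, hx1.symm, hy1.symm, hxy, rfl⟩] at h3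
  exact absurd (h3.trans (le_of_eq_of_le (by congr) h1)) (by norm_num)

end GainGraph

/-! ### The theorem -/

theorem mainTheorem3 {V E Γ : Type*} [Finite V] [Fintype E] [Group Γ]
    (k j : ℕ) (hk : 4 ≤ k) (hj : 2 ≤ j) (hjk : j + 2 ≤ k)
    (γ : Γ) (hγ : ∀ g : Γ, g ∈ Subgroup.zpowers γ) (hcard : Nat.card Γ = k)
    (G : GainGraph V E Γ) (hG : G.GainTight k j)
    (v : V) (hfree : v ∉ G.fixed) (hdeg : G.degree v = 3)
    (hloop : ∀ e, ¬ (G.src e = v ∧ G.tgt e = v))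
    (hno : ¬ G.HasAdmissibleOneReduction k j v) :
    Even k ∧ Odd j ∧
      ∃ v₁ v₂ : V, v₁ ≠ v₂ ∧ G.neighbors v = {v₁, v₂} ∧ v₁ ∉ G.fixed ∧ v₂ ∈ G.fixed ∧
        ∃ s t : E × Bool, s.1 ≠ t.1 ∧ G.tail s = v ∧ G.head s = v₁ ∧ G.IsWalk v [s, t] v ∧
          G.walkGain [s, t] = γ ^ (k / 2) := by
  have hcyc : IsCyclic Γ := ⟨γ, hγ⟩
  -- A cyclic group is commutative; the commutative structure extends the given one, so the
  -- statements about `G` keep their meaning.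
  obtain ⟨c, rfl⟩ : ∃ c : CommGroup Γ, c.toGroup = ‹Group Γ› :=
    ⟨{ ‹Group Γ› with mul_comm := hcyc.isMulCommutative.is_comm.comm }, rfl⟩
  have hfin : Finite Γ := Nat.finite_of_card_ne_zero (by omega)
  obtain ⟨s, hs⟩ := GainGraph.exists_isStar hdeg hloop
  obtain ⟨hodd, i, h12, hi, h2⟩ := hs.exists_fixed_leaf (j := j) (by omega) hfree
    (fun x y hx hy hx0 hy0 => GainGraph.eq_of_sq_eq_one (Γ := Γ) hx hy hx0 hy0)
    fun K hK => hs.card_add_dim_wheel_le (by omega) hcard hG hfree hdeg hloop hno hK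
  have hg : G.stepGain (s (i + 1)) ≠ G.stepGain (s (i + 2)) :=
    hs.leafGain_ne (i := i + 1) (i' := i + 2) (by omega) h12
  have h1 : G.leaf s (i + 1) ∉ G.fixed := hs.leaf_not_fixed (by omega) h12
  have hsq : (G.stepGain (s (i + 1)) * (G.stepGain (s (i + 2)))⁻¹) ^ 2 = 1 := by
    have h2' : (G.stepGain (s (i + 2)) / G.stepGain (s (i + 1))) ^ 2 = 1 := h2
    rw [← div_eq_mul_inv, ← inv_div, inv_pow, h2', inv_one]
  have hne : G.stepGain (s (i + 1)) * (G.stepGain (s (i + 2)))⁻¹ ≠ 1 := fun h =>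
    hg (mul_inv_eq_one.1 h)
  have hord : orderOf γ = k := (orderOf_eq_card_of_forall_mem_zpowers hγ).trans hcard
  have heven : 2 ∣ k := by
    rw [← orderOf_eq_prime hsq hne, ← hcard]
    exact orderOf_dvd_natCard _
  refine ⟨even_iff_two_dvd.2 heven, hodd, G.leaf s (i + 1), G.leaf s i, fun h => h1 (h ▸ hi), ?_,
    h1, hi, s (i + 1), GainGraph.revStep (s (i + 2)), fun h => ?_, hs.tail _, rfl, ?_, ?_⟩
  · ext w
    constructor
    · rintro ⟨t, ht, rfl⟩
      obtain ⟨e, he⟩ := hs.complete t.1 (by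
        obtain ⟨e, _ | _⟩ := t
        exacts [Or.inr ht, Or.inl ht])
      have het : G.head t = G.leaf s e := by
        have h3 := hs.tail e
        have h4 := hloop t.1
        unfold GainGraph.leaf
        obtain ⟨e', b⟩ := t
        rcases hse : s e with ⟨e'', b'⟩
        rw [hse] at h3 he
        obtain rfl : e'' = e' := he
        cases b <;> cases b' <;> simp only [GainGraph.tail] at ht h3 <;> first | rfl | tauto
      rw [het]
      rcases GainGraph.leaf_cases h12 e with rfl | h'
      exacts [Or.inr rfl, Or.inl h']
    · rintro (rfl | rfl)
      exacts [⟨_, hs.tail _, rfl⟩, ⟨_, hs.tail _, rfl⟩]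
  · have : i + 1 = i + 2 := hs.inj h
    omega
  · refine ⟨hs.tail _, ?_, ?_⟩
    · rw [GainGraph.tail_revStep]
      exact h12.symm
    · rw [GainGraph.head_revStep]
      exact hs.tail _
  -- The gain of the 2-cycle and `γ ^ (k / 2)` are both involutions, hence equal.
  · have hγ2 : (γ ^ (k / 2)) ^ 2 = 1 := by
      rw [← pow_mul, Nat.div_mul_cancel heven, ← hord, pow_orderOf_eq_one]
    have hγ1 : γ ^ (k / 2) ≠ 1 := pow_ne_one_of_lt_orderOf (by omega) (by omega)
    rw [← GainGraph.eq_of_sq_eq_one hsq hγ2 hne hγ1]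
    simp [GainGraph.walkGain, GainGraph.stepGain_revStep]
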